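/- Let $n\ge 1$. Let $S_n$ be the group of permutations of $\{1,\dots,n\}$ (products are compositions of maps), with simple transpositions $s_i=(i\;i{+}1)$, length $\ell(u)$ (the number of inversions of $u$) and Bruhat order $\le$. For $u\in S_n$ with reduced word $u=s_{i_1}\cdots s_{i_\ell}$, let $\beta(u)=\sigma_{i_1}\cdots\sigma_{i_\ell}$ in the braid group on $n$ strands. For an oriented link $L$, let $P(L)=P(L;a,z)\in\mathbb Z[a^{\pm1},z^{\pm1}]$ be the HOMFLY polynomial, given by $aP(L_+)-a^{-1}P(L_-)=zP(L_0)$ and $P(\text{unknot})=1$, where $L_+,L_-,L_0$ differ in one crossing which is $\sigma_i$, $\sigma_i^{-1}$ and smoothed, respectively. For $v,w\in S_n$ let $P_{v,w}$ be the HOMFLY polynomial of the closure of the braid $\beta(w)\beta(v)^{-1}$, and put $\ell_{v,w}=\ell(w)-\ell(v)$ and $\kappa_{v,w}=n-1-\ell_{v,w}$. Let $R_v^w\in\mathbb Z[q]$ be the Kazhdan–Lusztig $R$-polynomial: $R_v^w=0$ if $v\not\le w$, $R_v^w=1$ if $v=w$, and for $v<w$ and any simple transposition $s$ with $sw<w$,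 $R_v^w=R_{sv}^{sw}$ if $sv<v$, and $R_v^w=(q-1)R_{sv}^{w}+qR_{sv}^{sw}$ if $sv>v$. For a field $F$, let $B$ and $B_-$ be the groups of upper and of lower triangular invertible $n\times n$ matrices over $F$, and let $\mathcal R_v^w(F)=(BwB\cap B_-vB)/B\subset GL_n(F)/B$ be the set of $F$-points of the open Richardson variety. **(A)** For all $v,w\in S_n$, and for any choice of the reduced words: 1. if $v\not\le w$, then the maximal degree of $a$ in $P_{v,w}$ is $<\kappa_{v,w}$; 2. if $v\le w$, then the maximal degree of $a$ in $P_{v,w}$ equals $\kappa_{v,w}$; 3. if $P^{\mathrm{top}}_{v,w}(q)$ is obtained from $a^{\kappa_{v,w}}\cdot\bigl([a^{\kappa_{v,w}}]P_{v,w}\bigr)$ by the substitution $a=q^{-1/2}$, $z=q^{1/2}-q^{-1/2}$, then $R_v^w(q)=(q-1)^{n-1}\,P^{\mathrm{top}}_{v,w}(q)$ (as rational functions in $q^{1/2}$). **(B)** For all $v,w\in S_n$ and every finite field $F$ with $q$ elements, $\#\mathcal R_v^w(F)=R_v^w(q)$. **(C)** Let $k\ge0$, and let $f$ be a $(k,n)$-bounded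 affine permutation, that is, a bijection $f:\mathbb Z\to\mathbb Z$ with $f(j+n)=f(j)+n$ and $j\le f(j)\le j+n$ for all $j$, and $\sum_{j=1}^n(f(j)-j)=kn$. For $u\in S_n$ let $\tilde u:\mathbb Z\to\mathbb Z$ be its extension with $\tilde u(j+n)=\tilde u(j)+n$, and let $\tau_{k,n}(j)=j+n$ if $j$ is congruent modulo $n$ to one of $1,\dots,k$, and $\tau_{k,n}(j)=j$ otherwise. Then there is exactly one pair $v,w\in S_n$ such that $v\le w$, $w^{-1}(1)<\dots<w^{-1}(k)$, $w^{-1}(k+1)<\dots<w^{-1}(n)$ and $f=\tilde v^{-1}\circ\tau_{k,n}\circ\tilde w$. For a field $F$, let $\Pi_f^\circ(F)$ be the set of $F$-points of the open positroid variety of $f$: the row spans of the $k\times n$ matrices $A$ over $F$ of rank $k$, with columns $A_j$ ($j\in\mathbb Z$, $A_{j+n}=A_j$), such that $f(i)=\min\{j\ge i: A_i\in\operatorname{Span}(A_{i+1},\dots,A_j)\}$ for all $i\in\mathbb Z$. Then for every finite field $F$ with $q$ elements $$\#\Pi_f^\circ(F)=(q-1)^{n-1}\,P_f^{\mathrm{top}}(q),$$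 where $P_f^{\mathrm{top}}(q)$ is obtained from the term of top degree in $a$ of the HOMFLY polynomial $P_{v,w}$ of the link of $f$, the closure of $\beta(w)\beta(v)^{-1}$, by the substitution $a=q^{-1/2}$, $z=q^{1/2}-q^{-1/2}$. -/

import Mathlib

/-! ### Symmetric groups: length, reduced words, Bruhat order -/

section SymmetricGroup

/-- The number of inversions of a permutation of `{0, …, n-1}`. -/
def permLength {n : ℕ} (w : Equiv.Perm (Fin n)) : ℕ :=
  (Finset.univ.filter fun p : Fin n × Fin n => p.1 < p.2 ∧ w p.2 < w p.1).card

theorem permLength_le {n : ℕ} (w : Equiv.Perm (Fin n)) : permLength w ≤ n * n := by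
  refine (Finset.card_le_univ _).trans ?_
  simp

/-- The simple transpositions; the index `i : Fin (n - 1)` stands for the transposition of the
`i`-th and the `(i+1)`-st point (counted from `0`). -/
def simpleSwap (n : ℕ) (i : Fin (n - 1)) : Equiv.Perm (Fin n) :=
  Equiv.swap ⟨i.1, by omega⟩ ⟨i.1 + 1, by omega⟩

/-- `a = [i₁, …, i_ℓ]` is a reduced word of `u`: `u = s_{i₁} ⋯ s_{i_ℓ}` with `ℓ` the length
of `u`. -/
def IsReducedWord {n : ℕ} (a : List (Fin (n - 1))) (u : Equiv.Perm (Fin n)) : Prop :=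
  (a.map (simpleSwap n)).prod = u ∧ a.length = permLength u

/-- The (strong) Bruhat order: `v ≤ w` if `w` is reached from `v` by successive multiplications by
transpositions, each of which increases the length. -/
def BruhatLE {n : ℕ} (v w : Equiv.Perm (Fin n)) : Prop :=
  Relation.ReflTransGen
    (fun x y : Equiv.Perm (Fin n) =>
      ∃ i j : Fin n, i ≠ j ∧ y = x * Equiv.swap i j ∧ permLength x < permLength y) v w

end SymmetricGroup

/-! ### Kazhdan–Lusztig `R`-polynomials -/

section RPolynomial

open Classical in
/-- The Kazhdan–Lusztig polynomial `R_v^w ∈ ℤ[q]`: it is `1` for `v = w`, it is `0` for `v ≰ w`,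
and for `v < w` one picks any simple transposition `s` with `s w < w` and puts
`R_v^w = R_{sv}^{sw}` if `s v < v`, and `R_v^w = (q - 1) R_{sv}^w + q R_{sv}^{sw}` if `s v > v`.
(Since `ℓ(sv) = ℓ(v) ± 1`, and some `s` with `s w < w` exists for `w ≠ 1`, the two branches with
the value `0` at the end are never reached.) -/
noncomputable def klR {n : ℕ} (v w : Equiv.Perm (Fin n)) : Polynomial ℤ :=
  if v = w then 1
  else if ¬ BruhatLE v w then 0
  else if h : ∃ i : Fin (n - 1), permLength (simpleSwap n i * w) < permLength w then
    if permLength (simpleSwap n h.choose * v) < permLength v then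
      klR (simpleSwap n h.choose * v) (simpleSwap n h.choose * w)
    else if permLength v < permLength (simpleSwap n h.choose * v) then
      (Polynomial.X - 1) * klR (simpleSwap n h.choose * v) w
        + Polynomial.X * klR (simpleSwap n h.choose * v) (simpleSwap n h.choose * w)
    else 0
  else 0
termination_by (permLength w, n * n - permLength v)
decreasing_by
  · exact Prod.Lex.left _ _ h.choose_spec
  · have hle := permLength_le (simpleSwap n h.choose * v)
    exact Prod.Lex.right _ (by omega)
  · exact Prod.Lex.left _ _ h.choose_spec

end RPolynomial

/-! ### Braid groups, closures of braids, oriented links -/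

section Braids

/-- The braid relations `σ_i σ_{i+1} σ_i = σ_{i+1} σ_i σ_{i+1}` and `σ_i σ_j = σ_j σ_i` for
`|i - j| > 1`. -/
def braidRels (n : ℕ) : Set (FreeGroup (Fin (n - 1))) :=
  {r | ∃ i j : Fin (n - 1),
    (i.1 + 1 = j.1 ∧
      r = (FreeGroup.of i * FreeGroup.of j * FreeGroup.of i)
        * (FreeGroup.of j * FreeGroup.of i * FreeGroup.of j)⁻¹) ∨
    (i.1 + 1 < j.1 ∧
      r = (FreeGroup.of i * FreeGroup.of j) * (FreeGroup.of j * FreeGroup.of i)⁻¹)}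

/-- The braid group on `n` strands. -/
abbrev BraidGroup (n : ℕ) : Type := PresentedGroup (braidRels n)

/-- The Artin generators `σ_i` of the braid group. -/
def braidGen (n : ℕ) (i : Fin (n - 1)) : BraidGroup n := PresentedGroup.of i

theorem braidGen_braid (n : ℕ) (i j : Fin (n - 1)) (h : i.1 + 1 = j.1) :
    braidGen n i * braidGen n j * braidGen n i
      = braidGen n j * braidGen n i * braidGen n j := by
  have hr := PresentedGroup.one_of_mem (rels := braidRels n)
    (x := (FreeGroup.of i * FreeGroup.of j * FreeGroup.of i)
        * (FreeGroup.of j * FreeGroup.of i * FreeGroup.of j)⁻¹) ⟨i, j, Or.inl ⟨h, rfl⟩⟩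
  rw [map_mul, map_inv, mul_inv_eq_one] at hr
  simp only [map_mul] at hr
  exact hr

theorem braidGen_comm (n : ℕ) (i j : Fin (n - 1)) (h : i.1 + 1 < j.1) :
    braidGen n i * braidGen n j = braidGen n j * braidGen n i := by
  have hr := PresentedGroup.one_of_mem (rels := braidRels n)
    (x := (FreeGroup.of i * FreeGroup.of j) * (FreeGroup.of j * FreeGroup.of i)⁻¹)
    ⟨i, j, Or.inr ⟨h, rfl⟩⟩
  rw [map_mul, map_inv, mul_inv_eq_one] at hr
  simp only [map_mul] at hr
  exact hr

/-- The inclusion of the braid group on `n` strands in the braid group on `n + 1` strands which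
adds a last strand that crosses nothing: `σ_i ↦ σ_i`. -/
def braidIncl (n : ℕ) : BraidGroup n →* BraidGroup (n + 1) :=
  PresentedGroup.toGroup (f := fun i : Fin (n - 1) => braidGen (n + 1) ⟨i.1, by omega⟩) <| by
    rintro r ⟨i, j, ⟨h, rfl⟩ | ⟨h, rfl⟩⟩
    · rw [map_mul, map_inv, mul_inv_eq_one]
      simp only [map_mul, FreeGroup.lift_apply_of]
      exact braidGen_braid (n + 1) ⟨i.1, by omega⟩ ⟨j.1, by omega⟩ h
    · rw [map_mul, map_inv, mul_inv_eq_one]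
      simp only [map_mul, FreeGroup.lift_apply_of]
      exact braidGen_comm (n + 1) ⟨i.1, by omega⟩ ⟨j.1, by omega⟩ h

/-- The last Artin generator of the braid group on `n + 1` strands, which crosses the strand added
by `braidIncl n` with the one before it. -/
def braidLast (n : ℕ) (hn : 0 < n) : BraidGroup (n + 1) :=
  braidGen (n + 1) ⟨n - 1, by omega⟩

/-- A braid on a positive number of strands, to be closed up. -/
structure ClosedBraid where
  strands : ℕ
  pos : 0 < strands
  braid : BraidGroup strands

/-- The Markov moves: conjugation, and positive and negative stabilization. -/
inductive MarkovMove : ClosedBraid → ClosedBraid → Prop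
  | conj (n : ℕ) (hn : 0 < n) (α β : BraidGroup n) :
      MarkovMove ⟨n, hn, α * β⟩ ⟨n, hn, β * α⟩
  | stabPos (n : ℕ) (hn : 0 < n) (β : BraidGroup n) :
      MarkovMove ⟨n, hn, β⟩ ⟨n + 1, n.succ_pos, braidIncl n β * braidLast n hn⟩
  | stabNeg (n : ℕ) (hn : 0 < n) (β : BraidGroup n) :
      MarkovMove ⟨n, hn, β⟩ ⟨n + 1, n.succ_pos, braidIncl n β * (braidLast n hn)⁻¹⟩

/-- Isotopy classes of (nonempty, tame) oriented links in `ℝ³`. Every such link is the closure of a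
braid, and two braids have isotopic closures if and only if they are connected by a chain of Markov
moves and their inverses (Alexander, Markov); a link is therefore a class of braids for the
equivalence relation generated by the Markov moves. -/
def OrientedLink : Type := Quot MarkovMove

/-- The closure of a braid. -/
def braidClosure {n : ℕ} [NeZero n] (β : BraidGroup n) : OrientedLink :=
  Quot.mk MarkovMove ⟨n, NeZero.pos n, β⟩

/-- The unknot: the closure of the braid with one strand. -/
def unknot : OrientedLink := braidClosure (1 : BraidGroup 1)

/-- The braid `σ_{i₁} ⋯ σ_{i_ℓ}` of a word `[i₁, …, i_ℓ]`. If the word is a reduced word of a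
permutation `u`, this is the positive permutation braid `β(u)`. -/
def braidOfWord {n : ℕ} (a : List (Fin (n - 1))) : BraidGroup n := (a.map (braidGen n)).prod

end Braids

/-! ### The HOMFLY polynomial -/

section Homfly

/-- Laurent polynomials in `a` with coefficients in the Laurent polynomials in `z`, that is,
the ring `ℤ[a^{±1}, z^{±1}]`. -/
abbrev LaurentAZ : Type := LaurentPolynomial (LaurentPolynomial ℤ)

/-- The monomial `a ^ k`. -/
noncomputable def varA (k : ℤ) : LaurentAZ := LaurentPolynomial.T k

/-- The variable `z`. -/
noncomputable def varZ : LaurentAZ := LaurentPolynomial.C (LaurentPolynomial.T 1)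

/-- The skein relation `a P(L₊) - a⁻¹ P(L₋) = z P(L₀)` together with the normalization
`P(unknot) = 1`. The triples `(L₊, L₋, L₀)` are the closures of `β σ_i`, `β σ_i⁻¹` and `β`; a
crossing at any other place of a closed braid is moved to the end by a conjugation. -/
structure IsHomfly (P : OrientedLink → LaurentAZ) : Prop where
  unknot : P unknot = 1
  skein : ∀ (n : ℕ) [NeZero n] (β : BraidGroup n) (i : Fin (n - 1)),
    varA 1 * P (braidClosure (β * braidGen n i))
        - varA (-1) * P (braidClosure (β * (braidGen n i)⁻¹))
      = varZ * P (braidClosure β)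

/-- The HOMFLY polynomial, the link invariant which is determined by the skein relation and its
value at the unknot. -/
noncomputable def homfly : OrientedLink → LaurentAZ := Classical.epsilon IsHomfly

/-- The term `a^κ · [a^κ] P` of `P`, after the substitution `a = q^{-1/2}`,
`z = q^{1/2} - q^{-1/2}`, where `t = q^{1/2}`. -/
noncomputable def substTerm {K : Type*} [Field K] (P : LaurentAZ) (κ : ℤ) (t : K) : K :=
  (t⁻¹) ^ κ * (P.coeff κ).coeff.sum fun k c => (c : K) * (t - t⁻¹) ^ k

/-- The term of `P` of the top degree in `a`, after the same substitution. -/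
noncomputable def substTopTerm {K : Type*} [Field K] (P : LaurentAZ) (t : K) : K :=
  substTerm P (P.degree.unbotD 0) t

/-- The number `n - 1 - (ℓ(w) - ℓ(v))`. -/
def topDegree {n : ℕ} (v w : Equiv.Perm (Fin n)) : ℤ :=
  (n : ℤ) - 1 - ((permLength w : ℤ) - (permLength v : ℤ))

end Homfly

/-! ### Open Richardson varieties in the flag variety -/

section Richardson

/-- The subgroup of upper triangular matrices of `GL_n(F)`. -/
def upperBorel (n : ℕ) (F : Type*) [Field F] : Subgroup (Matrix.GeneralLinearGroup (Fin n) F) where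
  carrier := {g | g.1.BlockTriangular id}
  mul_mem' {g h} hg hh := by
    change (g.1 * h.1).BlockTriangular id
    exact Matrix.BlockTriangular.mul hg hh
  one_mem' := Matrix.blockTriangular_one
  inv_mem' {g} hg := by
    change (g⁻¹).1.BlockTriangular id
    rw [Matrix.coe_units_inv]
    have : Invertible g.1 := g.invertible
    exact Matrix.blockTriangular_inv_of_blockTriangular hg

/-- The lower triangular invertible matrices. -/
def lowerBorel (n : ℕ) (F : Type*) [Field F] : Set (Matrix.GeneralLinearGroup (Fin n) F) :=
  {g | ∀ i j : Fin n, i < j → g.1 i j = 0}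

/-- The matrix of a permutation, which sends the basis vector `e_j` to `e_{w(j)}`. -/
def permMat (F : Type*) [Field F] {n : ℕ} (w : Equiv.Perm (Fin n)) : Matrix (Fin n) (Fin n) F :=
  Matrix.of fun i j => if i = w j then 1 else 0

/-- The `F`-points of the open Richardson variety `(B w B ∩ B₋ v B) / B`, in the set of the
`F`-points `GL_n(F) / B(F) = PGL_n(F) / B(F)` of the flag variety. -/
def richardson (F : Type*) [Field F] {n : ℕ} (v w : Equiv.Perm (Fin n)) :
    Set (Matrix.GeneralLinearGroup (Fin n) F ⧸ upperBorel n F) :=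
  {x | ∃ g : Matrix.GeneralLinearGroup (Fin n) F, QuotientGroup.mk g = x ∧
    (∃ b ∈ upperBorel n F, ∃ b' ∈ upperBorel n F, g.1 = b.1 * permMat F w * b'.1) ∧
    (∃ c ∈ lowerBorel n F, ∃ c' ∈ upperBorel n F, g.1 = c.1 * permMat F v * c'.1)}

end Richardson

/-! ### Open positroid varieties

The points and columns `1, …, n` are numbered `0, …, n-1`, with the corresponding shift of the
bijections of `ℤ`. -/

section Positroid

/-- The residue of an integer modulo `n`. -/
def residue (n : ℕ) [NeZero n] (j : ℤ) : Fin n :=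
  ⟨(j % (n : ℤ)).toNat, by
    have hn : (0 : ℤ) < n := by exact_mod_cast NeZero.pos n
    have h1 := Int.emod_lt_of_pos j hn
    have h0 := Int.emod_nonneg j hn.ne'
    omega⟩

/-- `(k, n)`-bounded affine permutations. -/
structure IsBoundedAffine (k n : ℕ) (f : ℤ → ℤ) : Prop where
  bijective : Function.Bijective f
  periodic : ∀ j, f (j + n) = f j + n
  sum_eq : ∑ j ∈ Finset.range n, (f j - j) = (k : ℤ) * n
  le : ∀ j, j ≤ f j
  le_add : ∀ j, f j ≤ j + n

/-- The bijection `ũ` of `ℤ` with `ũ(j + n) = ũ(j) + n` which extends the permutation `u`. -/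
def affineExt {n : ℕ} [NeZero n] (u : Equiv.Perm (Fin n)) (j : ℤ) : ℤ :=
  (j / (n : ℤ)) * n + ((u (residue n j)).1 : ℤ)

/-- The bounded affine permutation which adds `n` to the first `k` of the residues modulo `n`, and
fixes the others. -/
def tauAffine (k n : ℕ) [NeZero n] (j : ℤ) : ℤ :=
  if (residue n j).1 < k then j + n else j

/-- `k`-Grassmannian permutations: `w⁻¹(1) < ⋯ < w⁻¹(k)` and `w⁻¹(k+1) < ⋯ < w⁻¹(n)`. -/
def IsGrassmannian (k : ℕ) {n : ℕ} (w : Equiv.Perm (Fin n)) : Prop :=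
  ∀ i j : Fin n, i < j → (j.1 < k ∨ k ≤ i.1) → w⁻¹ i < w⁻¹ j

/-- `f = f_{v,w}`, that is, `v ≤ w`, `w` is `k`-Grassmannian, and `f = ṽ⁻¹ ∘ τ ∘ w̃`. -/
structure IsAffineOf (k : ℕ) {n : ℕ} [NeZero n] (f : ℤ → ℤ) (v w : Equiv.Perm (Fin n)) :
    Prop where
  le : BruhatLE v w
  grassmannian : IsGrassmannian k w
  eq : f = affineExt v⁻¹ ∘ tauAffine k n ∘ affineExt w

/-- The columns `A_j`, `j ∈ ℤ`, of a `k × n` matrix, repeated periodically. -/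
def periodicCol {F : Type*} {k n : ℕ} [NeZero n] (A : Matrix (Fin k) (Fin n) F) (j : ℤ) :
    Fin k → F :=
  fun r => A r (residue n j)

/-- The `F`-points of the open positroid variety of `f`: the row spans of the `k × n` matrices `A`
of full rank such that, for every `i`, the least `j ≥ i` with
`A_i ∈ Span (A_{i+1}, …, A_j)` is `f(i)`. -/
def positroid (F : Type*) [Field F] (k n : ℕ) [NeZero n] (f : ℤ → ℤ) :
    Set (Submodule F (Fin n → F)) :=
  {V | ∃ A : Matrix (Fin k) (Fin n) F, LinearIndependent F A.row ∧
    Submodule.span F (Set.range A.row) = V ∧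
    ∀ i : ℤ, IsLeast {j : ℤ | i ≤ j ∧
      periodicCol A i ∈ Submodule.span F (periodicCol A '' Set.Ioc i j)} (f i)}

end Positroid

/-! Everything rests on recursions along a left descent: w = su with ℓ(w) = ℓ(u) + 1.

Point counts. The Schubert cell of w is the product of an affine line and the cell of u, through (x,
y) ↦ c(x)y, where c(x) is the 2×2 block matrix `curveGL`. For fixed y, the opposite cell that
contains c(x)y is decided by one 2×2 block. Let ℓ(sv) > ℓ(v). If y lies in the opposite cell of v,
then c(x)y stays in that cell for q - 1 values of x and falls into the cell of sv for one value. If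
y lies in the cell of sv, all q values lead to the cell of v. Summing over y gives the R-recursion
(`card_richardson_asc`, `card_richardson_desc`). Its coefficients are positive, so by the lifting
property the count is nonzero exactly for v ≤ w. Since a polynomial is determined by its values at
the primes, the counts also show that `klR` satisfies the recursion for every descent, although its
definition fixes one.

The HOMFLY polynomial. The Hecke algebra with T² = 1 + zT acts on functions on the permutations of
ℕ, and its canonical trace τ is the coefficient of the identity. Inserting the central element ∏(1 -
bJ), a product over Jucys–Murphy elements, turns τ into a Markov trace: positive stabilization
multiplies it by z, negative stabilization by bz. With b = a⁻² and the normalization a^(n-1-e)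
z^(1-n), e being the exponent sum, this is a link invariant that satisfies the skein relation. It is
the only one, because the skein relation reduces every braid to braids in which the last generator
occurs at most once. The Markov trace is a polynomial in b = a⁻². Hence the degree in a is at most n
- 1 - e = κ, and the coefficient at κ is the value at b = 0, namely z^(1-n) times τ of β(w)β(v)⁻¹.
This τ satisfies the R-recursion up to a power of q^(1/2) (`traceCoeff_cons`,
`aeval_klR_eq_traceCoeff`). It vanishes for v ≰ w. For v ≤ w it is nonzero, since R at q = 2 counts
the points of a nonempty Richardson variety over the field with two elements.

Positroids. Every point of the cell of w has a unique normal form. For Grassmannian w its last n - k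
rows are unit vectors and its first k rows are in reduced echelon form, so the row span of the
latter determines the point. If the point lies in the opposite cell of v, the columns satisfy A_i ∈
Span(A_{i+1}, …, A_{f(i)}) (`IsNormalForm.mem_colSpan`), and minimality of f(i) is then automatic by
a dimension count (`isLeast_of_mem_colSpan`). Conversely, the echelon form of a point of the
positroid variety lies in some opposite cell v'. Minimality gives f_{v,w} ≤ f_{v',w} pointwise, and
equality of sums forces v = v'. Thus the positroid and the Richardson variety have equally many
points. -/

/-! ### Length and simple transpositions -/

section Length

variable {n : ℕ}

/-- The first of the two points exchanged by a simple transposition. -/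
def loPt (i : Fin (n - 1)) : Fin n := ⟨i.1, by omega⟩

/-- The second of the two points exchanged by a simple transposition. -/
def hiPt (i : Fin (n - 1)) : Fin n := ⟨i.1 + 1, by omega⟩

theorem loPt_val (i : Fin (n - 1)) : (loPt i).1 = i.1 := rfl

theorem hiPt_val (i : Fin (n - 1)) : (hiPt i).1 = i.1 + 1 := rfl

theorem loPt_lt_hiPt (i : Fin (n - 1)) : loPt i < hiPt i := by
  rw [Fin.lt_def, loPt_val, hiPt_val]; omega

theorem loPt_ne_hiPt (i : Fin (n - 1)) : loPt i ≠ hiPt i := (loPt_lt_hiPt i).ne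

theorem simpleSwap_eq (i : Fin (n - 1)) : simpleSwap n i = Equiv.swap (loPt i) (hiPt i) := rfl

theorem simpleSwap_mul_self (i : Fin (n - 1)) : simpleSwap n i * simpleSwap n i = 1 :=
  Equiv.swap_mul_self _ _

theorem simpleSwap_inv (i : Fin (n - 1)) : (simpleSwap n i)⁻¹ = simpleSwap n i :=
  Equiv.swap_inv _ _

theorem simpleSwap_mul_cancel (i : Fin (n - 1)) (w : Equiv.Perm (Fin n)) :
    simpleSwap n i * (simpleSwap n i * w) = w := by
  rw [← mul_assoc, simpleSwap_mul_self, one_mul]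

theorem simpleSwap_mul_eq (i : Fin (n - 1)) (w : Equiv.Perm (Fin n)) :
    simpleSwap n i * w = w * Equiv.swap (w⁻¹ (loPt i)) (w⁻¹ (hiPt i)) := by
  rw [simpleSwap_eq, Equiv.mul_swap_eq_swap_mul]
  simp

theorem simpleSwap_lo (i : Fin (n - 1)) : simpleSwap n i (loPt i) = hiPt i :=
  Equiv.swap_apply_left _ _

theorem simpleSwap_hi (i : Fin (n - 1)) : simpleSwap n i (hiPt i) = loPt i :=
  Equiv.swap_apply_right _ _

theorem simpleSwap_of_ne (i : Fin (n - 1)) {a : Fin n} (h1 : a ≠ loPt i) (h2 : a ≠ hiPt i) :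
    simpleSwap n i a = a :=
  Equiv.swap_apply_of_ne_of_ne h1 h2

theorem simpleSwap_mul_inv_lo (i : Fin (n - 1)) (w : Equiv.Perm (Fin n)) :
    (simpleSwap n i * w)⁻¹ (loPt i) = w⁻¹ (hiPt i) := by
  rw [mul_inv_rev, simpleSwap_inv, Equiv.Perm.mul_apply, simpleSwap_lo]

theorem simpleSwap_mul_inv_hi (i : Fin (n - 1)) (w : Equiv.Perm (Fin n)) :
    (simpleSwap n i * w)⁻¹ (hiPt i) = w⁻¹ (loPt i) := by
  rw [mul_inv_rev, simpleSwap_inv, Equiv.Perm.mul_apply, simpleSwap_hi]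

theorem simpleSwap_mul_inv_of_ne (i : Fin (n - 1)) (w : Equiv.Perm (Fin n)) {a : Fin n}
    (h1 : a ≠ loPt i) (h2 : a ≠ hiPt i) :
    (simpleSwap n i * w)⁻¹ a = w⁻¹ a := by
  rw [mul_inv_rev, simpleSwap_inv, Equiv.Perm.mul_apply, simpleSwap_of_ne i h1 h2]

/-- A simple transposition preserves the order of all pairs but the one it exchanges. -/
theorem simpleSwap_lt_iff (i : Fin (n - 1)) {a b : Fin n}
    (h : ¬ (a = loPt i ∧ b = hiPt i)) (h' : ¬ (a = hiPt i ∧ b = loPt i)) :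
    simpleSwap n i a < simpleSwap n i b ↔ a < b := by
  rw [simpleSwap_eq, Equiv.swap_apply_def, Equiv.swap_apply_def]
  simp only [Fin.ext_iff, loPt_val, hiPt_val] at h h' ⊢
  split_ifs <;> simp only [Fin.lt_def, loPt_val, hiPt_val] <;> omega

theorem permLength_inv (w : Equiv.Perm (Fin n)) : permLength w⁻¹ = permLength w := by
  unfold permLength
  refine Finset.card_bij' (fun p _ => (w⁻¹ p.2, w⁻¹ p.1)) (fun p _ => (w p.2, w p.1)) ?_ ?_ ?_ ?_
  all_goals simp +contextual

/-- The inversion set of a permutation. -/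
def inversions (w : Equiv.Perm (Fin n)) : Finset (Fin n × Fin n) :=
  Finset.univ.filter fun p : Fin n × Fin n => p.1 < p.2 ∧ w p.2 < w p.1

theorem mem_inversions {w : Equiv.Perm (Fin n)} {p : Fin n × Fin n} :
    p ∈ inversions w ↔ p.1 < p.2 ∧ w p.2 < w p.1 := by simp [inversions]

theorem permLength_eq_card (w : Equiv.Perm (Fin n)) : permLength w = (inversions w).card := rfl

/-- Only the pair of positions that carry the values `loPt i` and `hiPt i` changes its relative
order, so the inversion set gains exactly this pair. -/
theorem permLength_simpleSwap_mul_of_lt {w : Equiv.Perm (Fin n)} {i : Fin (n - 1)}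
    (h : w⁻¹ (loPt i) < w⁻¹ (hiPt i)) : permLength (simpleSwap n i * w) = permLength w + 1 := by
  have hw : inversions (simpleSwap n i * w)
      = insert (w⁻¹ (loPt i), w⁻¹ (hiPt i)) (inversions w) := by
    ext ⟨a, b⟩
    rw [Finset.mem_insert, mem_inversions, mem_inversions, Prod.mk.injEq, Equiv.Perm.mul_apply,
      Equiv.Perm.mul_apply]
    simp only
    by_cases h1 : w b = loPt i ∧ w a = hiPt i
    · obtain rfl : b = w⁻¹ (loPt i) := by rw [← h1.1]; simp
      obtain rfl : a = w⁻¹ (hiPt i) := by rw [← h1.2]; simp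
      constructor
      · intro hh; exact absurd hh.1 (not_lt.2 h.le)
      · rintro (hh | hh)
        · exact absurd hh.1.symm h.ne
        · exact absurd hh.1 (not_lt.2 h.le)
    by_cases h2 : w b = hiPt i ∧ w a = loPt i
    · obtain rfl : b = w⁻¹ (hiPt i) := by rw [← h2.1]; simp
      obtain rfl : a = w⁻¹ (loPt i) := by rw [← h2.2]; simp
      refine iff_of_true ⟨h, ?_⟩ (Or.inl ⟨rfl, rfl⟩)
      rw [h2.1, h2.2, simpleSwap_lo, simpleSwap_hi]
      exact loPt_lt_hiPt i
    rw [simpleSwap_lt_iff i h1 h2]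
    constructor
    · exact Or.inr
    · rintro (⟨rfl, rfl⟩ | hh)
      · exact absurd (by simp) h2
      · exact hh
  rw [permLength_eq_card, hw, Finset.card_insert_of_notMem, ← permLength_eq_card]
  rw [mem_inversions]
  simp [(loPt_lt_hiPt i).le]

theorem permLength_simpleSwap_mul_of_gt {w : Equiv.Perm (Fin n)} {i : Fin (n - 1)}
    (h : w⁻¹ (hiPt i) < w⁻¹ (loPt i)) : permLength (simpleSwap n i * w) + 1 = permLength w := by
  have := permLength_simpleSwap_mul_of_lt (w := simpleSwap n i * w) (i := i)
    (by rwa [simpleSwap_mul_inv_lo, simpleSwap_mul_inv_hi])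
  rw [simpleSwap_mul_cancel] at this
  exact this.symm

theorem inv_lo_ne_inv_hi (w : Equiv.Perm (Fin n)) (i : Fin (n - 1)) :
    w⁻¹ (loPt i) ≠ w⁻¹ (hiPt i) := fun h => loPt_ne_hiPt i (w⁻¹.injective h)

theorem inv_lo_lt_or (w : Equiv.Perm (Fin n)) (i : Fin (n - 1)) :
    w⁻¹ (loPt i) < w⁻¹ (hiPt i) ∨ w⁻¹ (hiPt i) < w⁻¹ (loPt i) :=
  lt_or_gt_of_ne (inv_lo_ne_inv_hi w i)

theorem permLength_lt_simpleSwap_mul_iff {w : Equiv.Perm (Fin n)} {i : Fin (n - 1)} :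
    permLength w < permLength (simpleSwap n i * w) ↔ w⁻¹ (loPt i) < w⁻¹ (hiPt i) := by
  rcases inv_lo_lt_or w i with h | h
  · exact iff_of_true (by rw [permLength_simpleSwap_mul_of_lt h]; omega) h
  · have := permLength_simpleSwap_mul_of_gt h
    exact iff_of_false (by omega) (not_lt.2 h.le)

theorem permLength_simpleSwap_mul_lt_iff {w : Equiv.Perm (Fin n)} {i : Fin (n - 1)} :
    permLength (simpleSwap n i * w) < permLength w ↔ w⁻¹ (hiPt i) < w⁻¹ (loPt i) := by
  rcases inv_lo_lt_or w i with h | h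
  · have := permLength_simpleSwap_mul_of_lt h
    exact iff_of_false (by omega) (not_lt.2 h.le)
  · have := permLength_simpleSwap_mul_of_gt h
    simp only [h, iff_true]; omega

theorem permLength_simpleSwap_mul_le (w : Equiv.Perm (Fin n)) (i : Fin (n - 1)) :
    permLength (simpleSwap n i * w) ≤ permLength w + 1 := by
  rcases inv_lo_lt_or w i with h | h
  · exact (permLength_simpleSwap_mul_of_lt h).le
  · have := permLength_simpleSwap_mul_of_gt h
    omega

theorem permLength_one : permLength (1 : Equiv.Perm (Fin n)) = 0 := by
  rw [permLength_eq_card, Finset.card_eq_zero, Finset.eq_empty_iff_forall_notMem]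
  intro p hp
  rw [mem_inversions] at hp
  exact lt_asymm hp.1 hp.2

theorem permLength_prod_le (a : List (Fin (n - 1))) :
    permLength (a.map (simpleSwap n)).prod ≤ a.length := by
  induction a with
  | nil => simp [permLength_one]
  | cons i a ih =>
    rw [List.map_cons, List.prod_cons, List.length_cons]
    exact (permLength_simpleSwap_mul_le _ _).trans (by omega)

/-- Each letter changes the length by one, and a word is at least as long as the permutation it
represents; a reduced word therefore cannot start with an ascent, and its tail is reduced. -/
theorem IsReducedWord.of_cons {i : Fin (n - 1)} {a : List (Fin (n - 1))} {w : Equiv.Perm (Fin n)}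
    (h : IsReducedWord (i :: a) w) :
    IsReducedWord a (simpleSwap n i * w) ∧ w⁻¹ (hiPt i) < w⁻¹ (loPt i) := by
  obtain ⟨h1, h2⟩ := h
  rw [List.map_cons, List.prod_cons] at h1
  rw [List.length_cons] at h2
  have h3 : (a.map (simpleSwap n)).prod = simpleSwap n i * w := by
    rw [← h1, simpleSwap_mul_cancel]
  have h4 := permLength_prod_le a
  rw [h3] at h4
  have h5 : w⁻¹ (hiPt i) < w⁻¹ (loPt i) := permLength_simpleSwap_mul_lt_iff.1 (by omega)
  have h6 := permLength_simpleSwap_mul_of_gt h5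
  exact ⟨⟨h3, by omega⟩, h5⟩

theorem simpleSwap_prod_reverse (a : List (Fin (n - 1))) :
    (a.reverse.map (simpleSwap n)).prod = ((a.map (simpleSwap n)).prod)⁻¹ := by
  rw [List.prod_inv_reverse, List.map_map, List.map_reverse]
  congr 2

theorem IsReducedWord.reverse {a : List (Fin (n - 1))} {w : Equiv.Perm (Fin n)}
    (h : IsReducedWord a w) : IsReducedWord a.reverse w⁻¹ := by
  refine ⟨?_, ?_⟩
  · rw [simpleSwap_prod_reverse, h.1]
  · rw [List.length_reverse, h.2, permLength_inv]

/-- A permutation other than the identity has a left descent. -/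
theorem exists_descent {w : Equiv.Perm (Fin n)} (hw : w ≠ 1) :
    ∃ i : Fin (n - 1), w⁻¹ (hiPt i) < w⁻¹ (loPt i) := by
  by_contra! hcon
  apply hw
  -- Without a descent the inverse is strictly increasing, and the identity is the only increasing
  -- bijection of `Fin n`.
  have hmono : StrictMono (w⁻¹ : Equiv.Perm (Fin n)) := by
    cases n with
    | zero => intro a; exact a.elim0
    | succ m =>
      rw [Fin.strictMono_iff_lt_succ]
      intro i
      exact lt_of_le_of_ne (hcon i) (inv_lo_ne_inv_hi w i)
  have h1 : (w⁻¹ : Equiv.Perm (Fin n)) = 1 := by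
    ext x
    have := (StrictMono.range_inj hmono (strictMono_id)).1 (by
      rw [Set.range_id, (w⁻¹).surjective.range_eq])
    rw [this]; rfl
  exact inv_eq_one.1 h1

/-- The inversions of x are injected into those of x·(i j) other than (i, j) itself: a pair is moved
by the transposition if it stays ordered, and is kept otherwise. -/
theorem permLength_lt_mul_swap {x : Equiv.Perm (Fin n)} {i j : Fin n} (hij : i < j)
    (h : x i < x j) : permLength x < permLength (x * Equiv.swap i j) := by
  rw [permLength_eq_card, permLength_eq_card]
  set t := Equiv.swap i j with ht
  have htt : ∀ a, t (t a) = a := fun a => Equiv.swap_apply_self i j a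
  have hti : t i = j := Equiv.swap_apply_left i j
  have htj : t j = i := Equiv.swap_apply_right i j
  have htn : ∀ a, a ≠ i → a ≠ j → t a = a := fun a => Equiv.swap_apply_of_ne_of_ne
  let φ : Fin n × Fin n → Fin n × Fin n := fun p =>
    if t p.1 < t p.2 then (t p.1, t p.2) else p
  have hφ : ∀ p ∈ inversions x, φ p ∈ (inversions (x * t)).erase (i, j) := by
    rintro ⟨a, b⟩ hp
    rw [mem_inversions] at hp
    obtain ⟨hab, hx⟩ := hp
    simp only at hab hx
    rw [Finset.mem_erase, mem_inversions]
    by_cases hc : t a < t b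
    · simp only [φ, hc, if_true, Equiv.Perm.mul_apply, htt, hx, and_self, and_true]
      intro he
      rw [Prod.mk.injEq] at he
      have h1 : a = j := by rw [← htt a, he.1, hti]
      have h2 : b = i := by rw [← htt b, he.2, htj]
      subst h1 h2
      exact lt_asymm hab hij
    · simp only [φ, hc, if_false, Equiv.Perm.mul_apply]
      by_cases hai : a = i
      · subst hai
        by_cases hbj : b = j
        · subst hbj; exact absurd hx (lt_asymm h)
        · have hb : t b = b := htn b hab.ne' hbj
          refine ⟨by simp [hbj], hab, ?_⟩
          rw [hb, hti]; exact hx.trans h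
      · by_cases hbj : b = j
        · subst hbj
          have ha : t a = a := htn a hai hab.ne
          refine ⟨by simp [hai], hab, ?_⟩
          rw [ha, htj]; exact h.trans hx
        · exfalso
          by_cases haj : a = j
          · have hb : t b = b := htn b (by rintro rfl; exact lt_asymm hij (haj ▸ hab)) hbj
            rw [haj, htj, hb] at hc
            exact hc (hij.trans (haj ▸ hab))
          · by_cases hbi : b = i
            · rw [hbi, hti, htn a hai haj] at hc
              exact hc ((hbi ▸ hab).trans hij)
            · rw [htn a hai haj, htn b hbi hbj] at hc
              exact hc hab
  have hinj : Set.InjOn φ (inversions x) := by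
    rintro ⟨a, b⟩ hp ⟨c, d⟩ hq he
    rw [Finset.mem_coe, mem_inversions] at hp hq
    simp only at hp hq
    simp only [φ] at he
    split_ifs at he with h1 h2 h2 <;> rw [Prod.mk.injEq] at he
    · rw [t.injective he.1, t.injective he.2]
    · rw [← he.1, ← he.2, htt, htt] at h2
      exact absurd hp.1 h2
    · rw [he.1, he.2, htt, htt] at h1
      exact absurd hq.1 h1
    · rw [he.1, he.2]
  have hmem : (i, j) ∈ inversions (x * t) := by
    rw [mem_inversions]
    simp only [Equiv.Perm.mul_apply, hti, htj]
    exact ⟨hij, h⟩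
  exact (Finset.card_le_card_of_injOn φ hφ hinj).trans_lt (Finset.card_erase_lt_of_mem hmem)

theorem lt_of_permLength_lt_mul_swap {x : Equiv.Perm (Fin n)} {i j : Fin n} (hij : i < j)
    (h : permLength x < permLength (x * Equiv.swap i j)) : x i < x j := by
  by_contra hcon
  have h1 : x j < x i := lt_of_le_of_ne (not_lt.1 hcon) fun he => hij.ne' (x.injective he)
  have h2 := permLength_lt_mul_swap (x := x * Equiv.swap i j) hij (by simpa using h1)
  rw [mul_assoc, Equiv.swap_mul_self, mul_one] at h2
  exact lt_asymm h h2

end Length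

/-! ### Bruhat order -/

section Bruhat

variable {n : ℕ}

/-- One step of the Bruhat order. -/
def BruhatStep (x y : Equiv.Perm (Fin n)) : Prop :=
  ∃ i j : Fin n, i ≠ j ∧ y = x * Equiv.swap i j ∧ permLength x < permLength y

theorem BruhatStep.le {x y : Equiv.Perm (Fin n)} (h : BruhatStep x y) : BruhatLE x y :=
  Relation.ReflTransGen.single h

theorem BruhatLE.refl (x : Equiv.Perm (Fin n)) : BruhatLE x x := Relation.ReflTransGen.refl

theorem BruhatLE.trans {x y z : Equiv.Perm (Fin n)} (h : BruhatLE x y) (h' : BruhatLE y z) :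
    BruhatLE x z := Relation.ReflTransGen.trans h h'

theorem BruhatLE.permLength_le {x y : Equiv.Perm (Fin n)} (h : BruhatLE x y) :
    permLength x ≤ permLength y := by
  induction h with
  | refl => exact le_rfl
  | tail _ h ih =>
    obtain ⟨_, _, _, _, h⟩ := h
    exact ih.trans h.le

theorem permLength_eq_zero {x : Equiv.Perm (Fin n)} (h : permLength x = 0) : x = 1 := by
  by_contra hx
  obtain ⟨i, hi⟩ := exists_descent hx
  have := permLength_simpleSwap_mul_of_gt hi
  omega

theorem BruhatLE.eq_one {x : Equiv.Perm (Fin n)} (h : BruhatLE x 1) : x = 1 := by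
  have := h.permLength_le
  rw [permLength_one] at this
  exact permLength_eq_zero (by omega)

theorem bruhatStep_simpleSwap_mul {x : Equiv.Perm (Fin n)} {i : Fin (n - 1)}
    (h : x⁻¹ (loPt i) < x⁻¹ (hiPt i)) : BruhatStep x (simpleSwap n i * x) :=
  ⟨_, _, inv_lo_ne_inv_hi x i, simpleSwap_mul_eq i x, permLength_lt_simpleSwap_mul_iff.2 h⟩

theorem bruhatStep_simpleSwap_mul' {x : Equiv.Perm (Fin n)} {i : Fin (n - 1)}
    (h : x⁻¹ (hiPt i) < x⁻¹ (loPt i)) : BruhatStep (simpleSwap n i * x) x := by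
  have := bruhatStep_simpleSwap_mul (x := simpleSwap n i * x) (i := i)
    (by rwa [simpleSwap_mul_inv_lo, simpleSwap_mul_inv_hi])
  rwa [simpleSwap_mul_cancel] at this

/-- Left multiplication by s reverses only the values `loPt s` and `hiPt s`. So a reflection step is
still increasing after it, unless the step is x → sx itself. -/
theorem BruhatStep.simpleSwap_mul {x y : Equiv.Perm (Fin n)} (h : BruhatStep x y)
    (s : Fin (n - 1)) :
    y = simpleSwap n s * x ∨ BruhatStep (simpleSwap n s * x) (simpleSwap n s * y) := by
  obtain ⟨i, j, hij, rfl, hl⟩ := h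
  wlog hlt : i < j generalizing i j
  · have := this j i hij.symm (by rwa [Equiv.swap_comm]) (lt_of_le_of_ne (not_lt.1 hlt) hij.symm)
    rwa [Equiv.swap_comm] at this
  have hx := lt_of_permLength_lt_mul_swap hlt hl
  by_cases hc : x i = loPt s ∧ x j = hiPt s
  · left
    rw [simpleSwap_mul_eq, ← hc.1, ← hc.2]
    simp
  · right
    refine ⟨i, j, hij, (mul_assoc _ _ _).symm, ?_⟩
    rw [← mul_assoc]
    apply permLength_lt_mul_swap hlt
    rw [Equiv.Perm.mul_apply, Equiv.Perm.mul_apply, simpleSwap_lt_iff s hc]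
    · exact hx
    · rintro ⟨h1, h2⟩
      rw [h1, h2] at hx
      exact lt_asymm hx (loPt_lt_hiPt s)

/-- A chain is multiplied by s one step at a time; the only step that does not survive joins an
element to its own multiple by s, and there the two chains meet. The companion below runs the same
argument from the other end. -/
theorem BruhatLE.simpleSwap_mul_or {x y : Equiv.Perm (Fin n)} (h : BruhatLE x y)
    (s : Fin (n - 1)) :
    BruhatLE (simpleSwap n s * x) y ∨ BruhatLE (simpleSwap n s * x) (simpleSwap n s * y) := by
  induction h with
  | refl => exact Or.inr (BruhatLE.refl _)
  | @tail y z _ hstep ih =>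
    have hstep : BruhatStep y z := hstep
    rcases ih with ih | ih
    · exact Or.inl (ih.trans hstep.le)
    · rcases hstep.simpleSwap_mul s with h | h
      · exact Or.inl (h ▸ ih)
      · exact Or.inr (ih.trans h.le)

theorem BruhatLE.le_simpleSwap_mul_or {x y : Equiv.Perm (Fin n)} (h : BruhatLE x y)
    (s : Fin (n - 1)) :
    BruhatLE x (simpleSwap n s * y) ∨ BruhatLE (simpleSwap n s * x) (simpleSwap n s * y) := by
  induction h using Relation.ReflTransGen.head_induction_on with
  | refl => exact Or.inr (BruhatLE.refl _)
  | @head x z hstep _ ih =>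
    have hstep : BruhatStep x z := hstep
    rcases ih with ih | ih
    · exact Or.inl (hstep.le.trans ih)
    · rcases hstep.simpleSwap_mul s with h | h
      · rw [h, simpleSwap_mul_cancel] at ih
        exact Or.inl ih
      · exact Or.inr (h.le.trans ih)

/-- The lifting property of the Bruhat order. -/
theorem bruhatLE_iff_of_asc {v w : Equiv.Perm (Fin n)} {i : Fin (n - 1)}
    (hw : w⁻¹ (hiPt i) < w⁻¹ (loPt i)) (hv : v⁻¹ (loPt i) < v⁻¹ (hiPt i)) :
    BruhatLE v w ↔ BruhatLE v (simpleSwap n i * w) ∨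
      BruhatLE (simpleSwap n i * v) (simpleSwap n i * w) := by
  have h1 := (bruhatStep_simpleSwap_mul hv).le
  have h2 := (bruhatStep_simpleSwap_mul' hw).le
  exact ⟨fun h => h.le_simpleSwap_mul_or i, fun h => h.elim (·.trans h2)
    fun h => (h1.trans h).trans h2⟩

theorem bruhatLE_iff_of_desc {v w : Equiv.Perm (Fin n)} {i : Fin (n - 1)}
    (hw : w⁻¹ (hiPt i) < w⁻¹ (loPt i)) (hv : v⁻¹ (hiPt i) < v⁻¹ (loPt i)) :
    BruhatLE v w ↔ BruhatLE (simpleSwap n i * v) (simpleSwap n i * w) := by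
  have h1 := (bruhatStep_simpleSwap_mul' hv).le
  have h2 := (bruhatStep_simpleSwap_mul' hw).le
  refine ⟨fun h => (h.le_simpleSwap_mul_or i).elim h1.trans id, fun h => ?_⟩
  rcases h.simpleSwap_mul_or i with h | h
  · rw [simpleSwap_mul_cancel] at h
    exact h.trans h2
  · rwa [simpleSwap_mul_cancel, simpleSwap_mul_cancel] at h

/-- The number of points `< j` which are sent to points `< a`. -/
def permRank (w : Equiv.Perm (Fin n)) (a j : ℕ) : ℕ :=
  (Finset.univ.filter fun x : Fin n => x.1 < a ∧ (w⁻¹ x).1 < j).card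

theorem permRank_succ (w : Equiv.Perm (Fin n)) (x : Fin n) (j : ℕ) :
    permRank w (x.1 + 1) j = permRank w x.1 j + if (w⁻¹ x).1 < j then 1 else 0 := by
  unfold permRank
  split_ifs with h
  · rw [← Finset.card_insert_of_notMem (a := x) (by simp)]
    congr 1
    ext y
    simp only [Finset.mem_filter, Finset.mem_univ, true_and, Finset.mem_insert]
    constructor
    · rintro ⟨h1, h2⟩
      by_cases hy : y = x
      · exact Or.inl hy
      · refine Or.inr ⟨?_, h2⟩
        have : y.1 ≠ x.1 := fun h => hy (Fin.ext h)
        omega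
    · rintro (rfl | ⟨h1, h2⟩)
      · exact ⟨by omega, h⟩
      · exact ⟨by omega, h2⟩
  · rw [add_zero]
    congr 1
    ext y
    simp only [Finset.mem_filter, Finset.mem_univ, true_and]
    constructor
    · rintro ⟨h1, h2⟩
      refine ⟨?_, h2⟩
      have : y.1 ≠ x.1 := fun he => h (by rwa [← Fin.ext he])
      omega
    · rintro ⟨h1, h2⟩
      exact ⟨by omega, h2⟩

theorem permRank_simpleSwap_mul_of_ne (w : Equiv.Perm (Fin n)) (i : Fin (n - 1)) {a : ℕ} (j : ℕ)
    (ha : a ≠ i.1 + 1) : permRank (simpleSwap n i * w) a j = permRank w a j := by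
  unfold permRank
  refine Finset.card_bij' (fun x _ => simpleSwap n i x) (fun x _ => simpleSwap n i x) ?_ ?_ ?_ ?_
  · intro x
    simp only [Finset.mem_filter, Finset.mem_univ, true_and, mul_inv_rev, simpleSwap_inv,
      Equiv.Perm.mul_apply]
    rintro ⟨h1, h2⟩
    refine ⟨?_, h2⟩
    rw [simpleSwap_eq, Equiv.swap_apply_def]
    split_ifs with h3 h4
    · rw [h3, loPt_val] at h1; rw [hiPt_val]; omega
    · rw [h4, hiPt_val] at h1; rw [loPt_val]; omega
    · exact h1
  · intro x
    simp only [Finset.mem_filter, Finset.mem_univ, true_and, mul_inv_rev, simpleSwap_inv,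
      Equiv.Perm.mul_apply]
    rintro ⟨h1, h2⟩
    refine ⟨?_, by rw [← Equiv.Perm.mul_apply (simpleSwap n i), simpleSwap_mul_self]; exact h2⟩
    rw [simpleSwap_eq, Equiv.swap_apply_def]
    split_ifs with h3 h4
    · rw [h3, loPt_val] at h1; rw [hiPt_val]; omega
    · rw [h4, hiPt_val] at h1; rw [loPt_val]; omega
    · exact h1
  · intro x _
    rw [← Equiv.Perm.mul_apply, simpleSwap_mul_self, Equiv.Perm.one_apply]
  · intro x _
    rw [← Equiv.Perm.mul_apply, simpleSwap_mul_self, Equiv.Perm.one_apply]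

/-- The rank criterion for the Bruhat order. -/
theorem bruhatLE_of_permRank_le (w : Equiv.Perm (Fin n)) :
    ∀ v : Equiv.Perm (Fin n), (∀ a j, permRank w a j ≤ permRank v a j) → BruhatLE v w := by
  induction hl : permLength w using Nat.strong_induction_on generalizing w with
  | _ l ih =>
  intro v hr
  by_cases hw : w = 1
  · subst hw
    suffices v = 1 by subst this; exact BruhatLE.refl _
    by_contra hv
    -- The rank inequality at (x + 1, x + 1) gives v⁻¹ x ≤ x, and injectivity excludes strict
    -- inequality once the smaller points are known to be fixed.
    have key : ∀ x : Fin n, v⁻¹ x = x := by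
      intro x
      induction hx : x.1 using Nat.strong_induction_on generalizing x with
      | _ m ihx =>
      have hle : (v⁻¹ x).1 ≤ x.1 := by
        by_contra hgt
        have h1 := hr (x.1 + 1) (x.1 + 1)
        rw [permRank_succ, permRank_succ, if_pos (by simp), if_neg (by omega)] at h1
        have h2 : permRank v x.1 (x.1 + 1) ≤ permRank (1 : Equiv.Perm (Fin n)) x.1 (x.1 + 1) := by
          unfold permRank
          refine Finset.card_le_card fun y => ?_
          simp only [Finset.mem_filter, Finset.mem_univ, true_and, inv_one, Equiv.Perm.one_apply]
          omega
        omega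
      rcases hle.lt_or_eq with h | h
      · have := ihx _ (hx ▸ h) (v⁻¹ x) rfl
        exact absurd (v⁻¹.injective this) (fun h' => by rw [h'] at h; exact lt_irrefl _ h)
      · exact Fin.ext h
    exact hv (inv_eq_one.1 (Equiv.ext key))
  · obtain ⟨i, hi⟩ := exists_descent hw
    have hlen := permLength_simpleSwap_mul_of_gt hi
    -- The induction passes from (v, w) to sw and the shorter of v and sv. Only the ranks with a = i
    -- + 1 are affected by s, and for these the inequality follows from the old ones at a = i, i +
    -- 1, i + 2.
    have key : ∀ a j, permRank (simpleSwap n i * w) a j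
        ≤ permRank (if v⁻¹ (loPt i) < v⁻¹ (hiPt i) then v else simpleSwap n i * v) a j := by
      intro a j
      by_cases ha : a = i.1 + 1
      · subst ha
        have e1 := permRank_succ (simpleSwap n i * w) (loPt i) j
        rw [loPt_val, permRank_simpleSwap_mul_of_ne (a := i.1) _ _ _ (by omega),
          simpleSwap_mul_inv_lo] at e1
        have e2 := permRank_succ w (loPt i) j
        have e3 := permRank_succ w (hiPt i) j
        have e4 := permRank_succ v (loPt i) j
        have e5 := permRank_succ v (hiPt i) j
        have e6 := permRank_succ (simpleSwap n i * v) (loPt i) j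
        rw [loPt_val, permRank_simpleSwap_mul_of_ne (a := i.1) _ _ _ (by omega),
          simpleSwap_mul_inv_lo] at e6
        rw [loPt_val] at e2 e4
        rw [hiPt_val] at e3 e5
        have r1 := hr i.1 j
        have r2 := hr (i.1 + 1) j
        have r3 := hr (i.1 + 1 + 1) j
        rw [Fin.lt_def] at hi
        split_ifs with hv
        · rw [Fin.lt_def] at hv
          split_ifs at e1 e2 e3 e4 e5 <;> omega
        · rw [Fin.lt_def] at hv
          split_ifs at e1 e2 e3 e4 e5 e6 <;> omega
      · rw [permRank_simpleSwap_mul_of_ne _ _ _ ha]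
        split_ifs
        · exact hr a j
        · rw [permRank_simpleSwap_mul_of_ne _ _ _ ha]; exact hr a j
    have := ih _ (by omega) (simpleSwap n i * w) rfl _ key
    split_ifs at this with hv
    · exact (bruhatLE_iff_of_asc hi hv).2 (Or.inl this)
    · exact (bruhatLE_iff_of_desc hi ((inv_lo_lt_or v i).resolve_left hv)).2 this

end Bruhat

/-! ### Two-by-two blocks in the general linear group -/

section Blocks

variable {n : ℕ} {F : Type*} [Field F]

/-- The identity matrix with the block `p, q; r, t` put in the rows and columns `i, i + 1`. -/
def blockMat (i : Fin (n - 1)) (p q r t : F) : Matrix (Fin n) (Fin n) F :=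
  Matrix.of fun a b =>
    if a = loPt i then (if b = loPt i then p else if b = hiPt i then q else 0)
    else if a = hiPt i then (if b = loPt i then r else if b = hiPt i then t else 0)
    else if a = b then 1 else 0

theorem blockMat_mul_lo (i : Fin (n - 1)) (p q r t : F) (M : Matrix (Fin n) (Fin n) F)
    (b : Fin n) : (blockMat i p q r t * M) (loPt i) b = p * M (loPt i) b + q * M (hiPt i) b := by
  rw [Matrix.mul_apply, ← Finset.sum_subset (Finset.subset_univ {loPt i, hiPt i}),
    Finset.sum_pair (loPt_ne_hiPt i)]
  · simp [blockMat, (loPt_ne_hiPt i).symm]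
  · intro x _ hx
    simp only [Finset.mem_insert, Finset.mem_singleton, not_or] at hx
    simp [blockMat, hx.1, hx.2]

theorem blockMat_mul_hi (i : Fin (n - 1)) (p q r t : F) (M : Matrix (Fin n) (Fin n) F)
    (b : Fin n) : (blockMat i p q r t * M) (hiPt i) b = r * M (loPt i) b + t * M (hiPt i) b := by
  rw [Matrix.mul_apply, ← Finset.sum_subset (Finset.subset_univ {loPt i, hiPt i}),
    Finset.sum_pair (loPt_ne_hiPt i)]
  · simp [blockMat, (loPt_ne_hiPt i).symm]
  · intro x _ hx
    simp only [Finset.mem_insert, Finset.mem_singleton, not_or] at hx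
    simp [blockMat, hx.1, hx.2]

theorem blockMat_mul_of_ne (i : Fin (n - 1)) (p q r t : F) (M : Matrix (Fin n) (Fin n) F)
    {a : Fin n} (b : Fin n) (h1 : a ≠ loPt i) (h2 : a ≠ hiPt i) :
    (blockMat i p q r t * M) a b = M a b := by
  rw [Matrix.mul_apply, Finset.sum_eq_single a]
  · simp [blockMat, h1, h2]
  · intro x _ hx
    simp [blockMat, h1, h2, hx.symm]
  · simp

theorem mul_blockMat_lo (i : Fin (n - 1)) (p q r t : F) (M : Matrix (Fin n) (Fin n) F)
    (a : Fin n) : (M * blockMat i p q r t) a (loPt i) = M a (loPt i) * p + M a (hiPt i) * r := by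
  rw [Matrix.mul_apply, ← Finset.sum_subset (Finset.subset_univ {loPt i, hiPt i}),
    Finset.sum_pair (loPt_ne_hiPt i)]
  · simp [blockMat, (loPt_ne_hiPt i).symm]
  · intro x _ hx
    simp only [Finset.mem_insert, Finset.mem_singleton, not_or] at hx
    simp [blockMat, hx.1, hx.2]

theorem mul_blockMat_hi (i : Fin (n - 1)) (p q r t : F) (M : Matrix (Fin n) (Fin n) F)
    (a : Fin n) : (M * blockMat i p q r t) a (hiPt i) = M a (loPt i) * q + M a (hiPt i) * t := by
  rw [Matrix.mul_apply, ← Finset.sum_subset (Finset.subset_univ {loPt i, hiPt i}),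
    Finset.sum_pair (loPt_ne_hiPt i)]
  · simp [blockMat, (loPt_ne_hiPt i).symm]
  · intro x _ hx
    simp only [Finset.mem_insert, Finset.mem_singleton, not_or] at hx
    simp [blockMat, hx.1, hx.2]

theorem mul_blockMat_of_ne (i : Fin (n - 1)) (p q r t : F) (M : Matrix (Fin n) (Fin n) F)
    (a : Fin n) {b : Fin n} (h1 : b ≠ loPt i) (h2 : b ≠ hiPt i) :
    (M * blockMat i p q r t) a b = M a b := by
  rw [Matrix.mul_apply, Finset.sum_eq_single b]
  · simp [blockMat, h1, h2]
  · intro x _ hx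
    simp [blockMat, h1, h2, hx]
  · simp

theorem blockMat_lo (i : Fin (n - 1)) (p q r t : F) (b : Fin n) :
    blockMat i p q r t (loPt i) b = if b = loPt i then p else if b = hiPt i then q else 0 := by
  simp [blockMat]

theorem blockMat_hi (i : Fin (n - 1)) (p q r t : F) (b : Fin n) :
    blockMat i p q r t (hiPt i) b = if b = loPt i then r else if b = hiPt i then t else 0 := by
  simp [blockMat, (loPt_ne_hiPt i).symm]

theorem blockMat_of_ne (i : Fin (n - 1)) (p q r t : F) {a : Fin n} (b : Fin n)
    (h1 : a ≠ loPt i) (h2 : a ≠ hiPt i) :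
    blockMat i p q r t a b = if a = b then 1 else 0 := by
  simp [blockMat, h1, h2]

theorem blockMat_mul_blockMat (i : Fin (n - 1)) (p q r t p' q' r' t' : F) :
    blockMat i p q r t * blockMat i p' q' r' t'
      = blockMat i (p * p' + q * r') (p * q' + q * t') (r * p' + t * r') (r * q' + t * t') := by
  ext a b
  by_cases h1 : a = loPt i
  · subst h1
    rw [blockMat_mul_lo, blockMat_lo, blockMat_lo, blockMat_hi]
    split_ifs <;> simp
  by_cases h2 : a = hiPt i
  · subst h2
    rw [blockMat_mul_hi, blockMat_hi, blockMat_lo, blockMat_hi]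
    split_ifs <;> simp
  rw [blockMat_mul_of_ne _ _ _ _ _ _ _ h1 h2, blockMat_of_ne _ _ _ _ _ _ h1 h2,
    blockMat_of_ne _ _ _ _ _ _ h1 h2]

theorem blockMat_one (i : Fin (n - 1)) : blockMat i (1 : F) 0 0 1 = 1 := by
  ext a b
  by_cases h1 : a = loPt i
  · subst h1
    rw [blockMat_lo, Matrix.one_apply]
    by_cases h : b = loPt i
    · rw [if_pos h, if_pos h.symm]
    · rw [if_neg h, if_neg (Ne.symm h), ite_self]
  by_cases h2 : a = hiPt i
  · subst h2
    rw [blockMat_hi, Matrix.one_apply]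
    by_cases h : b = hiPt i
    · rw [if_pos h, if_pos h.symm, if_neg (h ▸ (loPt_ne_hiPt i).symm)]
    · rw [if_neg h, if_neg (Ne.symm h), ite_self]
  rw [blockMat_of_ne _ _ _ _ _ _ h1 h2, Matrix.one_apply]

/-- The invertible block matrices. -/
def blockGL (i : Fin (n - 1)) (p q r t : F) (h : p * t - q * r ≠ 0) :
    Matrix.GeneralLinearGroup (Fin n) F where
  val := blockMat i p q r t
  inv := blockMat i (t / (p * t - q * r)) (-q / (p * t - q * r)) (-r / (p * t - q * r))
    (p / (p * t - q * r))
  val_inv := by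
    rw [blockMat_mul_blockMat, ← blockMat_one i]
    congr 1 <;> first | ring1 | linear_combination mul_inv_cancel₀ h
  inv_val := by
    rw [blockMat_mul_blockMat, ← blockMat_one i]
    congr 1 <;> first | ring1 | linear_combination mul_inv_cancel₀ h

theorem blockGL_mul (i : Fin (n - 1)) {p q r t p' q' r' t' : F} (h : p * t - q * r ≠ 0)
    (h' : p' * t' - q' * r' ≠ 0) :
    ∃ h'', blockGL i p q r t h * blockGL i p' q' r' t' h'
      = blockGL i (p * p' + q * r') (p * q' + q * t') (r * p' + t * r') (r * q' + t * t') h'' := by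
  refine ⟨?_, Units.ext (blockMat_mul_blockMat i p q r t p' q' r' t')⟩
  have := mul_ne_zero h h'
  contrapose! this
  rw [← this]; ring

theorem blockGL_congr (i : Fin (n - 1)) {p q r t p' q' r' t' : F} {h : p * t - q * r ≠ 0}
    {h' : p' * t' - q' * r' ≠ 0} (h1 : p = p') (h2 : q = q') (h3 : r = r') (h4 : t = t') :
    blockGL i p q r t h = blockGL i p' q' r' t' h' := by
  subst h1 h2 h3 h4; rfl

/-- An order in which `i` and `i + 1` are not separated by other points. -/
def NotSeparated {α : Type*} [LinearOrder α] (φ : Fin n → α) (i : Fin (n - 1)) : Prop :=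
  ∀ x, x ≠ loPt i → x ≠ hiPt i → (φ x < φ (loPt i) ↔ φ x < φ (hiPt i)) ∧
    (φ (loPt i) < φ x ↔ φ (hiPt i) < φ x)

/-- The triangular matrices whose block at i, i + 1 is the identity remain triangular when
multiplied by block matrices on both sides: other rows and columns only get mixed with one on the
same side of the order, and `hq`, `hr` kill the off-diagonal entries of the new block. Stating it
for an order φ covers both Borel subgroups. -/
theorem blockTriangular_conj {α : Type*} [LinearOrder α] {φ : Fin n → α} {i : Fin (n - 1)}
    (hφ : NotSeparated φ i) {M : Matrix (Fin n) (Fin n) F} (hM : M.BlockTriangular φ)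
    (h1 : M (loPt i) (loPt i) = 1) (h2 : M (loPt i) (hiPt i) = 0) (h3 : M (hiPt i) (loPt i) = 0)
    (h4 : M (hiPt i) (hiPt i) = 1) {p q r t p' q' r' t' : F}
    (hq : p * q' + q * t' = 0) (hr : r * p' + t * r' = 0) :
    (blockMat i p q r t * M * blockMat i p' q' r' t').BlockTriangular φ := by
  intro a b hab
  have hz : ∀ {x y}, φ y < φ x → M x y = 0 := fun h => hM h
  by_cases hb1 : b = loPt i
  · subst hb1
    rw [mul_blockMat_lo]
    by_cases ha1 : a = loPt i
    · subst ha1; exact absurd hab (lt_irrefl _)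
    by_cases ha2 : a = hiPt i
    · subst ha2
      rw [blockMat_mul_hi, blockMat_mul_hi, h1, h2, h3, h4]
      linear_combination hr
    · rw [blockMat_mul_of_ne _ _ _ _ _ _ _ ha1 ha2, blockMat_mul_of_ne _ _ _ _ _ _ _ ha1 ha2,
        hz hab, hz ((hφ a ha1 ha2).2.1 hab)]
      ring
  by_cases hb2 : b = hiPt i
  · subst hb2
    rw [mul_blockMat_hi]
    by_cases ha1 : a = loPt i
    · subst ha1
      rw [blockMat_mul_lo, blockMat_mul_lo, h1, h2, h3, h4]
      linear_combination hq
    by_cases ha2 : a = hiPt i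
    · subst ha2; exact absurd hab (lt_irrefl _)
    · rw [blockMat_mul_of_ne _ _ _ _ _ _ _ ha1 ha2, blockMat_mul_of_ne _ _ _ _ _ _ _ ha1 ha2,
        hz hab, hz ((hφ a ha1 ha2).2.2 hab)]
      ring
  rw [mul_blockMat_of_ne _ _ _ _ _ _ _ hb1 hb2]
  by_cases ha1 : a = loPt i
  · subst ha1
    rw [blockMat_mul_lo, hz hab, hz ((hφ b hb1 hb2).1.1 hab)]
    ring
  by_cases ha2 : a = hiPt i
  · subst ha2
    rw [blockMat_mul_hi, hz hab, hz ((hφ b hb1 hb2).1.2 hab)]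
    ring
  rw [blockMat_mul_of_ne _ _ _ _ _ _ _ ha1 ha2, hz hab]

theorem blockTriangular_blockMat {α : Type*} [LinearOrder α] {φ : Fin n → α} {i : Fin (n - 1)}
    {p q r t : F} (hq : φ (hiPt i) < φ (loPt i) → q = 0)
    (hr : φ (loPt i) < φ (hiPt i) → r = 0) : (blockMat i p q r t).BlockTriangular φ := by
  intro a b hab
  by_cases h1 : a = loPt i
  · subst h1
    rw [blockMat_lo]
    split_ifs with h h'
    · subst h; exact absurd hab (lt_irrefl _)
    · subst h'; exact hq hab
    · rfl
  by_cases h2 : a = hiPt i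
  · subst h2
    rw [blockMat_hi]
    split_ifs with h h'
    · subst h; exact hr hab
    · subst h'; exact absurd hab (lt_irrefl _)
    · rfl
  rw [blockMat_of_ne _ _ _ _ _ _ h1 h2, if_neg]
  rintro rfl
  exact lt_irrefl _ hab

/-- A block matrix may be moved past a triangular matrix, up to the block of the latter. -/
theorem exists_blockGL_mul_eq {α : Type*} [LinearOrder α] {φ : Fin n → α} {i : Fin (n - 1)}
    (hφ : NotSeparated φ i) {b : Matrix.GeneralLinearGroup (Fin n) F}
    (hb : b.1.BlockTriangular φ)
    (hd : b.1 (loPt i) (loPt i) * b.1 (hiPt i) (hiPt i)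
      - b.1 (loPt i) (hiPt i) * b.1 (hiPt i) (loPt i) ≠ 0)
    {p q r t : F} (h : p * t - q * r ≠ 0) :
    ∃ b₁ : Matrix.GeneralLinearGroup (Fin n) F, b₁.1.BlockTriangular φ ∧
      blockGL i p q r t h * b = b₁ * (blockGL i p q r t h *
        blockGL i (b.1 (loPt i) (loPt i)) (b.1 (loPt i) (hiPt i)) (b.1 (hiPt i) (loPt i))
          (b.1 (hiPt i) (hiPt i)) hd) := by
  set A := blockGL i p q r t h
  set l := blockGL i (b.1 (loPt i) (loPt i)) (b.1 (loPt i) (hiPt i)) (b.1 (hiPt i) (loPt i))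
          (b.1 (hiPt i) (hiPt i)) hd
  -- The block l of b is split off, so that b l⁻¹ has the identity as its block and may be
  -- conjugated by A.
  refine ⟨A * (b * l⁻¹) * A⁻¹, ?_, by group⟩
  have hl : l⁻¹.1 = blockMat i _ _ _ _ := rfl
  have hA : A⁻¹.1 = blockMat i _ _ _ _ := rfl
  have hA' : A.1 = blockMat i p q r t := rfl
  rw [Units.val_mul, Units.val_mul, Units.val_mul, hA, hA', hl]
  refine blockTriangular_conj hφ ?_ ?_ ?_ ?_ ?_ ?_ ?_
  · refine hb.mul (blockTriangular_blockMat (fun h' => ?_) fun h' => ?_)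
    · rw [hb h', neg_zero, zero_div]
    · rw [hb h', neg_zero, zero_div]
  · rw [mul_blockMat_lo]; linear_combination mul_inv_cancel₀ hd
  · rw [mul_blockMat_hi]; ring
  · rw [mul_blockMat_lo]; ring
  · rw [mul_blockMat_hi]; linear_combination mul_inv_cancel₀ hd
  · ring
  · ring

end Blocks

/-! ### Bruhat cells -/

section Cells

variable {n : ℕ} {F : Type*} [Field F]

/-- The subgroup of lower triangular matrices. -/
def lowerSubgroup (n : ℕ) (F : Type*) [Field F] :
    Subgroup (Matrix.GeneralLinearGroup (Fin n) F) where
  carrier := lowerBorel n F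
  mul_mem' {g h} hg hh := fun i j hij =>
    (show (g.1 * h.1).BlockTriangular OrderDual.toDual from
      Matrix.BlockTriangular.mul (fun a b hab => hg a b hab) (fun a b hab => hh a b hab)) hij
  one_mem' := fun i j hij => Matrix.one_apply_ne hij.ne
  inv_mem' {g} hg := fun i j hij => by
    have : Invertible g.1 := g.invertible
    rw [Matrix.coe_units_inv]
    exact Matrix.blockTriangular_inv_of_blockTriangular (b := OrderDual.toDual)
      (fun a b hab => hg a b hab) hij

theorem mem_lowerSubgroup {g : Matrix.GeneralLinearGroup (Fin n) F} :
    g ∈ lowerSubgroup n F ↔ g.1.BlockTriangular OrderDual.toDual := Iff.rfl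

theorem upper_diag_ne_zero {g : Matrix.GeneralLinearGroup (Fin n) F} (hg : g ∈ upperBorel n F)
    (a : Fin n) : g.1 a a ≠ 0 := by
  have h := (Matrix.isUnit_iff_isUnit_det _).1 g.isUnit
  rw [Matrix.det_of_isUpperTriangular hg] at h
  exact fun h0 => h.ne_zero (Finset.prod_eq_zero (Finset.mem_univ a) h0)

theorem lower_diag_ne_zero {g : Matrix.GeneralLinearGroup (Fin n) F} (hg : g ∈ lowerSubgroup n F)
    (a : Fin n) : g.1 a a ≠ 0 := by
  have h := (Matrix.isUnit_iff_isUnit_det _).1 g.isUnit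
  rw [Matrix.det_of_isLowerTriangular _ (mem_lowerSubgroup.1 hg)] at h
  exact fun h0 => h.ne_zero (Finset.prod_eq_zero (Finset.mem_univ a) h0)

theorem permMat_apply (w : Equiv.Perm (Fin n)) (a b : Fin n) :
    permMat F w a b = if a = w b then 1 else 0 := by
  unfold permMat
  rw [Matrix.of_apply]

theorem permMat_mul_permMat (v w : Equiv.Perm (Fin n)) :
    permMat F v * permMat F w = permMat F (v * w) := by
  ext a b
  rw [Matrix.mul_apply, Finset.sum_eq_single (w b)]
  · rw [permMat_apply, permMat_apply, permMat_apply, if_pos rfl, mul_one, Equiv.Perm.mul_apply]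
  · intro x _ hx
    rw [permMat_apply w, if_neg hx, mul_zero]
  · simp

theorem permMat_one : permMat F (1 : Equiv.Perm (Fin n)) = 1 := by
  ext a b
  rw [permMat_apply, Matrix.one_apply, Equiv.Perm.one_apply]

/-- The matrix of a permutation, as an element of the general linear group. -/
def permGL (F : Type*) [Field F] {n : ℕ} (w : Equiv.Perm (Fin n)) :
    Matrix.GeneralLinearGroup (Fin n) F where
  val := permMat F w
  inv := permMat F w⁻¹
  val_inv := by rw [permMat_mul_permMat, mul_inv_cancel, permMat_one]
  inv_val := by rw [permMat_mul_permMat, inv_mul_cancel, permMat_one]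

theorem permGL_mul (v w : Equiv.Perm (Fin n)) : permGL F (v * w) = permGL F v * permGL F w :=
  Units.ext (permMat_mul_permMat v w).symm

theorem permGL_one : permGL F (1 : Equiv.Perm (Fin n)) = 1 := Units.ext permMat_one

theorem mul_permMat_apply (M : Matrix (Fin n) (Fin n) F) (w : Equiv.Perm (Fin n)) (a b : Fin n) :
    (M * permMat F w) a b = M a (w b) := by
  rw [Matrix.mul_apply, Finset.sum_eq_single (w b)]
  · simp [permMat]
  · intro x _ hx
    simp [permMat, hx]
  · simp

theorem permMat_mul_apply (M : Matrix (Fin n) (Fin n) F) (w : Equiv.Perm (Fin n)) (a b : Fin n) :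
    (permMat F w * M) (w a) b = M a b := by
  rw [Matrix.mul_apply, Finset.sum_eq_single a]
  · simp [permMat]
  · intro x _ hx
    simp [permMat, hx.symm]
  · simp

theorem permGL_simpleSwap (i : Fin (n - 1)) :
    permGL F (simpleSwap n i) = blockGL i 0 1 1 0 (by simp) := by
  refine Units.ext ?_
  change permMat F (simpleSwap n i) = blockMat i 0 1 1 0
  ext a b
  rw [permMat_apply]
  have key : a = simpleSwap n i b ↔ simpleSwap n i a = b := by
    rw [← Equiv.Perm.eq_inv_iff_eq, simpleSwap_inv]
  simp only [key]
  by_cases h1 : a = loPt i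
  · rw [h1, blockMat_lo, simpleSwap_lo]
    by_cases h : b = hiPt i
    · rw [if_pos h, if_pos h.symm, if_neg]
      exact fun h' => absurd (h'.symm.trans h) (loPt_ne_hiPt i)
    · rw [if_neg h, if_neg (Ne.symm h), ite_self]
  by_cases h2 : a = hiPt i
  · rw [h2, blockMat_hi, simpleSwap_hi, ite_self]
    by_cases h : b = loPt i
    · rw [if_pos h, if_pos h.symm]
    · rw [if_neg h, if_neg (Ne.symm h)]
  rw [blockMat_of_ne _ _ _ _ _ _ h1 h2, simpleSwap_of_ne i h1 h2]

theorem permGL_simpleSwap_mul (i : Fin (n - 1)) (w : Equiv.Perm (Fin n)) :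
    permGL F (simpleSwap n i * w) = blockGL i 0 1 1 0 (by simp) * permGL F w := by
  rw [permGL_mul, permGL_simpleSwap]

theorem eq_one_of_le {w : Equiv.Perm (Fin n)} (h : ∀ x, w x ≤ x) : w = 1 := by
  ext x
  rw [Equiv.Perm.one_apply]
  induction hx : x.1 using Nat.strong_induction_on generalizing x with
  | _ m ih =>
  rcases (h x).lt_or_eq with hlt | heq
  · have := ih _ (hx ▸ hlt) (w x) rfl
    exact absurd (w.injective (Fin.ext this)) hlt.ne
  · rw [heq, hx]

/-- The entry at (v x, x) is a diagonal entry of M on the left and the entry (w⁻¹ v x, x) of N on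
the right. It is nonzero, so w⁻¹ v x ≤ x for all x. This gives disjointness of the cells for both
Borel subgroups. -/
theorem eq_of_mul_permMat_eq {M N : Matrix (Fin n) (Fin n) F} {v w : Equiv.Perm (Fin n)}
    (hM : ∀ a, M a a ≠ 0) (hN : N.BlockTriangular id)
    (h : M * permMat F v = permMat F w * N) : v = w := by
  have : w⁻¹ * v = 1 := by
    refine eq_one_of_le fun x => ?_
    by_contra hx
    have h1 := congrFun (congrFun h (v x)) x
    rw [mul_permMat_apply] at h1
    have h2 := permMat_mul_apply N w (w⁻¹ (v x)) x
    rw [← Equiv.Perm.mul_apply w, mul_inv_cancel, Equiv.Perm.one_apply] at h2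
    rw [h2] at h1
    exact hM _ (h1.trans (hN (not_le.1 hx)))
  rw [inv_mul_eq_one] at this
  exact this.symm

/-- The preimage in `GL_n(F)` of a Schubert cell. -/
def UpCell (F : Type*) [Field F] {n : ℕ} (w : Equiv.Perm (Fin n)) :
    Set (Matrix.GeneralLinearGroup (Fin n) F) :=
  {g | ∃ b ∈ upperBorel n F, ∃ b' ∈ upperBorel n F, g = b * permGL F w * b'}

/-- The preimage in `GL_n(F)` of an opposite Schubert cell. -/
def LowCell (F : Type*) [Field F] {n : ℕ} (v : Equiv.Perm (Fin n)) :
    Set (Matrix.GeneralLinearGroup (Fin n) F) :=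
  {g | ∃ c ∈ lowerSubgroup n F, ∃ b ∈ upperBorel n F, g = c * permGL F v * b}

theorem UpCell.mul_left {w : Equiv.Perm (Fin n)} {b g : Matrix.GeneralLinearGroup (Fin n) F}
    (hb : b ∈ upperBorel n F) (hg : g ∈ UpCell F w) : b * g ∈ UpCell F w := by
  obtain ⟨b₁, h₁, b₂, h₂, rfl⟩ := hg
  exact ⟨b * b₁, mul_mem hb h₁, b₂, h₂, by group⟩

theorem UpCell.mul_right {w : Equiv.Perm (Fin n)} {b g : Matrix.GeneralLinearGroup (Fin n) F}
    (hg : g ∈ UpCell F w) (hb : b ∈ upperBorel n F) : g * b ∈ UpCell F w := by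
  obtain ⟨b₁, h₁, b₂, h₂, rfl⟩ := hg
  exact ⟨b₁, h₁, b₂ * b, mul_mem h₂ hb, by group⟩

theorem LowCell.mul_left {w : Equiv.Perm (Fin n)} {b g : Matrix.GeneralLinearGroup (Fin n) F}
    (hb : b ∈ lowerSubgroup n F) (hg : g ∈ LowCell F w) : b * g ∈ LowCell F w := by
  obtain ⟨b₁, h₁, b₂, h₂, rfl⟩ := hg
  exact ⟨b * b₁, mul_mem hb h₁, b₂, h₂, by group⟩

theorem LowCell.mul_right {w : Equiv.Perm (Fin n)} {b g : Matrix.GeneralLinearGroup (Fin n) F}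
    (hg : g ∈ LowCell F w) (hb : b ∈ upperBorel n F) : g * b ∈ LowCell F w := by
  obtain ⟨b₁, h₁, b₂, h₂, rfl⟩ := hg
  exact ⟨b₁, h₁, b₂ * b, mul_mem h₂ hb, by group⟩

theorem UpCell.mul_mul {w : Equiv.Perm (Fin n)} {b b' g : Matrix.GeneralLinearGroup (Fin n) F}
    (hb : b ∈ upperBorel n F) (hb' : b' ∈ upperBorel n F) (hg : g ∈ UpCell F w) :
    b * g * b' ∈ UpCell F w := UpCell.mul_right (UpCell.mul_left hb hg) hb'

theorem LowCell.mul_mul {w : Equiv.Perm (Fin n)} {b b' g : Matrix.GeneralLinearGroup (Fin n) F}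
    (hb : b ∈ lowerSubgroup n F) (hb' : b' ∈ upperBorel n F) (hg : g ∈ LowCell F w) :
    b * g * b' ∈ LowCell F w := LowCell.mul_right (LowCell.mul_left hb hg) hb'

theorem permGL_mem_upCell (w : Equiv.Perm (Fin n)) : permGL F w ∈ UpCell F w :=
  ⟨1, one_mem _, 1, one_mem _, by group⟩

theorem permGL_mem_lowCell (w : Equiv.Perm (Fin n)) : permGL F w ∈ LowCell F w :=
  ⟨1, one_mem _, 1, one_mem _, by group⟩

theorem UpCell.unique {v w : Equiv.Perm (Fin n)} {g : Matrix.GeneralLinearGroup (Fin n) F}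
    (hv : g ∈ UpCell F v) (hw : g ∈ UpCell F w) : v = w := by
  obtain ⟨b, hb, b', hb', rfl⟩ := hv
  obtain ⟨c, hc, c', hc', h⟩ := hw
  have h1 : (c⁻¹ * b) * permGL F v = permGL F w * (c' * b'⁻¹) := by
    rw [← mul_right_inj c, ← mul_left_inj b']
    simpa [mul_assoc] using h
  exact eq_of_mul_permMat_eq (upper_diag_ne_zero (mul_mem (inv_mem hc) hb))
    (mul_mem hc' (inv_mem hb')) (congrArg Units.val h1)

theorem LowCell.unique {v w : Equiv.Perm (Fin n)} {g : Matrix.GeneralLinearGroup (Fin n) F}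
    (hv : g ∈ LowCell F v) (hw : g ∈ LowCell F w) : v = w := by
  obtain ⟨b, hb, b', hb', rfl⟩ := hv
  obtain ⟨c, hc, c', hc', h⟩ := hw
  have h1 : (c⁻¹ * b) * permGL F v = permGL F w * (c' * b'⁻¹) := by
    rw [← mul_right_inj c, ← mul_left_inj b']
    simpa [mul_assoc] using h
  exact eq_of_mul_permMat_eq (lower_diag_ne_zero (mul_mem (inv_mem hc) hb))
    (mul_mem hc' (inv_mem hb')) (congrArg Units.val h1)

theorem notSeparated_id (i : Fin (n - 1)) : NotSeparated (id : Fin n → Fin n) i := by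
  intro x h1 h2
  simp only [id, Fin.lt_def, ne_eq, Fin.ext_iff, loPt_val, hiPt_val] at *
  omega

theorem notSeparated_toDual (i : Fin (n - 1)) :
    NotSeparated (OrderDual.toDual : Fin n → (Fin n)ᵒᵈ) i := by
  intro x h1 h2
  simp only [OrderDual.toDual_lt_toDual, Fin.lt_def, ne_eq, Fin.ext_iff, loPt_val,
    hiPt_val] at *
  omega

theorem exists_upper_mul {i : Fin (n - 1)} {b : Matrix.GeneralLinearGroup (Fin n) F}
    (hb : b ∈ upperBorel n F) {p q r t : F} (h : p * t - q * r ≠ 0) :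
    ∃ b₁ ∈ upperBorel n F, ∃ l₁ l₂ l₃ : F, ∃ hl : l₁ * l₃ - l₂ * 0 ≠ 0,
      blockGL i p q r t h * b = b₁ * (blockGL i p q r t h * blockGL i l₁ l₂ 0 l₃ hl) := by
  have h0 : b.1 (hiPt i) (loPt i) = 0 := hb (loPt_lt_hiPt i)
  have hd : b.1 (loPt i) (loPt i) * b.1 (hiPt i) (hiPt i) - b.1 (loPt i) (hiPt i) * 0 ≠ 0 := by
    rw [mul_zero, sub_zero]
    exact mul_ne_zero (upper_diag_ne_zero hb _) (upper_diag_ne_zero hb _)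
  obtain ⟨b₁, hb₁, he⟩ := exists_blockGL_mul_eq (notSeparated_id i) hb (by rwa [h0]) h
  exact ⟨b₁, hb₁, _, _, _, hd, he.trans (by congr 2; exact blockGL_congr i rfl rfl h0 rfl)⟩

theorem exists_lower_mul {i : Fin (n - 1)} {b : Matrix.GeneralLinearGroup (Fin n) F}
    (hb : b ∈ lowerSubgroup n F) {p q r t : F} (h : p * t - q * r ≠ 0) :
    ∃ b₁ ∈ lowerSubgroup n F, ∃ l₁ l₂ l₃ : F, ∃ hl : l₁ * l₃ - 0 * l₂ ≠ 0,
      blockGL i p q r t h * b = b₁ * (blockGL i p q r t h * blockGL i l₁ 0 l₂ l₃ hl) := by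
  have h0 : b.1 (loPt i) (hiPt i) = 0 := hb _ _ (loPt_lt_hiPt i)
  have hd : b.1 (loPt i) (loPt i) * b.1 (hiPt i) (hiPt i) - 0 * b.1 (hiPt i) (loPt i) ≠ 0 := by
    rw [zero_mul, sub_zero]
    exact mul_ne_zero (lower_diag_ne_zero hb _) (lower_diag_ne_zero hb _)
  obtain ⟨b₁, hb₁, he⟩ := exists_blockGL_mul_eq (notSeparated_toDual i)
    (mem_lowerSubgroup.1 hb) (by rwa [h0]) h
  exact ⟨b₁, hb₁, _, _, _, hd, he.trans (by congr 2; exact blockGL_congr i rfl h0 rfl rfl)⟩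

theorem blockGL_mem_upper (i : Fin (n - 1)) {p q t : F} (h : p * t - q * 0 ≠ 0) :
    blockGL i p q 0 t h ∈ upperBorel n F :=
  blockTriangular_blockMat (fun h => absurd h (lt_asymm (loPt_lt_hiPt i))) fun _ => rfl

theorem blockGL_mem_lower (i : Fin (n - 1)) {p r t : F} (h : p * t - 0 * r ≠ 0) :
    blockGL i p 0 r t h ∈ lowerSubgroup n F :=
  mem_lowerSubgroup.2
    (blockTriangular_blockMat (fun _ => rfl) fun h => absurd h (lt_asymm (loPt_lt_hiPt i)))

/-- When v⁻¹ keeps the order of i and i + 1, conjugation by v leaves the block upper triangular, so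
it can be absorbed by the Borel subgroup on the right. -/
theorem blockGL_mul_permGL {v : Equiv.Perm (Fin n)} {i : Fin (n - 1)}
    (hv : v⁻¹ (loPt i) < v⁻¹ (hiPt i)) {p q t : F} (h : p * t - q * 0 ≠ 0) :
    ∃ b ∈ upperBorel n F, blockGL i p q 0 t h * permGL F v = permGL F v * b := by
  refine ⟨(permGL F v)⁻¹ * blockGL i p q 0 t h * permGL F v, ?_, by group⟩
  intro a b hab
  change (permMat F v⁻¹ * blockMat i p q 0 t * permMat F v) a b = 0
  have h1 : a = v⁻¹ (v a) := by simp
  rw [mul_permMat_apply, h1, permMat_mul_apply]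
  have hab : b < a := hab
  by_cases ha : v a = loPt i
  · rw [ha, blockMat_lo, if_neg, if_neg]
    · intro hb
      rw [← ha, ← hb, ← Equiv.Perm.mul_apply, ← Equiv.Perm.mul_apply, inv_mul_cancel] at hv
      exact lt_asymm hv hab
    · rw [← ha]; exact fun h => hab.ne (v.injective h)
  by_cases hb : v a = hiPt i
  · rw [hb, blockMat_hi, if_neg (c := v b = hiPt i), ite_self]
    rw [← hb]; exact fun h => hab.ne (v.injective h)
  rw [blockMat_of_ne _ _ _ _ _ _ ha hb, if_neg]
  exact fun h => hab.ne' (v.injective h)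

end Cells

/-! ### Fibres of the projections to partial flag varieties -/

section Fibres

variable {n : ℕ} {F : Type*} [Field F]

/-- LU decomposition of the block: for p ≠ 0 it is a lower factor times an upper one, and the upper
one passes through v. For p = 0, in the next lemma, the block is the transposition times an upper
factor. -/
theorem blockGL_mul_permGL_mem_lowCell {v : Equiv.Perm (Fin n)} {i : Fin (n - 1)}
    (hv : v⁻¹ (loPt i) < v⁻¹ (hiPt i)) {p q r t : F} (h : p * t - q * r ≠ 0) (hp : p ≠ 0) :
    blockGL i p q r t h * permGL F v ∈ LowCell F v := by
  have h1 : (1 : F) * 1 - 0 * (r / p) ≠ 0 := by simp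
  have h2 : p * (t - r / p * q) - q * 0 ≠ 0 := by
    contrapose! h
    rw [← h]; field_simp; ring
  obtain ⟨b, hb, he⟩ := blockGL_mul_permGL hv h2
  refine ⟨blockGL i 1 0 (r / p) 1 h1, blockGL_mem_lower i h1, b, hb, ?_⟩
  rw [mul_assoc, ← he, ← mul_assoc]
  obtain ⟨h3, he'⟩ := blockGL_mul i h1 h2
  rw [he']
  congr 1
  exact blockGL_congr i (by ring) (by ring) (by field_simp; ring) (by ring)

theorem blockGL_mul_permGL_mem_lowCell_swap {v : Equiv.Perm (Fin n)} {i : Fin (n - 1)}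
    (hv : v⁻¹ (loPt i) < v⁻¹ (hiPt i)) {p q r t : F} (h : p * t - q * r ≠ 0) (hp : p = 0) :
    blockGL i p q r t h * permGL F v ∈ LowCell F (simpleSwap n i * v) := by
  subst hp
  have h2 : r * q - t * 0 ≠ 0 := by
    contrapose! h
    linear_combination -h
  obtain ⟨b, hb, he⟩ := blockGL_mul_permGL hv h2
  refine ⟨1, one_mem _, b, hb, ?_⟩
  rw [one_mul, permGL_simpleSwap_mul, mul_assoc, ← he, ← mul_assoc]
  obtain ⟨h3, he'⟩ := blockGL_mul i (by simp : (0 : F) * 0 - 1 * 1 ≠ 0) h2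
  rw [he']
  congr 1
  exact blockGL_congr i (by ring) (by ring) (by ring) (by ring)

/-- Bruhat decomposition of the 2×2 block: for r ≠ 0 it is upper times transposition times upper. -/
theorem blockGL_mul_permGL_mem_upCell_swap {u : Equiv.Perm (Fin n)} {i : Fin (n - 1)}
    (hu : u⁻¹ (loPt i) < u⁻¹ (hiPt i)) {p q r t : F} (h : p * t - q * r ≠ 0) (hr : r ≠ 0) :
    blockGL i p q r t h * permGL F u ∈ UpCell F (simpleSwap n i * u) := by
  have h1 : (q - p * t / r) * r - p * 0 ≠ 0 := by
    contrapose! h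
    rw [mul_zero, sub_zero] at h
    rw [← neg_eq_zero, ← h]; field_simp; ring
  have h2 : (1 : F) * 1 - t / r * 0 ≠ 0 := by simp
  obtain ⟨b, hb, he⟩ := blockGL_mul_permGL hu h2
  refine ⟨blockGL i (q - p * t / r) p 0 r h1, blockGL_mem_upper i h1, b, hb, ?_⟩
  rw [permGL_simpleSwap_mul, mul_assoc, mul_assoc, ← he, ← mul_assoc, ← mul_assoc]
  obtain ⟨h3, he'⟩ := blockGL_mul i h1 (by simp : (0 : F) * 0 - 1 * 1 ≠ 0)
  rw [he']
  obtain ⟨h4, he'⟩ := blockGL_mul i h3 h2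
  rw [he']
  congr 1
  exact blockGL_congr i (by ring) (by field_simp; ring) (by ring) (by field_simp; ring)

theorem blockGL_mul_permGL_mem_upCell {u : Equiv.Perm (Fin n)} {i : Fin (n - 1)}
    (hu : u⁻¹ (loPt i) < u⁻¹ (hiPt i)) {p q r t : F} (h : p * t - q * r ≠ 0) (hr : r = 0) :
    blockGL i p q r t h * permGL F u ∈ UpCell F u := by
  subst hr
  obtain ⟨b, hb, he⟩ := blockGL_mul_permGL hu h
  exact ⟨1, one_mem _, b, hb, by rw [he, one_mul]⟩

/-- The union of two opposite cells which differ by a simple transposition is stable under the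
corresponding block matrices. -/
theorem blockGL_mul_mem_lowCell_or {v : Equiv.Perm (Fin n)} {i : Fin (n - 1)}
    (hv : v⁻¹ (loPt i) < v⁻¹ (hiPt i)) {p q r t : F} (h : p * t - q * r ≠ 0)
    {g : Matrix.GeneralLinearGroup (Fin n) F}
    (hg : g ∈ LowCell F v ∨ g ∈ LowCell F (simpleSwap n i * v)) :
    blockGL i p q r t h * g ∈ LowCell F v ∨
      blockGL i p q r t h * g ∈ LowCell F (simpleSwap n i * v) := by
  have key : ∀ (p q r t : F) (h : p * t - q * r ≠ 0), blockGL i p q r t h * permGL F v ∈ LowCell F v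
      ∨ blockGL i p q r t h * permGL F v ∈ LowCell F (simpleSwap n i * v) := by
    intro p q r t h
    by_cases hp : p = 0
    · exact Or.inr (blockGL_mul_permGL_mem_lowCell_swap hv h hp)
    · exact Or.inl (blockGL_mul_permGL_mem_lowCell hv h hp)
  rcases hg with ⟨c, hc, b, hb, rfl⟩ | ⟨c, hc, b, hb, rfl⟩ <;>
    obtain ⟨c₁, hc₁, l₁, l₂, l₃, hl, he⟩ := exists_lower_mul (i := i) hc h <;>
    obtain ⟨h1, h2⟩ := blockGL_mul i h hl
  · have e : blockGL i p q r t h * (c * permGL F v * b) = c₁ * (blockGL i _ _ _ _ h1 *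
      permGL F v) * b := by
      rw [← h2, ← mul_assoc, ← mul_assoc, he]; group
    rw [e]
    exact (key _ _ _ _ h1).imp (LowCell.mul_mul hc₁ hb)
      (LowCell.mul_mul hc₁ hb)
  · obtain ⟨h3, h4⟩ := blockGL_mul i h1 (by simp : (0 : F) * 0 - 1 * 1 ≠ 0)
    have e : blockGL i p q r t h * (c * permGL F (simpleSwap n i * v) * b)
        = c₁ * (blockGL i _ _ _ _ h3 * permGL F v) * b := by
      rw [← h4, ← h2, ← mul_assoc, ← mul_assoc, he, permGL_simpleSwap_mul]; group
    rw [e]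
    exact (key _ _ _ _ h3).imp (LowCell.mul_mul hc₁ hb)
      (LowCell.mul_mul hc₁ hb)

/-- The product of a simple transposition with an elementary matrix: the representatives of the
points of a Schubert curve other than the base point. -/
def curveGL (i : Fin (n - 1)) (x : F) : Matrix.GeneralLinearGroup (Fin n) F :=
  blockGL i x 1 1 0 (by simp)

theorem curveGL_inv (i : Fin (n - 1)) (x : F) :
    (curveGL i x)⁻¹ = blockGL i 0 1 1 (-x) (by simp) := by
  refine Units.ext ?_
  change blockMat i _ _ _ _ = blockMat i _ _ _ _
  congr 1 <;> simp [div_neg]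

/-- After the lower factor and the transposition have been multiplied in, the upper left entry of
the block is a diagonal entry of the lower factor and does not involve x; so all points of the curve
land in the cell of v. -/
theorem curveGL_mul_mem_lowCell_of_swap {v : Equiv.Perm (Fin n)} {i : Fin (n - 1)}
    (hv : v⁻¹ (loPt i) < v⁻¹ (hiPt i)) {g : Matrix.GeneralLinearGroup (Fin n) F}
    (hg : g ∈ LowCell F (simpleSwap n i * v)) (x : F) : curveGL i x * g ∈ LowCell F v := by
  have h : x * 0 - 1 * 1 ≠ 0 := by simp
  obtain ⟨c, hc, b, hb, rfl⟩ := hg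
  obtain ⟨c₁, hc₁, l₁, l₂, l₃, hl, he⟩ := exists_lower_mul (i := i) hc h
  obtain ⟨h1, h2⟩ := blockGL_mul i h hl
  obtain ⟨h3, h4⟩ := blockGL_mul i h1 (by simp : (0 : F) * 0 - 1 * 1 ≠ 0)
  have e : curveGL i x * (c * permGL F (simpleSwap n i * v) * b)
      = c₁ * (blockGL i _ _ _ _ h3 * permGL F v) * b := by
    rw [← h4, ← h2, ← mul_assoc, ← mul_assoc, curveGL, he, permGL_simpleSwap_mul]; group
  rw [e]
  refine LowCell.mul_mul hc₁ hb (blockGL_mul_permGL_mem_lowCell hv h3 ?_)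
  exact fun h0 => hl (by linear_combination l₁ * h0)

theorem exists_curveGL_mul_mem_lowCell {v : Equiv.Perm (Fin n)} {i : Fin (n - 1)}
    (hv : v⁻¹ (loPt i) < v⁻¹ (hiPt i)) {g : Matrix.GeneralLinearGroup (Fin n) F}
    (hg : g ∈ LowCell F v) : ∃ d : F, ∀ x, (x ≠ d → curveGL i x * g ∈ LowCell F v) ∧
      (x = d → curveGL i x * g ∈ LowCell F (simpleSwap n i * v)) := by
  have h : ∀ x : F, x * 0 - 1 * 1 ≠ 0 := by simp
  obtain ⟨c, hc, b, hb, rfl⟩ := hg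
  have hd : c.1 (loPt i) (loPt i) * c.1 (hiPt i) (hiPt i) - 0 * c.1 (hiPt i) (loPt i) ≠ 0 := by
    rw [zero_mul, sub_zero]
    exact mul_ne_zero (lower_diag_ne_zero hc _) (lower_diag_ne_zero hc _)
  have h0 : c.1 (loPt i) (hiPt i) = 0 := hc _ _ (loPt_lt_hiPt i)
  have hl := lower_diag_ne_zero hc (loPt i)
  -- The upper left entry of the product block is x c₁₁ + c₂₁, with c₁₁, c₂₁ taken from the block of
  -- c; the exceptional x is its zero.
  refine ⟨- c.1 (hiPt i) (loPt i) / c.1 (loPt i) (loPt i), fun x => ?_⟩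
  have hd' : c.1 (loPt i) (loPt i) * c.1 (hiPt i) (hiPt i)
      - c.1 (loPt i) (hiPt i) * c.1 (hiPt i) (loPt i) ≠ 0 := by rwa [h0]
  obtain ⟨c₁, hc₁, he⟩ := exists_blockGL_mul_eq (notSeparated_toDual i)
    (mem_lowerSubgroup.1 hc) hd' (h x)
  obtain ⟨h1, h2⟩ := blockGL_mul i (h x) hd'
  have e : curveGL i x * (c * permGL F v * b)
      = c₁ * (blockGL i _ _ _ _ h1 * permGL F v) * b := by
    rw [← h2, ← mul_assoc, ← mul_assoc, curveGL, he]; group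
  rw [e]
  refine ⟨fun hx => ?_, fun hx => ?_⟩
  · refine LowCell.mul_mul hc₁ hb (blockGL_mul_permGL_mem_lowCell hv h1 ?_)
    contrapose! hx
    field_simp
    linear_combination hx
  · refine LowCell.mul_mul hc₁ hb (blockGL_mul_permGL_mem_lowCell_swap hv h1 ?_)
    rw [hx]
    field_simp
    ring

theorem curveGL_mul_mem_upCell {u : Equiv.Perm (Fin n)} {i : Fin (n - 1)}
    (hu : u⁻¹ (loPt i) < u⁻¹ (hiPt i)) {g : Matrix.GeneralLinearGroup (Fin n) F}
    (hg : g ∈ UpCell F u) (x : F) : curveGL i x * g ∈ UpCell F (simpleSwap n i * u) := by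
  have h : x * 0 - 1 * 1 ≠ 0 := by simp
  obtain ⟨c, hc, b, hb, rfl⟩ := hg
  obtain ⟨c₁, hc₁, l₁, l₂, l₃, hl, he⟩ := exists_upper_mul (i := i) hc h
  obtain ⟨h1, h2⟩ := blockGL_mul i h hl
  have e : curveGL i x * (c * permGL F u * b)
      = c₁ * (blockGL i _ _ _ _ h1 * permGL F u) * b := by
    rw [← h2, ← mul_assoc, ← mul_assoc, curveGL, he]; group
  rw [e]
  refine UpCell.mul_mul hc₁ hb (blockGL_mul_permGL_mem_upCell_swap hu h1 ?_)
  exact fun h0 => hl (by linear_combination l₃ * h0)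

/-- The lower left entry of the resulting block is linear in x with a nonzero coefficient, so
precisely one x brings g down to the cell of u. This is the line coordinate of g in the product
decomposition of the cell of su. -/
theorem exists_curveGL_inv_mul_mem_upCell {u : Equiv.Perm (Fin n)} {i : Fin (n - 1)}
    (hu : u⁻¹ (loPt i) < u⁻¹ (hiPt i)) {g : Matrix.GeneralLinearGroup (Fin n) F}
    (hg : g ∈ UpCell F (simpleSwap n i * u)) :
    ∃ d : F, ∀ x, (curveGL i x)⁻¹ * g ∈ UpCell F u ↔ x = d := by
  have h : ∀ x : F, 0 * -x - 1 * 1 ≠ 0 := by simp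
  obtain ⟨c, hc, b, hb, rfl⟩ := hg
  have hd : c.1 (loPt i) (loPt i) * c.1 (hiPt i) (hiPt i) - c.1 (loPt i) (hiPt i) * 0 ≠ 0 := by
    rw [mul_zero, sub_zero]
    exact mul_ne_zero (upper_diag_ne_zero hc _) (upper_diag_ne_zero hc _)
  have h0 : c.1 (hiPt i) (loPt i) = 0 := hc (loPt_lt_hiPt i)
  have hl := upper_diag_ne_zero hc (hiPt i)
  refine ⟨c.1 (loPt i) (hiPt i) / c.1 (hiPt i) (hiPt i), fun x => ?_⟩
  have hd' : c.1 (loPt i) (loPt i) * c.1 (hiPt i) (hiPt i)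
      - c.1 (loPt i) (hiPt i) * c.1 (hiPt i) (loPt i) ≠ 0 := by rwa [h0]
  obtain ⟨c₁, hc₁, he⟩ := exists_blockGL_mul_eq (notSeparated_id i) hc hd' (h x)
  obtain ⟨h1, h2⟩ := blockGL_mul i (h x) hd'
  obtain ⟨h3, h4⟩ := blockGL_mul i h1 (by simp : (0 : F) * 0 - 1 * 1 ≠ 0)
  have e : (curveGL i x)⁻¹ * (c * permGL F (simpleSwap n i * u) * b)
      = c₁ * (blockGL i _ _ _ _ h3 * permGL F u) * b := by
    rw [← h4, ← h2, ← mul_assoc, ← mul_assoc, curveGL_inv, he, permGL_simpleSwap_mul]; group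
  rw [e]
  refine ⟨fun hx => ?_, fun hx => ?_⟩
  · by_contra hne
    have h5 : c₁ * (blockGL i _ _ _ _ h3 * permGL F u) * b ∈ UpCell F (simpleSwap n i * u) := by
      refine UpCell.mul_mul hc₁ hb (blockGL_mul_permGL_mem_upCell_swap hu h3 ?_)
      contrapose! hne
      field_simp
      linear_combination -hne
    have h6 := UpCell.unique hx h5
    have h7 := congrArg (fun w : Equiv.Perm (Fin n) => w⁻¹ (loPt i)) h6
    simp only [simpleSwap_mul_inv_lo] at h7
    exact hu.ne h7
  · refine UpCell.mul_mul hc₁ hb (blockGL_mul_permGL_mem_upCell hu h3 ?_)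
    rw [hx]
    field_simp
    ring

end Fibres

/-! ### Point counts of open Richardson varieties -/

section Counts

variable {n : ℕ} {F : Type*} [Field F]

theorem UpCell.of_mk_eq {w : Equiv.Perm (Fin n)} {g h : Matrix.GeneralLinearGroup (Fin n) F}
    (he : (g : Matrix.GeneralLinearGroup (Fin n) F ⧸ upperBorel n F) = h)
    (hg : g ∈ UpCell F w) : h ∈ UpCell F w := by
  have := UpCell.mul_right hg (QuotientGroup.eq.1 he)
  rwa [mul_inv_cancel_left] at this

theorem LowCell.of_mk_eq {w : Equiv.Perm (Fin n)} {g h : Matrix.GeneralLinearGroup (Fin n) F}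
    (he : (g : Matrix.GeneralLinearGroup (Fin n) F ⧸ upperBorel n F) = h)
    (hg : g ∈ LowCell F w) : h ∈ LowCell F w := by
  have := LowCell.mul_right hg (QuotientGroup.eq.1 he)
  rwa [mul_inv_cancel_left] at this

theorem mk_mem_richardson {v w : Equiv.Perm (Fin n)}
    {g : Matrix.GeneralLinearGroup (Fin n) F} :
    (g : Matrix.GeneralLinearGroup (Fin n) F ⧸ upperBorel n F) ∈ richardson F v w ↔
      g ∈ UpCell F w ∧ g ∈ LowCell F v := by
  constructor
  · rintro ⟨h, he, ⟨b, hb, b', hb', e⟩, ⟨c, hc, c', hc', e'⟩⟩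
    exact ⟨UpCell.of_mk_eq he ⟨b, hb, b', hb', Units.ext e⟩,
      LowCell.of_mk_eq he ⟨c, hc, c', hc', Units.ext e'⟩⟩
  · rintro ⟨⟨b, hb, b', hb', e⟩, ⟨c, hc, c', hc', e'⟩⟩
    exact ⟨g, rfl, ⟨b, hb, b', hb', congrArg Units.val e⟩, ⟨c, hc, c', hc', congrArg Units.val e'⟩⟩

/-- The pairs of a point of a Schubert cell and a point of the affine line which parametrize the
points of an open Richardson variety in the cell of the next larger permutation. -/
def richardsonFibration (F : Type*) [Field F] {n : ℕ} (i : Fin (n - 1)) (v u : Equiv.Perm (Fin n)) :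
    Set (F × (Matrix.GeneralLinearGroup (Fin n) F ⧸ upperBorel n F)) :=
  {p | ∃ g ∈ UpCell F u, p.2 = g ∧ curveGL i p.1 * g ∈ LowCell F v}

theorem mem_richardsonFibration {i : Fin (n - 1)} {v u : Equiv.Perm (Fin n)}
    {g : Matrix.GeneralLinearGroup (Fin n) F} {x : F} :
    (x, (g : Matrix.GeneralLinearGroup (Fin n) F ⧸ upperBorel n F)) ∈ richardsonFibration F i v u ↔
      g ∈ UpCell F u ∧ curveGL i x * g ∈ LowCell F v := by
  constructor
  · rintro ⟨h, hh, he, hl⟩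
    refine ⟨UpCell.of_mk_eq (Eq.symm he) hh, LowCell.of_mk_eq ?_ hl⟩
    exact (congrArg (fun z => curveGL i x • z) he).symm
  · rintro ⟨h1, h2⟩
    exact ⟨g, h1, rfl, h2⟩

/-- The map (x, y) ↦ c(x)y is a bijection from the product of the line and the cell of u onto the
cell of su; the opposite cell only restricts both sides. -/
theorem card_richardson_swap {u : Equiv.Perm (Fin n)} {i : Fin (n - 1)}
    (hu : u⁻¹ (loPt i) < u⁻¹ (hiPt i)) (v : Equiv.Perm (Fin n)) :
    Nat.card (richardson F v (simpleSwap n i * u)) = Nat.card (richardsonFibration F i v u) := by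
  symm
  refine Nat.card_congr (Equiv.ofBijective (fun p => ⟨curveGL i p.1.1 • p.1.2, ?_⟩) ⟨?_, ?_⟩)
  · obtain ⟨⟨x, y⟩, hp⟩ := p
    obtain ⟨g, rfl⟩ := QuotientGroup.mk_surjective y
    obtain ⟨hg, hl⟩ := mem_richardsonFibration.1 hp
    exact mk_mem_richardson.2 ⟨curveGL_mul_mem_upCell hu hg x, hl⟩
  · rintro ⟨⟨x, y⟩, hp⟩ ⟨⟨x', y'⟩, hp'⟩ he
    obtain ⟨g, rfl⟩ := QuotientGroup.mk_surjective y
    obtain ⟨g', rfl⟩ := QuotientGroup.mk_surjective y'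
    obtain ⟨hg, hl⟩ := mem_richardsonFibration.1 hp
    obtain ⟨hg', hl'⟩ := mem_richardsonFibration.1 hp'
    simp only [Subtype.mk.injEq] at he
    have he : ((curveGL i x * g : Matrix.GeneralLinearGroup (Fin n) F) :
      Matrix.GeneralLinearGroup (Fin n) F ⧸ upperBorel n F)
        = ((curveGL i x' * g' : Matrix.GeneralLinearGroup (Fin n) F)) := he
    obtain ⟨d, hd⟩ := exists_curveGL_inv_mul_mem_upCell hu (curveGL_mul_mem_upCell hu hg x)
    have h1 : x = d := (hd x).1 (by rwa [inv_mul_cancel_left])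
    have h2 : x' = d := by
      refine (hd x').1 (UpCell.of_mk_eq (g := g') ?_ hg')
      have := congrArg (fun z => (curveGL i x')⁻¹ • z) he
      have this : (((curveGL i x')⁻¹ * (curveGL i x * g) : Matrix.GeneralLinearGroup (Fin n) F) :
        Matrix.GeneralLinearGroup (Fin n) F ⧸ upperBorel n F)
        = (((curveGL i x')⁻¹ * (curveGL i x' * g') : Matrix.GeneralLinearGroup (Fin n) F)) := this
      rw [this, inv_mul_cancel_left]
    obtain rfl : x = x' := h1.trans h2.symm
    have := congrArg (fun z => (curveGL i x)⁻¹ • z) he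
    have this : (((curveGL i x)⁻¹ * (curveGL i x * g) : Matrix.GeneralLinearGroup (Fin n) F) :
      Matrix.GeneralLinearGroup (Fin n) F ⧸ upperBorel n F)
      = (((curveGL i x)⁻¹ * (curveGL i x * g') : Matrix.GeneralLinearGroup (Fin n) F)) := this
    rw [inv_mul_cancel_left, inv_mul_cancel_left] at this
    simp [this]
  · rintro ⟨y, hy⟩
    obtain ⟨g, rfl⟩ := QuotientGroup.mk_surjective y
    obtain ⟨h1, h2⟩ := mk_mem_richardson.1 hy
    obtain ⟨d, hd⟩ := exists_curveGL_inv_mul_mem_upCell hu h1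
    refine ⟨⟨(d, ((curveGL i d)⁻¹ * g : Matrix.GeneralLinearGroup (Fin n) F)), _, (hd d).2 rfl, rfl,
      by rwa [mul_inv_cancel_left]⟩, ?_⟩
    refine Subtype.ext ?_
    change ((curveGL i d * ((curveGL i d)⁻¹ * g) : Matrix.GeneralLinearGroup (Fin n) F) :
      Matrix.GeneralLinearGroup (Fin n) F ⧸ upperBorel n F) = g
    rw [mul_inv_cancel_left]

theorem asc_swap_ne {v : Equiv.Perm (Fin n)} (i : Fin (n - 1)) : v ≠ simpleSwap n i * v := by
  intro h
  have := congrArg (fun w : Equiv.Perm (Fin n) => w⁻¹ (loPt i)) h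
  simp only [simpleSwap_mul_inv_lo] at this
  exact inv_lo_ne_inv_hi v i this

theorem card_richardson_one (v : Equiv.Perm (Fin n)) :
    Nat.card (richardson F v 1) = if v = 1 then 1 else 0 := by
  have key : ∀ y ∈ richardson F v 1, v = 1 ∧ y = ((1 : Matrix.GeneralLinearGroup (Fin n) F) :
      Matrix.GeneralLinearGroup (Fin n) F ⧸ upperBorel n F) := by
    intro y hy
    obtain ⟨g, rfl⟩ := QuotientGroup.mk_surjective y
    obtain ⟨⟨b, hb, b', hb', rfl⟩, h2⟩ := mk_mem_richardson.1 hy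
    have h3 : b * permGL F 1 * b' ∈ upperBorel n F := by
      rw [permGL_one, mul_one]; exact mul_mem hb hb'
    refine ⟨?_, (QuotientGroup.eq.2 (by simpa using h3)).symm⟩
    have h4 := LowCell.mul_right h2 (inv_mem h3)
    rw [mul_inv_cancel] at h4
    refine LowCell.unique h4 ?_
    rw [← permGL_one]
    exact permGL_mem_lowCell 1
  split_ifs with hv
  · subst hv
    rw [Nat.card_eq_one_iff_unique]
    refine ⟨⟨fun a b => Subtype.ext ((key _ a.2).2.trans (key _ b.2).2.symm)⟩, ⟨⟨_,
      mk_mem_richardson.2 ⟨permGL_mem_upCell 1, permGL_mem_lowCell 1⟩⟩⟩⟩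
  · rw [Nat.card_eq_zero]
    exact Or.inl ⟨fun a => hv (key _ a.2).1⟩

variable [Fintype F]

/-- Fibrewise count over the cell of u: q - 1 values of x over the opposite cell of v, q values over
that of sv, and none elsewhere, since the union of these two opposite cells is stable under the
block matrices. -/
theorem card_richardson_asc {u v : Equiv.Perm (Fin n)} {i : Fin (n - 1)}
    (hu : u⁻¹ (loPt i) < u⁻¹ (hiPt i)) (hv : v⁻¹ (loPt i) < v⁻¹ (hiPt i)) :
    Nat.card (richardson F v (simpleSwap n i * u))
      = (Fintype.card F - 1) * Nat.card (richardson F v u)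
        + Fintype.card F * Nat.card (richardson F (simpleSwap n i * v) u) := by
  classical
  rw [card_richardson_swap hu]
  have := Fintype.ofFinite (Matrix.GeneralLinearGroup (Fin n) F ⧸ upperBorel n F)
  simp only [Nat.card_eq_fintype_card, Fintype.card_subtype]
  rw [Finset.card_filter, Fintype.sum_prod_type_right, Finset.card_filter, Finset.card_filter,
    Finset.mul_sum, Finset.mul_sum, ← Finset.sum_add_distrib]
  refine Finset.sum_congr rfl fun y _ => ?_
  obtain ⟨g, rfl⟩ := QuotientGroup.mk_surjective y
  simp only [mem_richardsonFibration, mk_mem_richardson]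
  by_cases h0 : g ∈ UpCell F u
  swap
  · simp [h0]
  simp only [h0, true_and]
  by_cases h1 : g ∈ LowCell F v
  · have h2 : g ∉ LowCell F (simpleSwap n i * v) := fun h => asc_swap_ne i (LowCell.unique h1 h)
    obtain ⟨d, hd⟩ := exists_curveGL_mul_mem_lowCell hv h1
    have h3 : ∀ x, curveGL i x * g ∈ LowCell F v ↔ x ≠ d := fun x =>
      ⟨fun h hx => asc_swap_ne i (LowCell.unique h ((hd x).2 hx)), (hd x).1⟩
    simp only [h1, h2, h3, if_true, if_false]
    rw [← Finset.card_filter, Finset.filter_ne', Finset.card_erase_of_mem (Finset.mem_univ _),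
      Finset.card_univ]
    simp
  by_cases h2 : g ∈ LowCell F (simpleSwap n i * v)
  · have h3 : ∀ x, curveGL i x * g ∈ LowCell F v := curveGL_mul_mem_lowCell_of_swap hv h2
    simp [h1, h2, h3]
  · have h3 : ∀ x, curveGL i x * g ∉ LowCell F v := by
      intro x hx
      have := blockGL_mul_mem_lowCell_or hv (by simp : (0 : F) * -x - 1 * 1 ≠ 0) (Or.inl hx)
      rw [← curveGL_inv, inv_mul_cancel_left] at this
      exact this.elim h1 h2
    simp [h1, h2, h3]

/-- Over each point of the opposite cell of v exactly one x leads into the cell of sv, and over the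
other points none does. -/
theorem card_richardson_desc {u v : Equiv.Perm (Fin n)} {i : Fin (n - 1)}
    (hu : u⁻¹ (loPt i) < u⁻¹ (hiPt i)) (hv : v⁻¹ (loPt i) < v⁻¹ (hiPt i)) :
    Nat.card (richardson F (simpleSwap n i * v) (simpleSwap n i * u))
      = Nat.card (richardson F v u) := by
  classical
  rw [card_richardson_swap hu]
  have := Fintype.ofFinite (Matrix.GeneralLinearGroup (Fin n) F ⧸ upperBorel n F)
  simp only [Nat.card_eq_fintype_card, Fintype.card_subtype]
  rw [Finset.card_filter, Fintype.sum_prod_type_right, Finset.card_filter]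
  refine Finset.sum_congr rfl fun y _ => ?_
  obtain ⟨g, rfl⟩ := QuotientGroup.mk_surjective y
  simp only [mem_richardsonFibration, mk_mem_richardson]
  by_cases h0 : g ∈ UpCell F u
  swap
  · simp [h0]
  simp only [h0, true_and]
  by_cases h1 : g ∈ LowCell F v
  · obtain ⟨d, hd⟩ := exists_curveGL_mul_mem_lowCell hv h1
    have h3 : ∀ x, curveGL i x * g ∈ LowCell F (simpleSwap n i * v) ↔ x = d := fun x =>
      ⟨fun h => by_contra fun hx => asc_swap_ne i (LowCell.unique ((hd x).1 hx) h), (hd x).2⟩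
    simp [h1, h3]
  · have h3 : ∀ x, curveGL i x * g ∉ LowCell F (simpleSwap n i * v) := by
      intro x hx
      have h4 := blockGL_mul_mem_lowCell_or hv (by simp : (0 : F) * -x - 1 * 1 ≠ 0) (Or.inr hx)
      rw [← curveGL_inv, inv_mul_cancel_left] at h4
      have h5 := curveGL_mul_mem_lowCell_of_swap hv (h4.resolve_left h1) x
      exact asc_swap_ne i (LowCell.unique h5 hx)
    simp [h1, h3]

theorem card_richardson_self (w : Equiv.Perm (Fin n)) : Nat.card (richardson F w w) = 1 := by
  induction hl : permLength w using Nat.strong_induction_on generalizing w with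
  | _ l ih =>
  by_cases hw : w = 1
  · subst hw; rw [card_richardson_one, if_pos rfl]
  · obtain ⟨i, hi⟩ := exists_descent hw
    have h1 := permLength_simpleSwap_mul_of_gt hi
    have h2 : (simpleSwap n i * w)⁻¹ (loPt i) < (simpleSwap n i * w)⁻¹ (hiPt i) := by
      rwa [simpleSwap_mul_inv_lo, simpleSwap_mul_inv_hi]
    have h3 := card_richardson_desc (F := F) h2 h2
    rw [simpleSwap_mul_cancel] at h3
    rw [h3]
    exact ih _ (by omega) _ rfl

/-- The coefficients q - 1 and q are positive, so nonvanishing of the counts obeys the same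
recursion as the Bruhat order does by the lifting property. -/
theorem card_richardson_ne_zero_iff (v w : Equiv.Perm (Fin n)) :
    Nat.card (richardson F v w) ≠ 0 ↔ BruhatLE v w := by
  induction hl : permLength w using Nat.strong_induction_on generalizing v w with
  | _ l ih =>
  by_cases hw : w = 1
  · subst hw
    rw [card_richardson_one]
    split_ifs with hv
    · subst hv; simp [BruhatLE.refl]
    · simp only [ne_eq, not_true_eq_false, false_iff]
      exact fun h => hv h.eq_one
  · obtain ⟨i, hi⟩ := exists_descent hw
    have h1 := permLength_simpleSwap_mul_of_gt hi
    have h2 : (simpleSwap n i * w)⁻¹ (loPt i) < (simpleSwap n i * w)⁻¹ (hiPt i) := by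
      rwa [simpleSwap_mul_inv_lo, simpleSwap_mul_inv_hi]
    rcases inv_lo_lt_or v i with hv | hv
    · have h3 := card_richardson_asc (F := F) h2 hv
      rw [simpleSwap_mul_cancel] at h3
      rw [bruhatLE_iff_of_asc hi hv, ← ih _ (by omega) v _ rfl,
        ← ih _ (by omega) (simpleSwap n i * v) _ rfl, h3]
      have hq := Fintype.one_lt_card (α := F)
      have hq' : Fintype.card F - 1 ≠ 0 := by omega
      have hq'' : Fintype.card F ≠ 0 := by omega
      rw [ne_eq, Nat.add_eq_zero_iff, Nat.mul_eq_zero, Nat.mul_eq_zero]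
      tauto
    · have h4 : (simpleSwap n i * v)⁻¹ (loPt i) < (simpleSwap n i * v)⁻¹ (hiPt i) := by
        rwa [simpleSwap_mul_inv_lo, simpleSwap_mul_inv_hi]
      have h3 := card_richardson_desc (F := F) h2 h4
      rw [simpleSwap_mul_cancel, simpleSwap_mul_cancel] at h3
      rw [bruhatLE_iff_of_desc hi hv, h3]
      exact ih _ (by omega) _ _ rfl

/-- The number of points of an open Richardson variety over a finite field. -/
theorem card_richardson (v w : Equiv.Perm (Fin n)) :
    (Nat.card (richardson F v w) : ℤ) = (klR v w).eval (Fintype.card F : ℤ) := by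
  induction hl : permLength w using Nat.strong_induction_on generalizing v w with
  | _ l ih =>
  -- The ascending branch of `klR` keeps w and lengthens v, whose length is at most n², so a second
  -- induction is needed for fixed w.
  induction hm : n * n - permLength v using Nat.strong_induction_on generalizing v with
  | _ m ihm =>
  rw [klR]
  split_ifs with h1 h2 h3 h4 h5
  · subst h1; rw [card_richardson_self]; simp
  · have hi := permLength_simpleSwap_mul_lt_iff.1 h3.choose_spec
    have hv := permLength_simpleSwap_mul_lt_iff.1 h4
    rw [← ih _ (hl ▸ h3.choose_spec) _ _ rfl]
    have := card_richardson_desc (F := F) (u := simpleSwap n h3.choose * w)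
      (v := simpleSwap n h3.choose * v) (i := h3.choose)
      (by rwa [simpleSwap_mul_inv_lo, simpleSwap_mul_inv_hi])
      (by rwa [simpleSwap_mul_inv_lo, simpleSwap_mul_inv_hi])
    rw [simpleSwap_mul_cancel, simpleSwap_mul_cancel] at this
    rw [this]
  · have hi := permLength_simpleSwap_mul_lt_iff.1 h3.choose_spec
    have hv := permLength_lt_simpleSwap_mul_iff.1 h5
    have hle := permLength_le (simpleSwap n h3.choose * v)
    have h6 : (simpleSwap n h3.choose * w)⁻¹ (loPt h3.choose)
        < (simpleSwap n h3.choose * w)⁻¹ (hiPt h3.choose) := by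
      rwa [simpleSwap_mul_inv_lo, simpleSwap_mul_inv_hi]
    -- The definition uses R_{sv}^w where the geometric recursion has R_v^{sw}; the descending case
    -- identifies their counts.
    have h7 := card_richardson_desc (F := F) h6 hv
    have h8 := card_richardson_asc (F := F) h6 hv
    rw [simpleSwap_mul_cancel] at h7 h8
    rw [Polynomial.eval_add, Polynomial.eval_mul, Polynomial.eval_mul, ← ihm _ (by omega) _ rfl,
      ← ih _ (hl ▸ h3.choose_spec) _ _ rfl, h7, h8]
    have hq := Fintype.one_lt_card (α := F)
    push_cast [Nat.cast_sub hq.le]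
    simp
  · exact absurd (permLength_lt_simpleSwap_mul_iff.2
      ((inv_lo_lt_or v _).resolve_right fun h => h4 (permLength_simpleSwap_mul_lt_iff.2 h))) h5
  · exfalso
    have hw : w ≠ 1 := by
      rintro rfl
      exact h1 h2.eq_one
    obtain ⟨i, hi⟩ := exists_descent hw
    exact h3 ⟨i, permLength_simpleSwap_mul_lt_iff.2 hi⟩
  · rw [Polynomial.eval_zero, Nat.cast_eq_zero]
    by_contra h
    exact h2 ((card_richardson_ne_zero_iff v w).1 h)

end Counts

/-! ### The R-recursion for an arbitrary descent -/

section RRecursion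

variable {n : ℕ}

/-- Transfers identities from point counts over the fields `ZMod l` to polynomials. This is how the
choice of a descent in the definition of `klR` is shown not to matter. -/
theorem klR_eq_of_eval_prime {p q : Polynomial ℤ}
    (h : ∀ l : ℕ, l.Prime → p.eval (l : ℤ) = q.eval (l : ℤ)) : p = q := by
  refine Polynomial.eq_of_infinite_eval_eq p q ?_
  refine Set.Infinite.mono (s := (Nat.cast : ℕ → ℤ) '' {l | l.Prime}) ?_
    (Nat.infinite_setOfPred_prime.image Nat.cast_injective.injOn)
  rintro _ ⟨l, hl, rfl⟩
  exact h l hl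

theorem klR_one (v : Equiv.Perm (Fin n)) : klR v 1 = if v = 1 then 1 else 0 := by
  refine klR_eq_of_eval_prime fun l hl => ?_
  have := Fact.mk hl
  have h := card_richardson (F := ZMod l) v 1
  rw [ZMod.card] at h
  rw [← h, card_richardson_one]
  split_ifs <;> simp

theorem klR_asc {u v : Equiv.Perm (Fin n)} {i : Fin (n - 1)}
    (hu : u⁻¹ (loPt i) < u⁻¹ (hiPt i)) (hv : v⁻¹ (loPt i) < v⁻¹ (hiPt i)) :
    klR v (simpleSwap n i * u)
      = (Polynomial.X - 1) * klR v u + Polynomial.X * klR (simpleSwap n i * v) u := by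
  refine klR_eq_of_eval_prime fun l hl => ?_
  have := Fact.mk hl
  have h := fun v w : Equiv.Perm (Fin n) => card_richardson (F := ZMod l) v w
  simp only [ZMod.card] at h
  rw [Polynomial.eval_add, Polynomial.eval_mul, Polynomial.eval_mul, ← h, ← h, ← h,
    card_richardson_asc hu hv, ZMod.card]
  push_cast [Nat.cast_sub hl.one_lt.le]
  simp

theorem klR_desc {u v : Equiv.Perm (Fin n)} {i : Fin (n - 1)}
    (hu : u⁻¹ (loPt i) < u⁻¹ (hiPt i)) (hv : v⁻¹ (loPt i) < v⁻¹ (hiPt i)) :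
    klR (simpleSwap n i * v) (simpleSwap n i * u) = klR v u := by
  refine klR_eq_of_eval_prime fun l hl => ?_
  have := Fact.mk hl
  have h := fun v w : Equiv.Perm (Fin n) => card_richardson (F := ZMod l) v w
  simp only [ZMod.card] at h
  rw [← h, ← h, card_richardson_desc hu hv]

end RRecursion

/-! ### The regular representation of the Hecke algebra -/

section Hecke

variable {R : Type*} [CommRing R] (z : R)

/-- The simple transpositions of `ℕ`. -/
def natSwap (i : ℕ) : Equiv.Perm ℕ := Equiv.swap i (i + 1)

theorem natSwap_left (i : ℕ) : natSwap i i = i + 1 := Equiv.swap_apply_left _ _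

theorem natSwap_right (i : ℕ) : natSwap i (i + 1) = i := Equiv.swap_apply_right _ _

theorem natSwap_of_ne {i j : ℕ} (h1 : j ≠ i) (h2 : j ≠ i + 1) : natSwap i j = j :=
  Equiv.swap_apply_of_ne_of_ne h1 h2

theorem natSwap_mul_self (i : ℕ) : natSwap i * natSwap i = 1 := Equiv.swap_mul_self _ _

theorem natSwap_mul_cancel (i : ℕ) (w : Equiv.Perm ℕ) : natSwap i * (natSwap i * w) = w := by
  rw [← mul_assoc, natSwap_mul_self, one_mul]

theorem natSwap_inv (i : ℕ) : (natSwap i)⁻¹ = natSwap i := Equiv.swap_inv _ _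

theorem natSwap_mul_inv_apply (i : ℕ) (w : Equiv.Perm ℕ) (x : ℕ) :
    (natSwap i * w)⁻¹ x = w⁻¹ (natSwap i x) := by
  rw [mul_inv_rev, natSwap_inv, Equiv.Perm.mul_apply]

theorem natSwap_lt_iff (i : ℕ) {a b : ℕ} (h : ¬ (a = i ∧ b = i + 1))
    (h' : ¬ (a = i + 1 ∧ b = i)) : natSwap i a < natSwap i b ↔ a < b := by
  rw [natSwap, Equiv.swap_apply_def, Equiv.swap_apply_def]
  split_ifs <;> omega

theorem natSwap_mul_comm {i j : ℕ} (h : i + 1 < j) : natSwap i * natSwap j = natSwap j * natSwap i := by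
  ext x
  simp only [Equiv.Perm.mul_apply, natSwap, Equiv.swap_apply_def]
  split_ifs <;> omega

theorem natSwap_braid (i : ℕ) :
    natSwap i * natSwap (i + 1) * natSwap i = natSwap (i + 1) * natSwap i * natSwap (i + 1) := by
  ext x
  simp only [Equiv.Perm.mul_apply, natSwap, Equiv.swap_apply_def]
  split_ifs <;> omega

/-- The left multiplication by a generator of the Hecke algebra with the quadratic relation
`T ^ 2 = 1 + z T`, on functions on the symmetric group. -/
def heckeL (i : ℕ) : Module.End R (Equiv.Perm ℕ → R) where
  toFun f w := f (natSwap i * w) + if w⁻¹ i < w⁻¹ (i + 1) then z * f w else 0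
  map_add' f g := by
    ext w
    simp only [Pi.add_apply]
    split_ifs <;> ring
  map_smul' c f := by
    ext w
    simp only [Pi.smul_apply, smul_eq_mul, RingHom.id_apply]
    split_ifs <;> ring

/-- The right multiplication by a generator of the Hecke algebra. -/
def heckeR (i : ℕ) : Module.End R (Equiv.Perm ℕ → R) where
  toFun f w := f (w * natSwap i) + if w i < w (i + 1) then z * f w else 0
  map_add' f g := by
    ext w
    simp only [Pi.add_apply]
    split_ifs <;> ring
  map_smul' c f := by
    ext w
    simp only [Pi.smul_apply, smul_eq_mul, RingHom.id_apply]
    split_ifs <;> ring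

theorem heckeL_apply (i : ℕ) (f : Equiv.Perm ℕ → R) (w : Equiv.Perm ℕ) :
    heckeL z i f w = f (natSwap i * w) + if w⁻¹ i < w⁻¹ (i + 1) then z * f w else 0 := rfl

theorem heckeR_apply (i : ℕ) (f : Equiv.Perm ℕ → R) (w : Equiv.Perm ℕ) :
    heckeR z i f w = f (w * natSwap i) + if w i < w (i + 1) then z * f w else 0 := rfl

theorem inv_apply_ne (w : Equiv.Perm ℕ) {a b : ℕ} (h : a ≠ b) : w⁻¹ a ≠ w⁻¹ b :=
  fun h' => h (w⁻¹.injective h')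

theorem heckeL_mul_self (i : ℕ) : heckeL z i * heckeL z i = 1 + z • heckeL z i := by
  refine LinearMap.ext fun f => funext fun w => ?_
  simp only [Module.End.mul_apply, LinearMap.add_apply, Module.End.one_apply, LinearMap.smul_apply,
    Pi.add_apply, Pi.smul_apply, smul_eq_mul, heckeL_apply, natSwap_mul_inv_apply, natSwap_left,
    natSwap_right, natSwap_mul_cancel]
  have := inv_apply_ne w (show i ≠ i + 1 by omega)
  by_cases h : w⁻¹ i < w⁻¹ (i + 1)
  · simp only [h, lt_asymm h, if_true, if_false]; ring
  · have h' : w⁻¹ (i + 1) < w⁻¹ i := by omega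
    simp only [h, h', if_true, if_false]; ring

theorem heckeL_comm {i j : ℕ} (h : i + 1 < j) :
    heckeL z i * heckeL z j = heckeL z j * heckeL z i := by
  refine LinearMap.ext fun f => funext fun w => ?_
  have h1 : natSwap i j = j := natSwap_of_ne (by omega) (by omega)
  have h2 : natSwap i (j + 1) = j + 1 := natSwap_of_ne (by omega) (by omega)
  have h3 : natSwap j i = i := natSwap_of_ne (by omega) (by omega)
  have h4 : natSwap j (i + 1) = i + 1 := natSwap_of_ne (by omega) (by omega)
  simp only [Module.End.mul_apply, heckeL_apply, natSwap_mul_inv_apply, h1, h2, h3, h4]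
  rw [← mul_assoc (natSwap i), natSwap_mul_comm h, mul_assoc]
  split_ifs <;> ring

theorem heckeL_braid (i : ℕ) : heckeL z i * heckeL z (i + 1) * heckeL z i
    = heckeL z (i + 1) * heckeL z i * heckeL z (i + 1) := by
  refine LinearMap.ext fun f => funext fun w => ?_
  have h1 : natSwap i (i + 1 + 1) = i + 1 + 1 := natSwap_of_ne (by omega) (by omega)
  have h2 : natSwap (i + 1) i = i := natSwap_of_ne (by omega) (by omega)
  simp only [Module.End.mul_apply, heckeL_apply, natSwap_mul_inv_apply, natSwap_left,
    natSwap_right, h1, h2, natSwap_mul_cancel]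
  have e : natSwap i * (natSwap (i + 1) * (natSwap i * w))
      = natSwap (i + 1) * (natSwap i * (natSwap (i + 1) * w)) := by
    simp only [← mul_assoc]; rw [natSwap_braid]
  rw [e]
  have d1 := inv_apply_ne w (show i ≠ i + 1 by omega)
  have d2 := inv_apply_ne w (show i ≠ i + 1 + 1 by omega)
  have d3 := inv_apply_ne w (show i + 1 ≠ i + 1 + 1 by omega)
  -- Only the relative order of the three preimages enters the ascent conditions.
  generalize w⁻¹ i = a at *
  generalize w⁻¹ (i + 1) = b at *
  generalize w⁻¹ (i + 1 + 1) = c at *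
  rcases lt_or_gt_of_ne d1 with k1 | k1 <;> rcases lt_or_gt_of_ne d2 with k2 | k2 <;>
    rcases lt_or_gt_of_ne d3 with k3 | k3 <;> first
    | (exfalso; omega)
    | (simp only [k1, k2, k3, lt_asymm k1, lt_asymm k2, lt_asymm k3, if_true, if_false, add_zero]; try ring)

/-- The two sides interact only if w carries {j, j + 1} to {i, i + 1}. Then w s_j = s_i w and both
ascent conditions flip together; otherwise neither multiplication changes the ascent condition of
the other. -/
theorem heckeL_heckeR_comm (i j : ℕ) : heckeL z i * heckeR z j = heckeR z j * heckeL z i := by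
  refine LinearMap.ext fun f => funext fun w => ?_
  simp only [Module.End.mul_apply, heckeL_apply, heckeR_apply]
  have hinv : ∀ x, (w * natSwap j)⁻¹ x = natSwap j (w⁻¹ x) := by
    intro x
    rw [mul_inv_rev, natSwap_inv, Equiv.Perm.mul_apply]
  simp only [hinv, Equiv.Perm.mul_apply]
  have hww : ∀ x, w (w⁻¹ x) = x := fun x => by
    rw [← Equiv.Perm.mul_apply, mul_inv_cancel, Equiv.Perm.one_apply]
  have hww' : ∀ x, w⁻¹ (w x) = x := fun x => by
    rw [← Equiv.Perm.mul_apply, inv_mul_cancel, Equiv.Perm.one_apply]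
  have hmul : w * natSwap j = Equiv.swap (w j) (w (j + 1)) * w := by
    rw [natSwap, Equiv.mul_swap_eq_swap_mul]
  by_cases h1 : w j = i ∧ w (j + 1) = i + 1
  · have e1 : w⁻¹ i = j := by rw [← h1.1, hww']
    have e2 : w⁻¹ (i + 1) = j + 1 := by rw [← h1.2, hww']
    have e3 : w * natSwap j = natSwap i * w := by rw [hmul, h1.1, h1.2]; rfl
    simp only [h1.1, h1.2, e1, e2, natSwap_left, natSwap_right, mul_assoc, e3, natSwap_mul_cancel]
    have a1 : ¬ i + 1 < i := by omega
    have a2 : ¬ j + 1 < j := by omega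
    simp only [a1, a2, Nat.lt_add_one, if_true, if_false]
  by_cases h2 : w j = i + 1 ∧ w (j + 1) = i
  · have e1 : w⁻¹ i = j + 1 := by rw [← h2.2, hww']
    have e2 : w⁻¹ (i + 1) = j := by rw [← h2.1, hww']
    have e3 : w * natSwap j = natSwap i * w := by
      rw [hmul, h2.1, h2.2, Equiv.swap_comm]; rfl
    simp only [h2.1, h2.2, e1, e2, natSwap_left, natSwap_right, mul_assoc, e3, natSwap_mul_cancel]
    have a1 : ¬ i + 1 < i := by omega
    have a2 : ¬ j + 1 < j := by omega
    simp only [a1, a2, Nat.lt_add_one, if_true, if_false]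
  have h3 : ¬ (w⁻¹ i = j ∧ w⁻¹ (i + 1) = j + 1) := by
    rintro ⟨k1, k2⟩
    exact h1 ⟨by rw [← k1, hww], by rw [← k2, hww]⟩
  have h4 : ¬ (w⁻¹ i = j + 1 ∧ w⁻¹ (i + 1) = j) := by
    rintro ⟨k1, k2⟩
    exact h2 ⟨by rw [← k2, hww], by rw [← k1, hww]⟩
  simp only [natSwap_lt_iff i h1 h2, natSwap_lt_iff j h3 h4, mul_assoc]
  split_ifs <;> ring

open Classical in
/-- The function which is `1` at a permutation and `0` elsewhere. -/
noncomputable def deltaFun (R : Type*) [CommRing R] (u : Equiv.Perm ℕ) : Equiv.Perm ℕ → R :=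
  Pi.single u 1

open Classical in
theorem deltaFun_apply (u w : Equiv.Perm ℕ) : deltaFun R u w = if w = u then 1 else 0 :=
  Pi.single_apply _ _ _

theorem heckeL_delta_one (i : ℕ) : heckeL z i (deltaFun R 1) = heckeR z i (deltaFun R 1) := by
  ext w
  rw [heckeL_apply, heckeR_apply, deltaFun_apply, deltaFun_apply, deltaFun_apply]
  have e : natSwap i * w = 1 ↔ w * natSwap i = 1 := by
    rw [mul_eq_one_iff_inv_eq, natSwap_inv, mul_eq_one_iff_eq_inv, natSwap_inv, eq_comm]
  congr 1
  · by_cases h : natSwap i * w = 1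
    · rw [if_pos h, if_pos (e.1 h)]
    · rw [if_neg h, if_neg fun h' => h (e.2 h')]
  · by_cases h : w = 1
    · subst h; simp
    · rw [if_neg h, mul_zero, ite_self, ite_self]

theorem heckeL_apply_one (i : ℕ) (f : Equiv.Perm ℕ → R) : heckeL z i f 1 = heckeR z i f 1 := by
  rw [heckeL_apply, heckeR_apply]
  simp

/-- The canonical trace of the Hecke algebra: the coefficient of the identity. -/
noncomputable def heckeTrace : Module.End R (Equiv.Perm ℕ → R) →ₗ[R] R where
  toFun x := x (deltaFun R 1) 1
  map_add' _ _ := rfl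
  map_smul' _ _ := rfl

theorem heckeTrace_apply (x : Module.End R (Equiv.Perm ℕ → R)) :
    heckeTrace x = x (deltaFun R 1) 1 := rfl

theorem heckeTrace_one : heckeTrace (1 : Module.End R (Equiv.Perm ℕ → R)) = 1 := by
  rw [heckeTrace_apply, Module.End.one_apply, deltaFun_apply, if_pos rfl]

/-- The algebra generated by the first `m` generators. -/
def heckeAlg (m : ℕ) : Subalgebra R (Module.End R (Equiv.Perm ℕ → R)) :=
  Algebra.adjoin R {x | ∃ i < m, x = heckeL z i}

theorem heckeL_mem {i m : ℕ} (h : i < m) : heckeL z i ∈ heckeAlg z m :=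
  Algebra.subset_adjoin ⟨i, h, rfl⟩

theorem heckeAlg_mono {m k : ℕ} (h : m ≤ k) : heckeAlg z m ≤ heckeAlg z k :=
  Algebra.adjoin_mono fun _ ⟨i, hi, e⟩ => ⟨i, hi.trans_le h, e⟩

theorem commute_of_mem_heckeAlg {m : ℕ} {x y : Module.End R (Equiv.Perm ℕ → R)}
    (hy : ∀ i < m, Commute (heckeL z i) y) (hx : x ∈ heckeAlg z m) : Commute x y := by
  induction hx using Algebra.adjoin_induction with
  | mem x h =>
    obtain ⟨i, hi, rfl⟩ := h
    exact hy i hi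
  | algebraMap r => exact Algebra.commutes r y
  | add x x' _ _ h h' => exact h.add_left h'
  | mul x x' _ _ h h' => exact h.mul_left h'

/-- At the identity a left generator may be replaced by the right one; this commutes with y, and on
the delta function of the identity it turns back into the left one. -/
theorem heckeTrace_mul_comm {m : ℕ} {x y : Module.End R (Equiv.Perm ℕ → R)}
    (hx : x ∈ heckeAlg z m) (hy : y ∈ heckeAlg z m) : heckeTrace (x * y) = heckeTrace (y * x) := by
  induction hx using Algebra.adjoin_induction generalizing y with
  | mem x h =>
    obtain ⟨i, hi, rfl⟩ := h
    have hc : Commute y (heckeR z i) :=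
      commute_of_mem_heckeAlg z (fun j _ => heckeL_heckeR_comm z j i) hy
    rw [heckeTrace_apply, heckeTrace_apply, Module.End.mul_apply, heckeL_apply_one,
      ← Module.End.mul_apply, ← hc.eq, Module.End.mul_apply, Module.End.mul_apply,
      heckeL_delta_one]
  | algebraMap r => rw [Algebra.commutes]
  | add x x' _ _ h h' => rw [add_mul, mul_add, map_add, map_add, h hy, h' hy]
  | mul x x' hx hx' h h' =>
    rw [mul_assoc, h (mul_mem hx' hy), mul_assoc, h' (mul_mem hy hx), mul_assoc]

/-- The inverse of a generator. -/
def heckeT (i : ℕ) : Module.End R (Equiv.Perm ℕ → R) := heckeL z i - algebraMap R _ z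

theorem heckeT_mem {i m : ℕ} (h : i < m) : heckeT z i ∈ heckeAlg z m :=
  sub_mem (heckeL_mem z h) (Subalgebra.algebraMap_mem _ _)

theorem heckeL_mul_heckeT (i : ℕ) : heckeL z i * heckeT z i = 1 := by
  rw [heckeT, mul_sub, heckeL_mul_self, ← Algebra.commutes, Algebra.algebraMap_eq_smul_one,
    smul_mul_assoc, one_mul, add_sub_cancel_right]

theorem heckeT_mul_heckeL (i : ℕ) : heckeT z i * heckeL z i = 1 := by
  rw [heckeT, sub_mul, heckeL_mul_self, Algebra.algebraMap_eq_smul_one,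
    smul_mul_assoc, one_mul, add_sub_cancel_right]

theorem heckeL_eq (i : ℕ) : heckeL z i = heckeT z i + z • 1 := by
  rw [heckeT, Algebra.algebraMap_eq_smul_one, sub_add_cancel]

theorem heckeT_mul_self (i : ℕ) : heckeT z i * heckeT z i = 1 - z • heckeT z i := by
  have h := heckeL_mul_heckeT z i
  rw [heckeL_eq, add_mul, smul_mul_assoc, one_mul] at h
  exact eq_sub_of_add_eq h

theorem heckeT_commute_of_heckeL {i : ℕ} {x : Module.End R (Equiv.Perm ℕ → R)}
    (h : Commute (heckeL z i) x) : Commute (heckeT z i) x :=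
  h.sub_left (Algebra.commutes _ _)

theorem heckeL_commute_of_heckeT {i : ℕ} {x : Module.End R (Equiv.Perm ℕ → R)}
    (h : Commute (heckeT z i) x) : Commute (heckeL z i) x := by
  rw [heckeL_eq]
  exact h.add_left ((Commute.one_left x).smul_left z)

theorem heckeT_comm {i j : ℕ} (h : i + 1 < j) : Commute (heckeT z i) (heckeT z j) :=
  heckeT_commute_of_heckeL z (heckeT_commute_of_heckeL z (heckeL_comm z h).symm).symm

theorem heckeT_commute_heckeAlg {j m : ℕ} (h : m < j) {x : Module.End R (Equiv.Perm ℕ → R)}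
    (hx : x ∈ heckeAlg z m) : Commute x (heckeT z j) :=
  commute_of_mem_heckeAlg z (fun i hi =>
    (heckeT_commute_of_heckeL z (heckeL_comm z (by omega : i + 1 < j)).symm).symm) hx

theorem heckeT_braid (i : ℕ) : heckeT z i * heckeT z (i + 1) * heckeT z i
    = heckeT z (i + 1) * heckeT z i * heckeT z (i + 1) := by
  have h : ∀ a b : (Module.End R (Equiv.Perm ℕ → R))ˣ, a * b * a = b * a * b →
      a⁻¹ * b⁻¹ * a⁻¹ = b⁻¹ * a⁻¹ * b⁻¹ := by
    intro a b h
    have := congrArg (·⁻¹) h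
    simpa [mul_assoc] using this
  have := h ⟨heckeL z i, heckeT z i, heckeL_mul_heckeT z i, heckeT_mul_heckeL z i⟩
    ⟨heckeL z (i + 1), heckeT z (i + 1), heckeL_mul_heckeT z _, heckeT_mul_heckeL z _⟩
    (Units.ext (heckeL_braid z i))
  exact congrArg Units.val this

/-! ### Jucys–Murphy elements -/

/-- The multiplicative Jucys–Murphy elements, in the inverses of the generators. -/
def jucysMurphy : ℕ → Module.End R (Equiv.Perm ℕ → R)
  | 0 => 1
  | i + 1 => heckeT z i * jucysMurphy i * heckeT z i

theorem jucysMurphy_mem (i : ℕ) : jucysMurphy z i ∈ heckeAlg z i := by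
  induction i with
  | zero => exact one_mem _
  | succ i ih =>
    exact mul_mem (mul_mem (heckeT_mem z (by omega)) (heckeAlg_mono z (by omega) ih))
      (heckeT_mem z (by omega))

/-- Generators far from the last one commute with it and fall under the induction; for the
neighbouring one, two uses of the braid relation carry it through. -/
theorem heckeT_commute_jucysMurphy (i : ℕ) :
    ∀ j < i, Commute (heckeT z j) (jucysMurphy z (i + 1)) := by
  induction i with
  | zero => intro j hj; omega
  | succ i ih =>
    intro j hj
    rcases (Nat.lt_succ_iff.1 hj).lt_or_eq with h | rfl
    · have h1 := heckeT_comm z (by omega : j + 1 < i + 1)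
      exact (h1.mul_right (ih j h)).mul_right h1
    · have h1 : Commute (jucysMurphy z j) (heckeT z (j + 1)) :=
        heckeT_commute_heckeAlg z (by omega) (jucysMurphy_mem z j)
      have hb := heckeT_braid z j
      change _ = _
      simp only [jucysMurphy]
      set a := heckeT z j
      set b := heckeT z (j + 1)
      set x := jucysMurphy z j
      calc a * (b * (a * x * a) * b) = (a * b * a) * x * a * b := by simp only [mul_assoc]
        _ = b * a * (b * x) * a * b := by rw [hb]; simp only [mul_assoc]
        _ = b * a * x * (b * a * b) := by rw [← h1.eq]; simp only [mul_assoc]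
        _ = b * (a * x * a) * b * a := by rw [← hb]; simp only [mul_assoc]

/-- The product of the factors `1 - b J` over the Jucys–Murphy elements `J` other than the first
one. The canonical trace, multiplied by this element, is the Ocneanu trace. -/
def ocneanuElt (b : R) : ℕ → Module.End R (Equiv.Perm ℕ → R)
  | 0 => 1
  | m + 1 => ocneanuElt b m * (1 - b • jucysMurphy z (m + 1))

variable (b : R)

theorem one_sub_jucysMurphy_mem (m : ℕ) : 1 - b • jucysMurphy z m ∈ heckeAlg z m :=
  sub_mem (one_mem _) (Subalgebra.smul_mem _ (jucysMurphy_mem z m) b)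

theorem ocneanuElt_mem (m : ℕ) : ocneanuElt z b m ∈ heckeAlg z m := by
  induction m with
  | zero => exact one_mem _
  | succ m ih => exact mul_mem (heckeAlg_mono z (by omega) ih) (one_sub_jucysMurphy_mem z b _)

/-- The generator commutes with neither J_m nor J_{m+1} in general, but with their sum and their
product, and the two factors multiply to 1 - b(J_m + J_{m+1}) + b² J_m J_{m+1}. -/
theorem heckeT_commute_factors (m : ℕ) : Commute (heckeT z m)
    ((1 - b • jucysMurphy z m) * (1 - b • jucysMurphy z (m + 1))) := by
  have hJ : Commute (jucysMurphy z m) (jucysMurphy z (m + 1)) := by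
    refine commute_of_mem_heckeAlg z (fun i hi => ?_) (jucysMurphy_mem z m)
    exact heckeL_commute_of_heckeT z (heckeT_commute_jucysMurphy z m i hi)
  have hT := heckeT_mul_self z m
  simp only [jucysMurphy] at hJ ⊢
  set T := heckeT z m
  set J := jucysMurphy z m
  have h1 : Commute T (J + T * J * T) := by
    change _ = _
    have e1 : T * (T * J * T) = J * T - z • (T * J * T) := by
      rw [← mul_assoc, ← mul_assoc, hT]; simp only [sub_mul, one_mul, smul_mul_assoc]
    have e2 : T * J * T * T = T * J - z • (T * J * T) := by
      rw [mul_assoc (T * J), hT]; simp only [mul_sub, mul_one, mul_smul_comm, mul_assoc]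
    rw [mul_add, add_mul, e1, e2]
    abel
  have h2 : Commute T (J * (T * J * T)) := by
    change _ = _
    rw [hJ.eq]
    nth_rewrite 1 [← hJ.eq]
    simp only [mul_assoc]
  have e : (1 - b • J) * (1 - b • (T * J * T))
      = 1 - b • (J + T * J * T) + (b * b) • (J * (T * J * T)) := by
    simp only [sub_mul, mul_sub, one_mul, mul_one, smul_mul_assoc, mul_smul_comm]
    module
  rw [e]
  exact ((Commute.one_right T).sub_right (h1.smul_right b)).add_right (h2.smul_right _)

/-- Being symmetric in the Jucys–Murphy elements, the product is central in the algebra of the first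
m generators. Hence multiplying by it keeps the trace property. -/
theorem heckeT_commute_ocneanuElt (m : ℕ) :
    ∀ j < m, Commute (heckeT z j) (ocneanuElt z b m) := by
  induction m with
  | zero => intro j hj; omega
  | succ m ih =>
    intro j hj
    rcases (Nat.lt_succ_iff.1 hj).lt_or_eq with h | rfl
    · exact (ih j h).mul_right ((Commute.one_right _).sub_right
        ((heckeT_commute_jucysMurphy z m j h).smul_right b))
    · cases j with
      | zero =>
        -- J_0 = 1 contributes no factor, so there is no pair for the first generator; it commutes
        -- with J_1 because J_1 is its square.
        simp only [ocneanuElt, one_mul]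
        refine (Commute.one_right _).sub_right (Commute.smul_right ?_ b)
        simp only [jucysMurphy, mul_one]
        exact (Commute.refl _).mul_right (Commute.refl _)
      | succ k =>
        simp only [ocneanuElt]
        rw [mul_assoc]
        exact (heckeT_commute_heckeAlg z (by omega) (ocneanuElt_mem z b k)).symm.mul_right
          (heckeT_commute_factors z b (k + 1))

/-! ### The Markov property of the trace -/

/-- The last factor takes the delta function of 1 to that of s_m, which is supported on the w with w
m = m + 1. The first m generators do not move the value m + 1, so this support persists, and it does
not contain the identity. -/
theorem heckeTrace_mul_heckeT {m : ℕ} {x : Module.End R (Equiv.Perm ℕ → R)}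
    (hx : x ∈ heckeAlg z m) : heckeTrace (x * heckeT z m) = 0 := by
  have key : ∀ f : Equiv.Perm ℕ → R, (∀ w : Equiv.Perm ℕ, w m ≠ m + 1 → f w = 0) →
      ∀ w : Equiv.Perm ℕ, w m ≠ m + 1 → x f w = 0 := by
    induction hx using Algebra.adjoin_induction with
    | mem x h =>
      obtain ⟨i, hi, rfl⟩ := h
      intro f hf w hw
      rw [heckeL_apply, hf w hw, hf, mul_zero, ite_self, add_zero]
      rw [Equiv.Perm.mul_apply]
      intro h
      apply hw
      have := congrArg (natSwap i) h
      rwa [← Equiv.Perm.mul_apply, natSwap_mul_self, Equiv.Perm.one_apply,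
        natSwap_of_ne (by omega) (by omega)] at this
    | algebraMap r =>
      intro f hf w hw
      rw [Module.algebraMap_end_apply, Pi.smul_apply, hf w hw, smul_zero]
    | add x x' _ _ h h' =>
      intro f hf w hw
      rw [LinearMap.add_apply, Pi.add_apply, h f hf w hw, h' f hf w hw, add_zero]
    | mul x x' _ _ h h' =>
      intro f hf w hw
      rw [Module.End.mul_apply]
      exact h _ (h' f hf) w hw
  rw [heckeTrace_apply, Module.End.mul_apply]
  refine key _ (fun w hw => ?_) 1 (by simp)
  rw [heckeT, LinearMap.sub_apply, Pi.sub_apply, heckeL_apply, Module.algebraMap_end_apply,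
    Pi.smul_apply, deltaFun_apply, deltaFun_apply, if_neg, smul_eq_mul]
  · by_cases h : w = 1
    · subst h; simp
    · simp [h]
  · intro h
    rw [mul_eq_one_iff_inv_eq, natSwap_inv] at h
    rw [← h, natSwap_left] at hw
    exact hw rfl

theorem heckeTrace_mul_heckeT_mul {m : ℕ} {x y : Module.End R (Equiv.Perm ℕ → R)}
    (hx : x ∈ heckeAlg z m) (hy : y ∈ heckeAlg z m) :
    heckeTrace (x * heckeT z m * y) = 0 := by
  have h1 : m ≤ m + 1 := by omega
  rw [heckeTrace_mul_comm z (mul_mem (heckeAlg_mono z h1 hx) (heckeT_mem z (by omega)))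
    (heckeAlg_mono z h1 hy), ← mul_assoc]
  exact heckeTrace_mul_heckeT z (mul_mem hy hx)

/-- The span of the products with exactly one factor `T`. -/
def heckeSpan (m : ℕ) : Submodule R (Module.End R (Equiv.Perm ℕ → R)) :=
  Submodule.span R {u | ∃ x ∈ heckeAlg z m, ∃ y ∈ heckeAlg z m, u = x * heckeT z m * y}

/-- Induction through J' - 1 = T(J - 1)T - zT: a product T x S y T, with S the previous generator,
becomes x S T S y by the braid relation. As such products have trace zero, J_{m+1} acts as 1 under
the trace. -/
theorem jucysMurphy_sub_one_mem (m : ℕ) : jucysMurphy z (m + 1) - 1 ∈ heckeSpan z m := by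
  have hT : ∀ k, heckeT z k ∈ heckeSpan z k := fun k =>
    Submodule.subset_span ⟨1, one_mem _, 1, one_mem _, by simp⟩
  induction m with
  | zero =>
    have : jucysMurphy z (0 + 1) - 1 = (-z) • heckeT z 0 := by
      simp only [jucysMurphy, mul_one]
      rw [heckeT_mul_self]; module
    rw [this]
    exact Submodule.smul_mem _ _ (hT 0)
  | succ m ih =>
    have key : ∀ u ∈ heckeSpan z m, heckeT z (m + 1) * u * heckeT z (m + 1)
        ∈ heckeSpan z (m + 1) := by
      intro u hu
      induction hu using Submodule.span_induction with
      | mem u h =>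
        obtain ⟨x, hx, y, hy, rfl⟩ := h
        have h1 := heckeT_commute_heckeAlg z (by omega : m < m + 1) hx
        have h2 := heckeT_commute_heckeAlg z (by omega : m < m + 1) hy
        have hb := heckeT_braid z m
        have hm : m ≤ m + 1 := by omega
        have hTm := heckeT_mem z (by omega : m < m + 1)
        refine Submodule.subset_span ⟨x * heckeT z m, mul_mem (heckeAlg_mono z hm hx) hTm,
          heckeT z m * y, mul_mem hTm (heckeAlg_mono z hm hy), ?_⟩
        set s := heckeT z m
        set t := heckeT z (m + 1)
        calc t * (x * s * y) * t = (t * x) * s * (y * t) := by simp only [mul_assoc]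
          _ = x * (t * s * t) * y := by rw [← h1.eq, h2.eq]; simp only [mul_assoc]
          _ = x * s * t * (s * y) := by rw [← hb]; simp only [mul_assoc]
      | zero => rw [mul_zero, zero_mul]; exact zero_mem _
      | add u u' _ _ h h' => rw [mul_add, add_mul]; exact add_mem h h'
      | smul c u _ h => rw [mul_smul_comm, smul_mul_assoc]; exact Submodule.smul_mem _ _ h
    have e : jucysMurphy z (m + 1 + 1) - 1
        = (-z) • heckeT z (m + 1)
          + heckeT z (m + 1) * (jucysMurphy z (m + 1) - 1) * heckeT z (m + 1) := by
      rw [mul_sub, sub_mul, mul_one, heckeT_mul_self]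
      change heckeT z (m + 1) * jucysMurphy z (m + 1) * heckeT z (m + 1) - 1 = _
      module
    rw [e]
    exact add_mem (Submodule.smul_mem _ _ (hT _)) (key _ ih)

theorem heckeTrace_mul_jucysMurphy {m : ℕ} {x : Module.End R (Equiv.Perm ℕ → R)}
    (hx : x ∈ heckeAlg z m) : heckeTrace (x * jucysMurphy z (m + 1)) = heckeTrace x := by
  have key : ∀ u ∈ heckeSpan z m, heckeTrace (x * u) = 0 := by
    intro u hu
    induction hu using Submodule.span_induction with
    | mem u h =>
      obtain ⟨y, hy, y', hy', rfl⟩ := h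
      rw [← mul_assoc, ← mul_assoc]
      exact heckeTrace_mul_heckeT_mul z (mul_mem hx hy) hy'
    | zero => rw [mul_zero, map_zero]
    | add u u' _ _ h h' => rw [mul_add, map_add, h, h', add_zero]
    | smul c u _ h => rw [mul_smul_comm, map_smul, h, smul_zero]
  have := key _ (jucysMurphy_sub_one_mem z m)
  rw [mul_sub, mul_one, map_sub, sub_eq_zero] at this
  exact this

/-- The Ocneanu trace on the algebra generated by the first `m` generators, up to a scalar. -/
noncomputable def ocneanuTrace (m : ℕ) (x : Module.End R (Equiv.Perm ℕ → R)) : R :=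
  heckeTrace (x * ocneanuElt z b m)

theorem ocneanuTrace_mul_comm {m : ℕ} {x y : Module.End R (Equiv.Perm ℕ → R)}
    (hx : x ∈ heckeAlg z m) (hy : y ∈ heckeAlg z m) :
    ocneanuTrace z b m (x * y) = ocneanuTrace z b m (y * x) := by
  have h : Commute x (ocneanuElt z b m) := commute_of_mem_heckeAlg z
    (fun i hi => heckeL_commute_of_heckeT z (heckeT_commute_ocneanuElt z b m i hi)) hx
  rw [ocneanuTrace, ocneanuTrace, mul_assoc,
    heckeTrace_mul_comm z hx (mul_mem hy (ocneanuElt_mem z b m)), mul_assoc, mul_assoc, h.eq]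

/-- In (1 - bJ_{m+1})L the second summand reduces to bTJ_m and L = T + z. All terms with a single T
have trace zero, and only z survives. -/
theorem ocneanuTrace_mul_heckeL {m : ℕ} {x : Module.End R (Equiv.Perm ℕ → R)}
    (hx : x ∈ heckeAlg z m) :
    ocneanuTrace z b (m + 1) (x * heckeL z m) = z * ocneanuTrace z b m x := by
  have hy : x * ocneanuElt z b m ∈ heckeAlg z m := mul_mem hx (ocneanuElt_mem z b m)
  have hc : Commute (heckeL z m) (ocneanuElt z b (m + 1)) :=
    heckeL_commute_of_heckeT z (heckeT_commute_ocneanuElt z b (m + 1) m (by omega))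
  rw [ocneanuTrace, ocneanuTrace, mul_assoc, hc.eq]
  have e : x * (ocneanuElt z b (m + 1) * heckeL z m)
      = z • (x * ocneanuElt z b m) + x * ocneanuElt z b m * heckeT z m
        - b • (x * ocneanuElt z b m * heckeT z m * jucysMurphy z m) := by
    simp only [ocneanuElt, jucysMurphy]
    rw [mul_assoc (ocneanuElt z b m), sub_mul, one_mul, smul_mul_assoc, mul_assoc _ (heckeT z m)
      (heckeL z m), heckeT_mul_heckeL, mul_one, heckeL_eq]
    simp only [mul_sub, mul_add, mul_smul_comm, mul_one, ← mul_assoc]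
    abel
  rw [e, map_sub, map_add, map_smul, map_smul, heckeTrace_mul_heckeT z hy,
    heckeTrace_mul_heckeT_mul z hy (jucysMurphy_mem z m), smul_zero, sub_zero, add_zero,
    smul_eq_mul]

/-- Here T² = 1 - zT produces, besides terms with a single T, the term bz J_{m+1}, under which the
trace sees J_{m+1} as 1. -/
theorem ocneanuTrace_mul_heckeT {m : ℕ} {x : Module.End R (Equiv.Perm ℕ → R)}
    (hx : x ∈ heckeAlg z m) :
    ocneanuTrace z b (m + 1) (x * heckeT z m) = b * z * ocneanuTrace z b m x := by
  have hy : x * ocneanuElt z b m ∈ heckeAlg z m := mul_mem hx (ocneanuElt_mem z b m)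
  have hc := heckeT_commute_ocneanuElt z b (m + 1) m (by omega)
  rw [ocneanuTrace, ocneanuTrace, mul_assoc, hc.eq]
  have e : x * (ocneanuElt z b (m + 1) * heckeT z m)
      = x * ocneanuElt z b m * heckeT z m
        - b • (x * ocneanuElt z b m * heckeT z m * jucysMurphy z m)
        + (b * z) • (x * ocneanuElt z b m * jucysMurphy z (m + 1)) := by
    have h1 : jucysMurphy z (m + 1) * heckeT z m
        = heckeT z m * jucysMurphy z m - z • jucysMurphy z (m + 1) := by
      simp only [jucysMurphy]
      rw [mul_assoc _ (heckeT z m) (heckeT z m), heckeT_mul_self, mul_sub, mul_one, mul_smul_comm]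
    have h2 : ocneanuElt z b (m + 1) = ocneanuElt z b m * (1 - b • jucysMurphy z (m + 1)) := rfl
    rw [h2, mul_assoc (ocneanuElt z b m), sub_mul, one_mul, smul_mul_assoc, h1]
    simp only [mul_sub, mul_smul_comm, ← mul_assoc, smul_sub, smul_smul]
    abel
  rw [e, map_add, map_sub, map_smul, map_smul, heckeTrace_mul_heckeT z hy,
    heckeTrace_mul_heckeT_mul z hy (jucysMurphy_mem z m), heckeTrace_mul_jucysMurphy z hy,
    smul_zero, sub_zero, zero_add, smul_eq_mul]

theorem ocneanuTrace_zero_one : ocneanuTrace z b 0 1 = 1 := by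
  rw [ocneanuTrace, ocneanuElt, one_mul, heckeTrace_one]

/-! ### Base change -/

variable {S : Type*} [CommRing S] (φ : R →+* S)

theorem heckeL_map (i : ℕ) (f : Equiv.Perm ℕ → R) (w : Equiv.Perm ℕ) :
    heckeL (φ z) i (fun u => φ (f u)) w = φ (heckeL z i f w) := by
  rw [heckeL_apply, heckeL_apply, map_add φ]
  split_ifs <;> simp

theorem heckeT_apply (i : ℕ) (f : Equiv.Perm ℕ → R) (w : Equiv.Perm ℕ) :
    heckeT z i f w = heckeL z i f w - z * f w := by
  rw [heckeT, LinearMap.sub_apply, Pi.sub_apply, Module.algebraMap_end_apply, Pi.smul_apply,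
    smul_eq_mul]

theorem heckeT_map (i : ℕ) (f : Equiv.Perm ℕ → R) (w : Equiv.Perm ℕ) :
    heckeT (φ z) i (fun u => φ (f u)) w = φ (heckeT z i f w) := by
  rw [heckeT_apply, heckeT_apply, heckeL_map, map_sub, map_mul]

/-- Two operators correspond to each other under a base change. -/
def BaseChange (x : Module.End R (Equiv.Perm ℕ → R)) (y : Module.End S (Equiv.Perm ℕ → S)) : Prop :=
  ∀ f w, y (fun u => φ (f u)) w = φ (x f w)

variable {φ}

theorem BaseChange.heckeL (i : ℕ) : BaseChange φ (heckeL z i) (_root_.heckeL (φ z) i) :=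
  heckeL_map z φ i

theorem BaseChange.heckeT (i : ℕ) : BaseChange φ (heckeT z i) (_root_.heckeT (φ z) i) :=
  heckeT_map z φ i

theorem BaseChange.one : BaseChange φ 1 1 := fun _ _ => rfl

theorem BaseChange.mul {x x' : Module.End R (Equiv.Perm ℕ → R)}
    {y y' : Module.End S (Equiv.Perm ℕ → S)} (h : BaseChange φ x y) (h' : BaseChange φ x' y') :
    BaseChange φ (x * x') (y * y') := by
  intro f w
  rw [Module.End.mul_apply, Module.End.mul_apply, ← h]
  exact congrFun (congrArg y (funext fun u => h' f u)) w

theorem BaseChange.one_sub_smul {x : Module.End R (Equiv.Perm ℕ → R)}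
    {y : Module.End S (Equiv.Perm ℕ → S)} (h : BaseChange φ x y) (c : R) :
    BaseChange φ (1 - c • x) (1 - φ c • y) := by
  intro f w
  simp only [LinearMap.sub_apply, Pi.sub_apply, LinearMap.smul_apply, Pi.smul_apply,
    Module.End.one_apply, smul_eq_mul, map_sub, map_mul]
  rw [h f w]

theorem BaseChange.jucysMurphy (m : ℕ) :
    BaseChange φ (jucysMurphy z m) (_root_.jucysMurphy (φ z) m) := by
  induction m with
  | zero => exact BaseChange.one
  | succ m ih => exact ((BaseChange.heckeT z m).mul ih).mul (BaseChange.heckeT z m)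

theorem BaseChange.ocneanuElt (m : ℕ) :
    BaseChange φ (ocneanuElt z b m) (_root_.ocneanuElt (φ z) (φ b) m) := by
  induction m with
  | zero => exact BaseChange.one
  | succ m ih => exact ih.mul ((BaseChange.jucysMurphy z (m + 1)).one_sub_smul b)

theorem BaseChange.heckeTrace {x : Module.End R (Equiv.Perm ℕ → R)}
    {y : Module.End S (Equiv.Perm ℕ → S)} (h : BaseChange φ x y) :
    _root_.heckeTrace y = φ (_root_.heckeTrace x) := by
  rw [heckeTrace_apply, heckeTrace_apply, ← h]
  refine congrFun (congrArg y (funext fun w => ?_)) 1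
  rw [deltaFun_apply, deltaFun_apply]
  split_ifs <;> simp

theorem BaseChange.ocneanuTrace {x : Module.End R (Equiv.Perm ℕ → R)}
    {y : Module.End S (Equiv.Perm ℕ → S)} (h : BaseChange φ x y) (m : ℕ) :
    _root_.ocneanuTrace (φ z) (φ b) m y = φ (_root_.ocneanuTrace z b m x) :=
  (h.mul (BaseChange.ocneanuElt z b m)).heckeTrace

end Hecke

/-! ### Representations of the braid group -/

section BraidRep

variable {n : ℕ}

theorem braid_induction {p : BraidGroup n → Prop} (one : p 1)
    (mul_gen : ∀ β i, p β → p (β * braidGen n i))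
    (mul_inv : ∀ β i, p β → p (β * (braidGen n i)⁻¹)) (β : BraidGroup n) : p β := by
  have h : β ∈ Subgroup.closure (Set.range (PresentedGroup.of (rels := braidRels n))) := by
    rw [PresentedGroup.closure_range_of]; trivial
  induction h using Subgroup.closure_induction_right with
  | one => exact one
  | mul_right x _ y hy ih => obtain ⟨i, rfl⟩ := hy; exact mul_gen x i ih
  | mul_inv_cancel x _ y hy ih => obtain ⟨i, rfl⟩ := hy; exact mul_inv x i ih

theorem braidIncl_gen (i : Fin (n - 1)) :
    braidIncl n (braidGen n i) = braidGen (n + 1) ⟨i.1, by omega⟩ :=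
  PresentedGroup.toGroup.of _

/-- A map from the generators which satisfies the braid relations extends to the braid group. -/
def braidLift {G : Type*} [Group G] (f : Fin (n - 1) → G)
    (h1 : ∀ i j : Fin (n - 1), i.1 + 1 = j.1 → f i * f j * f i = f j * f i * f j)
    (h2 : ∀ i j : Fin (n - 1), i.1 + 1 < j.1 → f i * f j = f j * f i) : BraidGroup n →* G :=
  PresentedGroup.toGroup (f := f) <| by
    rintro r ⟨i, j, ⟨h, rfl⟩ | ⟨h, rfl⟩⟩
    · rw [map_mul, map_inv, mul_inv_eq_one]
      simp only [map_mul, FreeGroup.lift_apply_of]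
      exact h1 i j h
    · rw [map_mul, map_inv, mul_inv_eq_one]
      simp only [map_mul, FreeGroup.lift_apply_of]
      exact h2 i j h

theorem braidLift_gen {G : Type*} [Group G] {f : Fin (n - 1) → G}
    (h1 : ∀ i j : Fin (n - 1), i.1 + 1 = j.1 → f i * f j * f i = f j * f i * f j)
    (h2 : ∀ i j : Fin (n - 1), i.1 + 1 < j.1 → f i * f j = f j * f i) (i : Fin (n - 1)) :
    braidLift f h1 h2 (braidGen n i) = f i :=
  PresentedGroup.toGroup.of _

variable {R : Type*} [CommRing R] (z : R)

/-- A generator of the Hecke algebra as an invertible operator. -/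
def heckeUnit (i : ℕ) : (Module.End R (Equiv.Perm ℕ → R))ˣ :=
  ⟨heckeL z i, heckeT z i, heckeL_mul_heckeT z i, heckeT_mul_heckeL z i⟩

/-- The representation of the braid group through the Hecke algebra. -/
def heckeRep (n : ℕ) : BraidGroup n →* (Module.End R (Equiv.Perm ℕ → R))ˣ :=
  braidLift (fun i => heckeUnit z i.1)
    (fun i j h => Units.ext (by
      have := heckeL_braid z i.1
      rw [h] at this
      exact this))
    (fun _ _ h => Units.ext (heckeL_comm z h))

theorem heckeRep_gen (i : Fin (n - 1)) : heckeRep z n (braidGen n i) = heckeUnit z i.1 :=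
  braidLift_gen _ _ i

theorem heckeRep_mul_gen (β : BraidGroup n) (i : Fin (n - 1)) :
    (heckeRep z n (β * braidGen n i)).1 = (heckeRep z n β).1 * heckeL z i.1 := by
  rw [map_mul, heckeRep_gen]; rfl

theorem heckeRep_mul_inv (β : BraidGroup n) (i : Fin (n - 1)) :
    (heckeRep z n (β * (braidGen n i)⁻¹)).1 = (heckeRep z n β).1 * heckeT z i.1 := by
  rw [map_mul, map_inv, heckeRep_gen]; rfl

theorem heckeRep_mem (β : BraidGroup n) : (heckeRep z n β).1 ∈ heckeAlg z (n - 1) := by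
  induction β using braid_induction with
  | one => rw [map_one]; exact one_mem _
  | mul_gen β i ih => rw [heckeRep_mul_gen]; exact mul_mem ih (heckeL_mem z i.2)
  | mul_inv β i ih => rw [heckeRep_mul_inv]; exact mul_mem ih (heckeT_mem z i.2)

theorem heckeRep_incl (β : BraidGroup n) :
    heckeRep z (n + 1) (braidIncl n β) = heckeRep z n β := by
  have : (heckeRep z (n + 1)).comp (braidIncl n) = heckeRep z n :=
    PresentedGroup.ext fun i => by
      have h1 := heckeRep_gen z i
      have h2 := heckeRep_gen z (n := n + 1) ⟨i.1, by omega⟩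
      rw [← braidIncl_gen] at h2
      exact h2.trans h1.symm
  exact DFunLike.congr_fun this β

theorem BaseChange.heckeRep {S : Type*} [CommRing S] (φ : R →+* S) (β : BraidGroup n) :
    BaseChange φ (heckeRep z n β).1 (_root_.heckeRep (φ z) n β).1 := by
  induction β using braid_induction with
  | one => simp only [map_one]; exact BaseChange.one
  | mul_gen β i ih =>
    rw [heckeRep_mul_gen, heckeRep_mul_gen]; exact ih.mul (BaseChange.heckeL z _)
  | mul_inv β i ih =>
    rw [heckeRep_mul_inv, heckeRep_mul_inv]; exact ih.mul (BaseChange.heckeT z _)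

/-- The exponent sum of a braid. -/
def braidExp (n : ℕ) : BraidGroup n →* Multiplicative ℤ :=
  braidLift (fun _ => Multiplicative.ofAdd 1) (fun _ _ _ => rfl) (fun _ _ _ => rfl)

theorem braidExp_gen (i : Fin (n - 1)) : braidExp n (braidGen n i) = Multiplicative.ofAdd 1 :=
  braidLift_gen _ _ i

theorem braidExp_incl (β : BraidGroup n) : braidExp (n + 1) (braidIncl n β) = braidExp n β := by
  have : (braidExp (n + 1)).comp (braidIncl n) = braidExp n :=
    PresentedGroup.ext fun i => by
      have h1 := braidExp_gen i
      have h2 := braidExp_gen (n := n + 1) ⟨i.1, by omega⟩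
      rw [← braidIncl_gen] at h2
      exact h2.trans h1.symm
  exact DFunLike.congr_fun this β

end BraidRep

/-! ### Existence of the HOMFLY polynomial -/

section HomflyExists

/-- The ring of coefficients of the Ocneanu trace: polynomials in `b = a⁻²` over the Laurent
polynomials in `z`. -/
abbrev OcneanuRing : Type := Polynomial (LaurentPolynomial ℤ)

/-- The parameter `z` of the Hecke algebra. -/
noncomputable def ocneanuZ : OcneanuRing := Polynomial.C (LaurentPolynomial.T 1)

/-- The inclusion of the ring of coefficients in the ring of the HOMFLY polynomials. -/
noncomputable def ocneanuEval : OcneanuRing →+* LaurentAZ :=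
  Polynomial.eval₂RingHom LaurentPolynomial.C (LaurentPolynomial.T (-2))

theorem ocneanuEval_C (c : LaurentPolynomial ℤ) :
    ocneanuEval (Polynomial.C c) = LaurentPolynomial.C c :=
  Polynomial.eval₂_C _ _

theorem ocneanuEval_X : ocneanuEval Polynomial.X = varA (-2) := Polynomial.eval₂_X _ _

theorem ocneanuEval_z : ocneanuEval ocneanuZ = varZ := ocneanuEval_C _

/-- A power of `z`. -/
noncomputable def powZ (k : ℤ) : LaurentAZ := LaurentPolynomial.C (LaurentPolynomial.T k)

theorem powZ_mul_varZ (k : ℤ) : powZ k * varZ = powZ (k + 1) := by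
  rw [powZ, varZ, ← map_mul, ← LaurentPolynomial.T_add, powZ]

theorem varA_mul_varA (k l : ℤ) : varA k * varA l = varA (k + l) :=
  (LaurentPolynomial.T_add k l).symm

/-- The trace of a braid, normalized in such a way that it is a polynomial in `a⁻²`. -/
noncomputable def braidTrace (n : ℕ) (β : BraidGroup n) : OcneanuRing :=
  ocneanuTrace ocneanuZ Polynomial.X (n - 1) (heckeRep ocneanuZ n β).1

/-- The HOMFLY polynomial of the closure of a braid, by means of the Ocneanu trace. -/
noncomputable def braidHomfly (n : ℕ) (β : BraidGroup n) : LaurentAZ :=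
  varA ((n : ℤ) - 1 - (braidExp n β).toAdd) * powZ (1 - n) * ocneanuEval (braidTrace n β)

theorem braidHomfly_conj (n : ℕ) (α β : BraidGroup n) :
    braidHomfly n (α * β) = braidHomfly n (β * α) := by
  have h : braidTrace n (α * β) = braidTrace n (β * α) := by
    unfold braidTrace
    rw [map_mul, map_mul, Units.val_mul, Units.val_mul]
    exact ocneanuTrace_mul_comm _ _ (heckeRep_mem _ α) (heckeRep_mem _ β)
  rw [braidHomfly, braidHomfly, h, map_mul (braidExp n), map_mul (braidExp n),
    mul_comm (braidExp n α)]

/-- Strand number and exponent sum both grow by one, so the power of a is unchanged; the factor z of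
the trace restores the power of z. -/
theorem braidHomfly_stabPos (n : ℕ) (hn : 0 < n) (β : BraidGroup n) :
    braidHomfly (n + 1) (braidIncl n β * braidLast n hn) = braidHomfly n β := by
  have h : braidTrace (n + 1) (braidIncl n β * braidLast n hn)
      = ocneanuZ * braidTrace n β := by
    unfold braidTrace
    rw [braidLast, heckeRep_mul_gen, heckeRep_incl]
    have := ocneanuTrace_mul_heckeL ocneanuZ Polynomial.X (heckeRep_mem ocneanuZ β)
    rwa [Nat.sub_add_cancel hn] at this
  rw [braidHomfly, braidHomfly, h, map_mul (braidExp _), map_mul ocneanuEval, braidLast,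
    braidExp_gen, braidExp_incl, ocneanuEval_z, toAdd_mul, toAdd_ofAdd, ← mul_assoc, mul_assoc (varA _), powZ_mul_varZ]
  congr 3 <;> push_cast <;> ring

/-- The exponent of a grows by two, which the factor b = a⁻² of the trace compensates. -/
theorem braidHomfly_stabNeg (n : ℕ) (hn : 0 < n) (β : BraidGroup n) :
    braidHomfly (n + 1) (braidIncl n β * (braidLast n hn)⁻¹) = braidHomfly n β := by
  have h : braidTrace (n + 1) (braidIncl n β * (braidLast n hn)⁻¹)
      = Polynomial.X * ocneanuZ * braidTrace n β := by
    unfold braidTrace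
    rw [braidLast, heckeRep_mul_inv, heckeRep_incl]
    have := ocneanuTrace_mul_heckeT ocneanuZ Polynomial.X (heckeRep_mem ocneanuZ β)
    rwa [Nat.sub_add_cancel hn] at this
  rw [braidHomfly, braidHomfly, h, map_mul (braidExp _), map_mul ocneanuEval,
    map_mul ocneanuEval, braidLast, map_inv (braidExp _), braidExp_gen, braidExp_incl, 
    ocneanuEval_z, ocneanuEval_X, toAdd_mul, toAdd_inv, toAdd_ofAdd]
  have e : ∀ a p b z t : LaurentAZ, a * p * (b * z * t) = (a * b) * (p * z) * t := by
    intro a p b z t; ring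
  rw [e, varA_mul_varA, powZ_mul_varZ]
  congr 3 <;> push_cast <;> ring

/-- The HOMFLY polynomial on closed braids. -/
noncomputable def closedBraidHomfly (L : ClosedBraid) : LaurentAZ := braidHomfly L.strands L.braid

theorem closedBraidHomfly_markov (L L' : ClosedBraid) (h : MarkovMove L L') :
    closedBraidHomfly L = closedBraidHomfly L' := by
  cases h with
  | conj n hn α β => exact braidHomfly_conj n α β
  | stabPos n hn β => exact (braidHomfly_stabPos n hn β).symm
  | stabNeg n hn β => exact (braidHomfly_stabNeg n hn β).symm

/-- The HOMFLY polynomial of a link, by means of the Ocneanu trace. -/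
noncomputable def ocneanuHomfly : OrientedLink → LaurentAZ :=
  Quot.lift closedBraidHomfly closedBraidHomfly_markov

theorem ocneanuHomfly_closure {n : ℕ} [NeZero n] (β : BraidGroup n) :
    ocneanuHomfly (braidClosure β) = braidHomfly n β := rfl

theorem braidTrace_skein {n : ℕ} (β : BraidGroup n) (i : Fin (n - 1)) :
    braidTrace n (β * braidGen n i) - braidTrace n (β * (braidGen n i)⁻¹)
      = ocneanuZ * braidTrace n β := by
  unfold braidTrace ocneanuTrace
  rw [heckeRep_mul_gen, heckeRep_mul_inv, heckeL_eq, mul_add, add_mul, map_add,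
    add_sub_cancel_left, mul_smul_comm, mul_one, smul_mul_assoc, map_smul, smul_eq_mul]

theorem isHomfly_ocneanuHomfly : IsHomfly ocneanuHomfly where
  unknot := by
    rw [unknot, ocneanuHomfly_closure, braidHomfly, braidTrace, map_one (braidExp 1),
      map_one (heckeRep _ 1), Units.val_one, ocneanuTrace_zero_one, map_one ocneanuEval, toAdd_one]
    simp [varA, powZ]
  skein n _ β i := by
    rw [ocneanuHomfly_closure, ocneanuHomfly_closure, ocneanuHomfly_closure]
    unfold braidHomfly
    rw [map_mul (braidExp n), map_mul (braidExp n), map_inv (braidExp n), braidExp_gen, toAdd_mul,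
      toAdd_mul, toAdd_inv, toAdd_ofAdd]
    set e := (braidExp n β).toAdd
    have h := congrArg ocneanuEval (braidTrace_skein β i)
    rw [map_sub, map_mul, ocneanuEval_z] at h
    have h1 : varA 1 * varA ((n : ℤ) - 1 - (e + 1)) = varA ((n : ℤ) - 1 - e) := by
      rw [varA_mul_varA]; congr 1; ring
    have h2 : varA (-1) * varA ((n : ℤ) - 1 - (e + -1)) = varA ((n : ℤ) - 1 - e) := by
      rw [varA_mul_varA]; congr 1; ring
    linear_combination (powZ (1 - n) * ocneanuEval (braidTrace n (β * braidGen n i))) * h1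
      - (powZ (1 - n) * ocneanuEval (braidTrace n (β * (braidGen n i)⁻¹))) * h2
      + (varA ((n : ℤ) - 1 - e) * powZ (1 - n)) * h

end HomflyExists

/-! ### Uniqueness of the HOMFLY polynomial -/

section HomflyUnique

theorem varA_cancel (k : ℤ) {x : LaurentAZ} (h : varA k * x = 0) : x = 0 := by
  have := congrArg (varA (-k) * ·) h
  simp only [← mul_assoc, varA_mul_varA, neg_add_cancel, mul_zero] at this
  rwa [varA, LaurentPolynomial.T_zero, one_mul] at this

theorem varZ_cancel {x : LaurentAZ} (h : varZ * x = 0) : x = 0 := by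
  have := congrArg (powZ (-1) * ·) h
  simp only [← mul_assoc, powZ_mul_varZ, neg_add_cancel, mul_zero] at this
  rwa [powZ, LaurentPolynomial.T_zero, map_one, one_mul] at this

/-- The functions on the braid group which satisfy the skein relation at every crossing. -/
def IsSkein {n : ℕ} (D : BraidGroup n → LaurentAZ) : Prop :=
  ∀ p q i, varA 1 * D (p * braidGen n i * q) - varA (-1) * D (p * (braidGen n i)⁻¹ * q)
    = varZ * D (p * q)

/-- Lets the argument pass to fewer strands: part of a braid word varies while the rest is frozen.
-/
theorem IsSkein.comp {n m : ℕ} {D : BraidGroup m → LaurentAZ} (hD : IsSkein D)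
    {φ : BraidGroup n →* BraidGroup m} (hφ : ∀ i, ∃ j, φ (braidGen n i) = braidGen m j)
    (x y : BraidGroup m) : IsSkein fun g => D (x * φ g * y) := by
  intro p q i
  obtain ⟨j, hj⟩ := hφ i
  have := hD (x * φ p) (φ q * y) j
  simpa only [map_mul, map_inv, hj, mul_assoc] using this

theorem IsSkein.mul_inv_eq_zero {n : ℕ} {D : BraidGroup n → LaurentAZ} (hD : IsSkein D)
    {p q : BraidGroup n} {i : Fin (n - 1)} (h1 : D (p * braidGen n i * q) = 0)
    (h2 : D (p * q) = 0) : D (p * (braidGen n i)⁻¹ * q) = 0 := by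
  have := hD p q i
  rw [h1, h2, mul_zero, mul_zero, zero_sub, neg_eq_zero] at this
  exact varA_cancel _ this

theorem IsSkein.mul_mul_eq_zero {n : ℕ} {D : BraidGroup n → LaurentAZ} (hD : IsSkein D)
    {p q : BraidGroup n} {i : Fin (n - 1)} (h1 : D (p * braidGen n i * q) = 0)
    (h2 : D (p * q) = 0) : D (p * braidGen n i * braidGen n i * q) = 0 := by
  have := hD (p * braidGen n i) q i
  rw [h1, mul_inv_cancel_right, h2, mul_zero, mul_zero, sub_zero] at this
  exact varA_cancel _ this

theorem braidLast_comm (n : ℕ) (hn : 0 < n) (u : BraidGroup n) :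
    Commute (braidIncl (n + 1) (braidIncl n u)) (braidLast (n + 1) n.succ_pos) := by
  have hg : ∀ i : Fin (n - 1), Commute (braidIncl (n + 1) (braidIncl n (braidGen n i)))
      (braidLast (n + 1) n.succ_pos) := by
    intro i
    rw [braidIncl_gen, braidIncl_gen]
    exact braidGen_comm _ _ _ (by simp; omega)
  induction u using braid_induction with
  | one => rw [map_one, map_one]; exact Commute.one_left _
  | mul_gen u i ih => rw [map_mul, map_mul]; exact ih.mul_left (hg i)
  | mul_inv u i ih => rw [map_mul, map_mul, map_inv, map_inv]; exact ih.mul_left (hg i).inv_left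

theorem braidLast_braid (n : ℕ) (hn : 0 < n) :
    braidLast (n + 1) n.succ_pos * braidIncl (n + 1) (braidLast n hn) * braidLast (n + 1) n.succ_pos
      = braidIncl (n + 1) (braidLast n hn) * braidLast (n + 1) n.succ_pos
        * braidIncl (n + 1) (braidLast n hn) := by
  have h : braidIncl (n + 1) (braidLast n hn) = braidGen (n + 1 + 1) ⟨n - 1, by omega⟩ :=
    braidIncl_gen _
  rw [h]
  exact (braidGen_braid _ _ _ (by simp; omega)).symm

/-- A function which satisfies the skein relation is determined by its values at the braids with
at most one occurrence of the last generator. -/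
theorem IsSkein.eq_zero (n : ℕ) : ∀ (D : BraidGroup (n + 1) → LaurentAZ), IsSkein D →
    (∀ x, D (braidIncl n x) = 0) →
    (∀ (hn : 0 < n) (x y), D (braidIncl n x * braidLast n hn * braidIncl n y) = 0) →
    ∀ g, D g = 0 := by
  induction n with
  | zero =>
    intro D _ h1 _ g
    induction g using braid_induction with
    | one => rw [← map_one (braidIncl 0)]; exact h1 1
    | mul_gen β i => exact i.elim0
    | mul_inv β i => exact i.elim0
  | succ k ih =>
    intro D hD h1 h2 g
    set s := braidLast (k + 1) k.succ_pos with hs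
    -- Two occurrences of the last generator s: for fixed x the induction hypothesis is applied to y
    -- ↦ D(x s y s). If y avoids its own last generator t, it commutes with s and s² is removed by
    -- the skein relation; if t occurs once in y, then s t s = t s t leaves a single s.
    have key : ∀ (D : BraidGroup (k + 1 + 1) → LaurentAZ), IsSkein D →
        (∀ x, D (braidIncl (k + 1) x) = 0) →
        (∀ x y, D (braidIncl (k + 1) x * s * braidIncl (k + 1) y) = 0) →
        ∀ x y, D (braidIncl (k + 1) x * s * braidIncl (k + 1) y * s) = 0 := by
      intro D hD h1 h2 x
      refine ih (fun y => D (braidIncl (k + 1) x * s * braidIncl (k + 1) y * s)) ?_ ?_ ?_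
      · exact hD.comp (fun i => ⟨_, braidIncl_gen i⟩) _ _
      · intro u
        rcases Nat.eq_zero_or_pos k with rfl | hk
        · have hu : u = 1 := by
            induction u using braid_induction with
            | one => rfl
            | mul_gen β i => exact i.elim0
            | mul_inv β i => exact i.elim0
          rw [hu, map_one, map_one, mul_one]
          have := hD.mul_mul_eq_zero (p := braidIncl (0 + 1) x) (q := 1) (i := ⟨0, by omega⟩)
            (by have := h2 x 1; rwa [map_one] at this)
            (by rw [mul_one]; exact h1 x)
          rwa [mul_one] at this
        · rw [mul_assoc (_ * s), (braidLast_comm k hk u).eq, ← mul_assoc]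
          have := hD.mul_mul_eq_zero (p := braidIncl (k + 1) x)
            (q := braidIncl (k + 1) (braidIncl k u)) (i := ⟨k + 1 - 1, by omega⟩)
            (h2 x _) (by rw [← map_mul]; exact h1 _)
          exact this
      · intro hk u v
        simp only [map_mul]
        have e : braidIncl (k + 1) x * s * (braidIncl (k + 1) (braidIncl k u)
            * braidIncl (k + 1) (braidLast k hk) * braidIncl (k + 1) (braidIncl k v)) * s
          = braidIncl (k + 1) (x * braidIncl k u * braidLast k hk) * s *
            braidIncl (k + 1) (braidLast k hk * braidIncl k v) := by
          have c1 := (braidLast_comm k hk u).eq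
          have c2 := (braidLast_comm k hk v).eq
          have c3 := braidLast_braid k hk
          rw [← hs] at c1 c2 c3
          simp only [map_mul]
          set X := braidIncl (k + 1) x
          set U := braidIncl (k + 1) (braidIncl k u)
          set V := braidIncl (k + 1) (braidIncl k v)
          set t := braidIncl (k + 1) (braidLast k hk)
          calc X * s * (U * t * V) * s = X * (s * U) * t * (V * s) := by simp only [mul_assoc]
            _ = X * U * (s * t * s) * V := by rw [← c1, c2]; simp only [mul_assoc]
            _ = X * U * t * s * (t * V) := by rw [c3]; simp only [mul_assoc]
        rw [e]
        exact h2 _ _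
    -- The vanishing conditions are inherited by g ↦ D(g σ_i). So the final induction on g must run
    -- over all D at once, peeling letters off the end of g.
    have gen : ∀ (i : Fin (k + 1 + 1 - 1)) (D : BraidGroup (k + 1 + 1) → LaurentAZ), IsSkein D →
        (∀ x, D (braidIncl (k + 1) x) = 0) →
        (∀ x y, D (braidIncl (k + 1) x * s * braidIncl (k + 1) y) = 0) →
        IsSkein (fun g => D (g * braidGen _ i)) ∧
        (∀ x, D (braidIncl (k + 1) x * braidGen _ i) = 0) ∧
        (∀ x y, D (braidIncl (k + 1) x * s * braidIncl (k + 1) y * braidGen _ i) = 0) := by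
      intro i D hD h1 h2
      refine ⟨?_, ?_⟩
      · have := hD.comp (φ := MonoidHom.id _) (fun i => ⟨i, rfl⟩) 1 (braidGen _ i)
        simpa only [one_mul, MonoidHom.id_apply] using this
      · by_cases hi : i.1 < k + 1 - 1
        · have hg : braidGen (k + 1 + 1) i = braidIncl (k + 1) (braidGen (k + 1) ⟨i.1, hi⟩) :=
            (braidIncl_gen (n := k + 1) ⟨i.1, hi⟩).symm
          rw [hg]
          refine ⟨fun x => ?_, fun x y => ?_⟩
          · rw [← map_mul]; exact h1 _
          · rw [mul_assoc, ← map_mul]; exact h2 _ _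
        · have hg : braidGen (k + 1 + 1) i = s := by
            rw [hs, braidLast]
            congr 1
            exact Fin.ext (by simp; omega)
          rw [hg]
          refine ⟨fun x => ?_, key D hD h1 h2⟩
          have := h2 x 1
          rwa [map_one, mul_one] at this
    have all : ∀ g : BraidGroup (k + 1 + 1), ∀ (D : BraidGroup (k + 1 + 1) → LaurentAZ), IsSkein D →
        (∀ x, D (braidIncl (k + 1) x) = 0) →
        (∀ x y, D (braidIncl (k + 1) x * s * braidIncl (k + 1) y) = 0) → D g = 0 := by
      intro g
      induction g using braid_induction with
      | one => intro D _ h1 _; rw [← map_one (braidIncl (k + 1))]; exact h1 1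
      | mul_gen β i ih =>
        intro D hD h1 h2
        obtain ⟨g1, g2, g3⟩ := gen i D hD h1 h2
        exact ih _ g1 g2 g3
      | mul_inv β i ih =>
        intro D hD h1 h2
        obtain ⟨g1, g2, g3⟩ := gen i D hD h1 h2
        have := hD.mul_inv_eq_zero (p := β) (q := 1) (i := i)
          (by rw [mul_one]; exact ih _ g1 g2 g3) (by rw [mul_one]; exact ih D hD h1 h2)
        rwa [mul_one] at this
    exact all g D hD h1 (h2 k.succ_pos)

theorem closure_conj {n : ℕ} [NeZero n] (α β : BraidGroup n) :
    braidClosure (α * β) = braidClosure (β * α) :=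
  Quot.sound (MarkovMove.conj n (NeZero.pos n) α β)

theorem closure_stabPos {n : ℕ} [NeZero n] (hn : 0 < n) (β : BraidGroup n) :
    braidClosure (braidIncl n β * braidLast n hn) = braidClosure β :=
  (Quot.sound (MarkovMove.stabPos n hn β)).symm

theorem closure_stabNeg {n : ℕ} [NeZero n] (hn : 0 < n) (β : BraidGroup n) :
    braidClosure (braidIncl n β * (braidLast n hn)⁻¹) = braidClosure β :=
  (Quot.sound (MarkovMove.stabNeg n hn β)).symm

theorem IsHomfly.skein_mul {P : OrientedLink → LaurentAZ} (hP : IsHomfly P) {n : ℕ} [NeZero n]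
    (p q : BraidGroup n) (i : Fin (n - 1)) :
    varA 1 * P (braidClosure (p * braidGen n i * q))
      - varA (-1) * P (braidClosure (p * (braidGen n i)⁻¹ * q)) = varZ * P (braidClosure (p * q)) := by
  have := hP.skein n (q * p) i
  rw [mul_assoc, closure_conj, mul_assoc q, closure_conj q (p * (braidGen n i)⁻¹),
    closure_conj q p] at this
  exact this

/-- For a braid on one strand fewer, the skein relation at the two stabilizations, which have equal
closures, expresses z times the difference on n + 1 strands by the difference on fewer strands. A
braid with one last generator is conjugate to a stabilization. -/
theorem IsHomfly.unique {P Q : OrientedLink → LaurentAZ} (hP : IsHomfly P) (hQ : IsHomfly Q)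
    (n : ℕ) : ∀ β : BraidGroup (n + 1), P (braidClosure β) - Q (braidClosure β) = 0 := by
  have hskein : ∀ n, IsSkein fun β : BraidGroup (n + 1) =>
      P (braidClosure β) - Q (braidClosure β) := by
    intro n p q i
    linear_combination hP.skein_mul p q i - hQ.skein_mul p q i
  induction n with
  | zero =>
    intro β
    have hβ : β = 1 := by
      induction β using braid_induction with
      | one => rfl
      | mul_gen β i => exact i.elim0
      | mul_inv β i => exact i.elim0
    subst hβ
    have h1 : P (braidClosure (1 : BraidGroup 1)) = 1 := hP.unknot
    have h2 : Q (braidClosure (1 : BraidGroup 1)) = 1 := hQ.unknot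
    exact sub_eq_zero.2 (h1.trans h2.symm)
  | succ n ih =>
    refine IsSkein.eq_zero (n + 1) _ (hskein (n + 1)) (fun x => ?_) (fun hn x y => ?_)
    · have h1 := hskein (n + 1) (braidIncl (n + 1) x) 1 ⟨n + 1 - 1, by omega⟩
      simp only [mul_one] at h1
      have h2 := closure_stabPos n.succ_pos x
      have h3 := closure_stabNeg n.succ_pos x
      rw [braidLast] at h2 h3
      rw [h2, h3, ih x, mul_zero, mul_zero, sub_zero] at h1
      exact varZ_cancel h1.symm
    · rw [closure_conj, ← mul_assoc, ← map_mul, closure_stabPos]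
      exact ih _

/-- Existence makes the choice in `homfly` a genuine solution, and uniqueness identifies it with the
Ocneanu construction. -/
theorem homfly_closure {n : ℕ} [NeZero n] (β : BraidGroup n) :
    homfly (braidClosure β) = braidHomfly n β := by
  have hP : IsHomfly homfly := Classical.epsilon_spec ⟨_, isHomfly_ocneanuHomfly⟩
  obtain ⟨m, rfl⟩ : ∃ m, n = m + 1 := Nat.exists_eq_succ_of_ne_zero (NeZero.ne n)
  have := hP.unique isHomfly_ocneanuHomfly m β
  rw [sub_eq_zero, ocneanuHomfly_closure] at this
  exact this

end HomflyUnique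

/-! ### The Hecke trace of a positive braid times a negative braid -/

section TraceRecursion

variable {n : ℕ}

/-- The permutations of `{0, …, n-1}` as permutations of `ℕ`. -/
def natPerm (n : ℕ) : Equiv.Perm (Fin n) →* Equiv.Perm ℕ :=
  Equiv.Perm.extendDomainHom Fin.equivSubtype

theorem natPerm_apply (w : Equiv.Perm (Fin n)) (j : Fin n) : natPerm n w j = (w j : ℕ) :=
  Equiv.Perm.extendDomain_apply_image w Fin.equivSubtype j

theorem natPerm_inv_apply (w : Equiv.Perm (Fin n)) (j : Fin n) :
    (natPerm n w)⁻¹ j = (w⁻¹ j : Fin n).1 := by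
  rw [← map_inv, natPerm_apply]

theorem natPerm_of_le (w : Equiv.Perm (Fin n)) {j : ℕ} (hj : n ≤ j) : natPerm n w j = j :=
  Equiv.Perm.extendDomain_apply_not_subtype w Fin.equivSubtype (not_lt.2 hj)

theorem natPerm_eq_one_iff (w : Equiv.Perm (Fin n)) : natPerm n w = 1 ↔ w = 1 :=
  Equiv.Perm.extendDomain_eq_one_iff

theorem natPerm_simpleSwap (i : Fin (n - 1)) : natPerm n (simpleSwap n i) = natSwap i := by
  ext x
  rcases lt_or_ge x n with hx | hx
  · have h := natPerm_apply (simpleSwap n i) ⟨x, hx⟩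
    change natPerm n (simpleSwap n i) x = _ at h
    rw [h]
    simp only [simpleSwap, natSwap, Equiv.swap_apply_def, Fin.ext_iff]
    split_ifs <;> rfl
  · rw [natPerm_of_le _ hx, natSwap_of_ne (by omega) (by omega)]

variable {R : Type*} [CommRing R] (z : R)

theorem deltaFun_congr {u w u' w' : Equiv.Perm ℕ} (h : w = u ↔ w' = u') :
    deltaFun R u w = deltaFun R u' w' := by
  classical
  rw [deltaFun_apply, deltaFun_apply]
  by_cases hw : w = u
  · rw [if_pos hw, if_pos (h.1 hw)]
  · rw [if_neg hw, if_neg (mt h.2 hw)]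

theorem heckeL_deltaFun (i : ℕ) (u : Equiv.Perm ℕ) :
    heckeL z i (deltaFun R u)
      = deltaFun R (natSwap i * u) + if u⁻¹ i < u⁻¹ (i + 1) then z • deltaFun R u else 0 := by
  ext w
  rw [heckeL_apply, Pi.add_apply]
  have e : natSwap i * w = u ↔ w = natSwap i * u :=
    ⟨fun h => by rw [← h, natSwap_mul_cancel], fun h => by rw [h, natSwap_mul_cancel]⟩
  congr 1
  · exact deltaFun_congr e
  · by_cases h : w = u
    · subst h
      split_ifs <;> rfl
    · have h0 : deltaFun R u w = 0 := by rw [deltaFun_apply, if_neg h]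
      split_ifs <;> simp [h0]

theorem heckeR_deltaFun (i : ℕ) (u : Equiv.Perm ℕ) :
    heckeR z i (deltaFun R u)
      = deltaFun R (u * natSwap i) + if u i < u (i + 1) then z • deltaFun R u else 0 := by
  ext w
  rw [heckeR_apply, Pi.add_apply]
  have e : w * natSwap i = u ↔ w = u * natSwap i :=
    ⟨fun h => by rw [← h, mul_assoc, natSwap_mul_self, mul_one],
      fun h => by rw [h, mul_assoc, natSwap_mul_self, mul_one]⟩
  congr 1
  · exact deltaFun_congr e
  · by_cases h : w = u
    · subst h
      split_ifs <;> rfl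
    · have h0 : deltaFun R u w = 0 := by rw [deltaFun_apply, if_neg h]
      split_ifs <;> simp [h0]

/-- In this representation the delta functions correspond to products of inverse generators over
reduced words, so an inverse generator acts on an ascent without a correction term. -/
theorem heckeT_deltaFun {i : ℕ} {u : Equiv.Perm ℕ} (h : u⁻¹ i < u⁻¹ (i + 1)) :
    heckeT z i (deltaFun R u) = deltaFun R (natSwap i * u) := by
  rw [heckeT, LinearMap.sub_apply, heckeL_deltaFun, if_pos h, Module.algebraMap_end_apply,
    add_sub_cancel_right]

theorem braidOfWord_cons (i : Fin (n - 1)) (a : List (Fin (n - 1))) :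
    braidOfWord (i :: a) = braidGen n i * braidOfWord a := by
  rw [braidOfWord, List.map_cons, List.prod_cons, braidOfWord]

theorem heckeRep_braidOfWord_cons (i : Fin (n - 1)) (a : List (Fin (n - 1))) :
    (heckeRep z n (braidOfWord (i :: a))).1 = heckeL z i * (heckeRep z n (braidOfWord a)).1 := by
  rw [braidOfWord_cons, map_mul, heckeRep_gen]; rfl

theorem heckeRep_inv_of_append (a : List (Fin (n - 1))) (i : Fin (n - 1)) :
    (heckeRep z n (braidOfWord (a ++ [i]))⁻¹).1
      = heckeT z i * (heckeRep z n (braidOfWord a)⁻¹).1 := by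
  rw [braidOfWord, List.map_append, List.prod_append, mul_inv_rev, map_mul, List.map_singleton,
    List.prod_singleton, map_inv, heckeRep_gen]; rfl

theorem heckeRep_inv_deltaFun (a : List (Fin (n - 1))) : ∀ {v : Equiv.Perm (Fin n)},
    IsReducedWord a v →
      (heckeRep z n (braidOfWord a)⁻¹).1 (deltaFun R 1) = deltaFun R (natPerm n v⁻¹) := by
  induction a using List.reverseRecOn with
  | nil =>
    intro v h
    have : v = 1 := h.1.symm
    rw [this, inv_one, map_one]
    have : (braidOfWord [] : BraidGroup n) = 1 := rfl
    rw [this, inv_one, map_one, Units.val_one, Module.End.one_apply]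
  | append_singleton a i ih =>
    intro v h
    have h1 := h.reverse
    rw [List.reverse_append, List.reverse_singleton, List.singleton_append] at h1
    obtain ⟨h2, h3⟩ := h1.of_cons
    have h4 := h2.reverse
    rw [List.reverse_reverse] at h4
    rw [heckeRep_inv_of_append, Module.End.mul_apply, ih h4, inv_inv, map_mul, natPerm_simpleSwap,
      heckeT_deltaFun, natSwap_mul_cancel]
    have e1 := natPerm_inv_apply v⁻¹ (loPt i)
    have e2 := natPerm_inv_apply v⁻¹ (hiPt i)
    rw [loPt_val] at e1
    rw [hiPt_val] at e2
    rw [natSwap_mul_inv_apply, natSwap_mul_inv_apply, natSwap_left, natSwap_right, e1, e2]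
    exact h3

/-- The value at the identity of the action of a positive braid on a basis vector. -/
noncomputable def traceCoeff (v : Equiv.Perm (Fin n)) (b : List (Fin (n - 1))) : R :=
  (heckeRep z n (braidOfWord b)).1 (deltaFun R (natPerm n v⁻¹)) 1

theorem heckeTrace_eq_traceCoeff {a : List (Fin (n - 1))} {v : Equiv.Perm (Fin n)}
    (ha : IsReducedWord a v) (b : List (Fin (n - 1))) :
    heckeTrace (heckeRep z n (braidOfWord b * (braidOfWord a)⁻¹)).1 = traceCoeff z v b := by
  rw [heckeTrace_apply, map_mul, Units.val_mul, Module.End.mul_apply, heckeRep_inv_deltaFun z a ha,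
    traceCoeff]

theorem traceCoeff_nil (v : Equiv.Perm (Fin n)) :
    traceCoeff z v [] = if v = 1 then 1 else 0 := by
  have h : (braidOfWord [] : BraidGroup n) = 1 := rfl
  rw [traceCoeff, h, map_one, Units.val_one, Module.End.one_apply, deltaFun_apply]
  have e : 1 = natPerm n v⁻¹ ↔ v = 1 := by rw [eq_comm, natPerm_eq_one_iff, inv_eq_one]
  by_cases hv : v = 1
  · rw [if_pos hv, if_pos (e.2 hv)]
  · rw [if_neg hv, if_neg (mt e.1 hv)]

/-- The first generator is read at the identity as a right multiplication, commuted past the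
remaining braid, and then acts on the delta function of v⁻¹ from the right, that is, on v from the
left. The result is the R-recursion in terms of z. -/
theorem traceCoeff_cons (v : Equiv.Perm (Fin n)) (i : Fin (n - 1)) (b : List (Fin (n - 1))) :
    traceCoeff z v (i :: b) = traceCoeff z (simpleSwap n i * v) b
      + if v⁻¹ (loPt i) < v⁻¹ (hiPt i) then z * traceCoeff z v b else 0 := by
  have hc : Commute (heckeRep z n (braidOfWord b)).1 (heckeR z i) :=
    commute_of_mem_heckeAlg z (fun j _ => heckeL_heckeR_comm z j i) (heckeRep_mem z _)
  have e1 := natPerm_apply v⁻¹ (loPt i)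
  have e2 := natPerm_apply v⁻¹ (hiPt i)
  rw [loPt_val] at e1
  rw [hiPt_val] at e2
  have hp : natPerm n v⁻¹ * natSwap i = natPerm n (simpleSwap n i * v)⁻¹ := by
    rw [mul_inv_rev, simpleSwap_inv, map_mul, natPerm_simpleSwap]
  rw [traceCoeff, heckeRep_braidOfWord_cons, Module.End.mul_apply, heckeL_apply_one,
    ← Module.End.mul_apply, ← hc.eq, Module.End.mul_apply, heckeR_deltaFun, map_add, Pi.add_apply,
    hp, traceCoeff, e1, e2]
  simp only [Fin.lt_def]
  split_ifs
  · rw [map_smul, Pi.smul_apply, smul_eq_mul, traceCoeff]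
  · rw [map_zero, Pi.zero_apply]

theorem traceCoeff_eq_zero (b : List (Fin (n - 1))) : ∀ {v w : Equiv.Perm (Fin n)},
    IsReducedWord b w → ¬ BruhatLE v w → traceCoeff z v b = 0 := by
  induction b with
  | nil =>
    intro v w h hv
    have hw : w = 1 := h.1.symm
    rw [traceCoeff_nil, if_neg]
    rintro rfl
    exact hv (hw ▸ BruhatLE.refl _)
  | cons i b ih =>
    intro v w h hv
    obtain ⟨h1, h2⟩ := h.of_cons
    rcases inv_lo_lt_or v i with hi | hi
    · rw [bruhatLE_iff_of_asc h2 hi, not_or] at hv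
      rw [traceCoeff_cons, if_pos hi, ih h1 hv.1, ih h1 hv.2, mul_zero, add_zero]
    · rw [bruhatLE_iff_of_desc h2 hi] at hv
      rw [traceCoeff_cons, if_neg hi.not_gt, ih h1 hv, add_zero]

/-- Both sides follow the same recursion along the reduced word, since q = t² and q - 1 = t(t -
t⁻¹); the power of t absorbs the change of lengths. -/
theorem aeval_klR_eq_traceCoeff {K : Type*} [Field K] {t : K} (ht : t ≠ 0)
    (b : List (Fin (n - 1))) : ∀ {w : Equiv.Perm (Fin n)}, IsReducedWord b w →
      ∀ v : Equiv.Perm (Fin n), Polynomial.aeval (t ^ 2) (klR v w)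
        = t ^ ((permLength w : ℤ) - permLength v) * traceCoeff (t - t⁻¹) v b := by
  induction b with
  | nil =>
    intro w h v
    have hw : w = 1 := h.1.symm
    subst hw
    rw [traceCoeff_nil, klR_one]
    split_ifs with hv
    · subst hv; simp
    · simp
  | cons i b ih =>
    intro w h v
    obtain ⟨h1, h2⟩ := h.of_cons
    obtain ⟨u, rfl⟩ : ∃ u, w = simpleSwap n i * u := ⟨_, (simpleSwap_mul_cancel i w).symm⟩
    rw [simpleSwap_mul_cancel] at h1
    rw [simpleSwap_mul_inv_lo, simpleSwap_mul_inv_hi] at h2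
    have hlu := permLength_simpleSwap_mul_of_lt h2
    rcases inv_lo_lt_or v i with hi | hi
    · have hlv := permLength_simpleSwap_mul_of_lt hi
      rw [klR_asc h2 hi, traceCoeff_cons, if_pos hi, map_add, map_mul, map_mul, map_sub, map_one,
        Polynomial.aeval_X, ih h1, ih h1, hlu, hlv]
      push_cast
      have e1 : t ^ ((permLength u : ℤ) + 1 - permLength v)
          = t ^ ((permLength u : ℤ) - permLength v) * t := by
        rw [← zpow_add_one₀ ht]; congr 1; ring
      have e2 : t ^ ((permLength u : ℤ) - (permLength v + 1))
          = t ^ ((permLength u : ℤ) - permLength v) * t⁻¹ := by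
        rw [← zpow_sub_one₀ ht]; congr 1; ring
      rw [e1, e2]
      have := mul_inv_cancel₀ ht
      linear_combination (t ^ ((permLength u : ℤ) - permLength v)) *
        (t * traceCoeff (t - t⁻¹) (simpleSwap n i * v) b + traceCoeff (t - t⁻¹) v b) * this
    · obtain ⟨x, rfl⟩ : ∃ x, v = simpleSwap n i * x := ⟨_, (simpleSwap_mul_cancel i v).symm⟩
      have hi' := hi
      rw [simpleSwap_mul_inv_lo, simpleSwap_mul_inv_hi] at hi'
      have hlv := permLength_simpleSwap_mul_of_lt hi'
      rw [klR_desc h2 hi', traceCoeff_cons, if_neg hi.not_gt, simpleSwap_mul_cancel, ih h1, hlu,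
        hlv, add_zero]
      congr 2
      push_cast; ring

end TraceRecursion

/-! ### The top coefficient of the HOMFLY polynomial -/

section TopCoefficient

variable {n : ℕ}

theorem coeff_T_mul (k : ℤ) (P : LaurentAZ) (j : ℤ) :
    (varA k * P).coeff j = P.coeff (j - k) := by
  rw [varA, LaurentPolynomial.T, AddMonoidAlgebra.coeff_single_mul_apply, one_mul]
  congr 1; ring

theorem coeff_C_mul (c : LaurentPolynomial ℤ) (P : LaurentAZ) (j : ℤ) :
    (LaurentPolynomial.C c * P).coeff j = c * P.coeff j := by
  rw [← LaurentPolynomial.single_eq_C, AddMonoidAlgebra.coeff_single_mul_apply]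
  simp

theorem ocneanuEval_monomial (m : ℕ) (c : LaurentPolynomial ℤ) :
    ocneanuEval (Polynomial.monomial m c) = LaurentPolynomial.C c * varA (-2 * m) := by
  rw [← Polynomial.C_mul_X_pow_eq_monomial, map_mul, map_pow, ocneanuEval_C, ocneanuEval_X, varA,
    varA, LaurentPolynomial.T_pow, mul_comm (m : ℤ)]

/-- The evaluation puts b = a⁻², so only nonpositive powers of a occur; this bounds the degree in a
by the exponent of the normalizing factor. -/
theorem ocneanuEval_coeff_pos (Q : OcneanuRing) {j : ℤ} (hj : 0 < j) :
    (ocneanuEval Q).coeff j = 0 := by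
  induction Q using Polynomial.induction_on' with
  | add p q hp hq => rw [map_add, AddMonoidAlgebra.coeff_add, Finsupp.add_apply, hp, hq, add_zero]
  | monomial m c =>
    rw [ocneanuEval_monomial, coeff_C_mul, varA, LaurentPolynomial.T_apply, if_neg (by omega),
      mul_zero]

theorem ocneanuEval_coeff_zero (Q : OcneanuRing) : (ocneanuEval Q).coeff 0 = Q.coeff 0 := by
  induction Q using Polynomial.induction_on' with
  | add p q hp hq =>
    rw [map_add, AddMonoidAlgebra.coeff_add, Finsupp.add_apply, hp, hq, Polynomial.coeff_add]
  | monomial m c =>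
    rw [ocneanuEval_monomial, coeff_C_mul, varA, LaurentPolynomial.T_apply,
      Polynomial.coeff_monomial]
    by_cases hm : m = 0
    · subst hm; simp
    · rw [if_neg (by omega), if_neg hm, mul_zero]

theorem ocneanuElt_zero {R : Type*} [CommRing R] (z : R) (m : ℕ) : ocneanuElt z 0 m = 1 := by
  induction m with
  | zero => rfl
  | succ m ih => rw [ocneanuElt, ih, zero_smul, sub_zero, one_mul]

/-- Base change along b ↦ 0 turns every factor 1 - bJ into 1, and the Ocneanu trace degenerates to
the canonical trace. -/
theorem braidTrace_coeff_zero (β : BraidGroup n) :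
    (braidTrace n β).coeff 0 = heckeTrace (heckeRep (LaurentPolynomial.T 1) n β).1 := by
  have h := (BaseChange.heckeRep ocneanuZ Polynomial.constantCoeff β).ocneanuTrace
    (z := ocneanuZ) Polynomial.X (n - 1)
  have hz : Polynomial.constantCoeff ocneanuZ = (LaurentPolynomial.T 1 : LaurentPolynomial ℤ) := by
    rw [ocneanuZ, Polynomial.constantCoeff_apply, Polynomial.coeff_C_zero]
  have hX : Polynomial.constantCoeff (Polynomial.X : OcneanuRing) = 0 := by
    rw [Polynomial.constantCoeff_apply, Polynomial.coeff_X_zero]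
  rw [hz, hX, ocneanuTrace, ocneanuElt_zero, mul_one, Polynomial.constantCoeff_apply] at h
  exact h.symm

theorem braidHomfly_coeff (β : BraidGroup n) (j : ℤ) :
    (braidHomfly n β).coeff j = LaurentPolynomial.T (1 - n)
      * (ocneanuEval (braidTrace n β)).coeff (j - ((n : ℤ) - 1 - (braidExp n β).toAdd)) := by
  rw [braidHomfly, mul_assoc, coeff_T_mul, powZ, coeff_C_mul]

theorem degree_le_of_coeff {P : LaurentAZ} {κ : ℤ} (h : ∀ j, κ < j → P.coeff j = 0) :
    P.degree ≤ κ := by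
  refine Finset.max_le fun j hj => ?_
  rw [WithBot.coe_le_coe]
  by_contra hlt
  exact Finsupp.mem_support_iff.1 hj (h j (not_le.1 hlt))

theorem degree_eq_of_coeff {P : LaurentAZ} {κ : ℤ} (h : ∀ j, κ < j → P.coeff j = 0)
    (h0 : P.coeff κ ≠ 0) : P.degree = κ :=
  (degree_le_of_coeff h).antisymm (Finset.le_max (Finsupp.mem_support_iff.2 h0))

theorem degree_lt_of_coeff {P : LaurentAZ} {κ : ℤ} (h : ∀ j, κ < j → P.coeff j = 0)
    (h0 : P.coeff κ = 0) : P.degree < κ := by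
  refine lt_of_le_of_ne (degree_le_of_coeff h) fun he => ?_
  exact Finsupp.mem_support_iff.1 (Finset.mem_of_max he) h0

theorem sum_mul_zpow_eq_eval₂ {K : Type*} [Field K] {x : K} (hx : x ≠ 0) (p : LaurentPolynomial ℤ) :
    (p.coeff.sum fun k c => (c : K) * x ^ k)
      = LaurentPolynomial.eval₂ (Int.castRingHom K) (Units.mk0 x hx) p := by
  induction p using LaurentPolynomial.induction_on' with
  | add p q hp hq =>
    rw [map_add, ← hp, ← hq, AddMonoidAlgebra.coeff_add, Finsupp.sum_add_index']
    · intro k; simp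
    · intro k c d; push_cast; ring
  | C_mul_T k c =>
    rw [LaurentPolynomial.eval₂_C_mul_T, ← LaurentPolynomial.single_eq_C_mul_T,
      AddMonoidAlgebra.coeff_single, Finsupp.sum_single_index (by simp), Units.val_zpow_eq_zpow_val]
    rfl

theorem braidExp_braidOfWord (a : List (Fin (n - 1))) :
    (braidExp n (braidOfWord a)).toAdd = a.length := by
  induction a with
  | nil =>
    have : (braidOfWord [] : BraidGroup n) = 1 := rfl
    rw [this, map_one (braidExp n)]; rfl
  | cons i a ih =>
    rw [braidOfWord_cons, map_mul (braidExp n), toAdd_mul, ih, braidExp_gen, toAdd_ofAdd,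
      List.length_cons]
    push_cast; ring

variable {v w : Equiv.Perm (Fin n)} {a b : List (Fin (n - 1))}

theorem topDegree_eq (ha : IsReducedWord a v) (hb : IsReducedWord b w) :
    (n : ℤ) - 1 - (braidExp n (braidOfWord b * (braidOfWord a)⁻¹)).toAdd = topDegree v w := by
  rw [map_mul (braidExp n), map_inv (braidExp n), toAdd_mul, toAdd_inv, braidExp_braidOfWord,
    braidExp_braidOfWord, ha.2, hb.2, topDegree]
  ring

theorem traceCoeff_eval₂ {K : Type*} [Field K] (x : Kˣ) (ha : IsReducedWord a v)
    (b : List (Fin (n - 1))) :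
    LaurentPolynomial.eval₂ (Int.castRingHom K) x (traceCoeff (LaurentPolynomial.T 1) v b)
      = traceCoeff (x : K) v b := by
  have h := (BaseChange.heckeRep (LaurentPolynomial.T 1 : LaurentPolynomial ℤ)
    (LaurentPolynomial.eval₂ (Int.castRingHom K) x)
    (braidOfWord b * (braidOfWord a)⁻¹)).heckeTrace
  rw [heckeTrace_eq_traceCoeff _ ha, heckeTrace_eq_traceCoeff _ ha, LaurentPolynomial.eval₂_T,
    zpow_one] at h
  exact h.symm

variable [NeZero n]

theorem homfly_coeff_of_lt (ha : IsReducedWord a v) (hb : IsReducedWord b w) {j : ℤ}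
    (hj : topDegree v w < j) :
    (homfly (braidClosure (braidOfWord b * (braidOfWord a)⁻¹))).coeff j = 0 := by
  rw [homfly_closure, braidHomfly_coeff, topDegree_eq ha hb, ocneanuEval_coeff_pos _ (by omega),
    mul_zero]

theorem homfly_coeff_topDegree (ha : IsReducedWord a v) (hb : IsReducedWord b w) :
    (homfly (braidClosure (braidOfWord b * (braidOfWord a)⁻¹))).coeff (topDegree v w)
      = LaurentPolynomial.T (1 - n) * traceCoeff (LaurentPolynomial.T 1) v b := by
  rw [homfly_closure, braidHomfly_coeff, topDegree_eq ha hb, sub_self, ocneanuEval_coeff_zero,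
    braidTrace_coeff_zero, heckeTrace_eq_traceCoeff _ ha]

/-- The Kazhdan–Lusztig polynomial as the top coefficient of the HOMFLY polynomial. -/
theorem aeval_klR_eq_substTerm {K : Type*} [Field K] {t : K} (ht : t ≠ 0) (ht' : t ^ 2 ≠ 1)
    (ha : IsReducedWord a v) (hb : IsReducedWord b w) :
    Polynomial.aeval (t ^ 2) (klR v w) = (t ^ 2 - 1) ^ (n - 1)
      * substTerm (homfly (braidClosure (braidOfWord b * (braidOfWord a)⁻¹))) (topDegree v w) t := by
  have hz : t - t⁻¹ ≠ 0 := by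
    intro h
    apply ht'
    linear_combination t * h + mul_inv_cancel₀ ht
  -- With z = t - t⁻¹, the factor (q - 1)^(n-1) = t^(n-1) z^(n-1) cancels z^(1-n) and the part
  -- t^(1-n) of a^κ.
  have hzt : t ^ 2 - 1 = t * (t - t⁻¹) := by linear_combination mul_inv_cancel₀ ht
  have hn : (1 : ℤ) - n = -((n - 1 : ℕ) : ℤ) := by
    have := NeZero.pos n
    omega
  have hκ : topDegree v w = ((n - 1 : ℕ) : ℤ) - ((permLength w : ℤ) - permLength v) := by
    rw [topDegree]; omega
  rw [substTerm, homfly_coeff_topDegree ha hb, sum_mul_zpow_eq_eval₂ hz, map_mul,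
    traceCoeff_eval₂ _ ha, LaurentPolynomial.eval₂_T, Units.val_zpow_eq_zpow_val, Units.val_mk0,
    aeval_klR_eq_traceCoeff ht b hb v, hn, hκ, hzt, mul_pow, inv_zpow', neg_sub,
    zpow_sub₀ ht (_ - _), zpow_neg, zpow_natCast, zpow_natCast]
  have h1 := mul_inv_cancel₀ (pow_ne_zero (n - 1) ht)
  have h2 := mul_inv_cancel₀ (pow_ne_zero (n - 1) hz)
  set y := traceCoeff (t - t⁻¹) v b
  set x := t ^ ((permLength w : ℤ) - permLength v)
  calc x * y = x * y * (t ^ (n - 1) * (t ^ (n - 1))⁻¹)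
        * ((t - t⁻¹) ^ (n - 1) * ((t - t⁻¹) ^ (n - 1))⁻¹) := by rw [h1, h2, mul_one, mul_one]
    _ = _ := by ring

theorem homfly_degree_lt (ha : IsReducedWord a v) (hb : IsReducedWord b w) (h : ¬ BruhatLE v w) :
    (homfly (braidClosure (braidOfWord b * (braidOfWord a)⁻¹))).degree
      < (topDegree v w : WithBot ℤ) := by
  refine degree_lt_of_coeff (fun j => homfly_coeff_of_lt ha hb) ?_
  rw [homfly_coeff_topDegree ha hb, traceCoeff_eq_zero _ b hb h, mul_zero]

/-- If the coefficient at κ vanished, evaluation at t = √2 would give R_v^w(2) = 0, but this is the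
number of points over the field with two elements, which is nonzero for v ≤ w. -/
theorem homfly_degree_eq (ha : IsReducedWord a v) (hb : IsReducedWord b w) (h : BruhatLE v w) :
    (homfly (braidClosure (braidOfWord b * (braidOfWord a)⁻¹))).degree
      = (topDegree v w : WithBot ℤ) := by
  refine degree_eq_of_coeff (fun j => homfly_coeff_of_lt ha hb) fun h0 => ?_
  have : Fact (Nat.Prime 2) := ⟨Nat.prime_two⟩
  have h2 := (card_richardson_ne_zero_iff (F := ZMod 2) v w).2 h
  have h3 := card_richardson (F := ZMod 2) v w
  have h4 : (klR v w).eval (2 : ℤ) ≠ 0 := by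
    rw [ZMod.card] at h3
    rw [← Nat.cast_ofNat, ← h3]
    exact_mod_cast h2
  have hs : (Real.sqrt 2) ^ 2 = 2 := Real.sq_sqrt (by norm_num)
  have h5 := aeval_klR_eq_substTerm (t := Real.sqrt 2) (by positivity) (by rw [hs]; norm_num) ha hb
  rw [substTerm, h0, hs, AddMonoidAlgebra.coeff_zero, Finsupp.sum_zero_index, mul_zero, mul_zero,
    ← map_ofNat (algebraMap ℤ ℝ), Polynomial.aeval_algebraMap_apply] at h5
  simp only [eq_intCast, Int.cast_eq_zero, Polynomial.coe_aeval_eq_eval] at h5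
  exact h4 h5

end TopCoefficient

/-! ### Normal forms in the Schubert cells -/

section NormalForm

variable {n : ℕ} {F : Type*} [Field F]

/-- The normal forms of the elements of a Schubert cell: the entries at the places of the
permutation matrix of `w` are `1`, and the other entries vanish unless they are both to the left of
such a place and above such a place. -/
def IsNormalForm (w : Equiv.Perm (Fin n)) (h : Matrix (Fin n) (Fin n) F) : Prop :=
  (∀ a, h a (w⁻¹ a) = 1) ∧ ∀ a j, h a j ≠ 0 → j = w⁻¹ a ∨ (a < w j ∧ j < w⁻¹ a)

theorem IsNormalForm.one : IsNormalForm (1 : Equiv.Perm (Fin n)) (1 : Matrix (Fin n) (Fin n) F) := by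
  refine ⟨fun a => by rw [inv_one, Equiv.Perm.one_apply, Matrix.one_apply_eq], fun a j h => ?_⟩
  left
  rw [inv_one, Equiv.Perm.one_apply]
  by_contra hne
  exact h (Matrix.one_apply_ne (Ne.symm hne))

/-- The matrix c(x) replaces row i + 1 by row i, and row i by row i + 1 plus x times row i. The
pivots are exchanged, and the new entries stay left of the pivot of their row and above that of
their column. -/
theorem IsNormalForm.curve {u : Equiv.Perm (Fin n)} {i : Fin (n - 1)}
    (hu : u⁻¹ (loPt i) < u⁻¹ (hiPt i)) {h : Matrix (Fin n) (Fin n) F} (hh : IsNormalForm u h)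
    (x : F) : IsNormalForm (simpleSwap n i * u) ((curveGL i x).1 * h) := by
  change IsNormalForm (simpleSwap n i * u) (blockMat i x 1 1 0 * h)
  obtain ⟨h1, h2⟩ := hh
  have hlh := loPt_lt_hiPt i
  have hinv : ∀ {j a}, u j = a → j = u⁻¹ a := by
    rintro j a rfl
    rw [← Equiv.Perm.mul_apply, inv_mul_cancel, Equiv.Perm.one_apply]
  have hlo : ∀ j, h (loPt i) j ≠ 0 → j ≠ u⁻¹ (loPt i) →
      hiPt i < (simpleSwap n i * u) j ∧ j < u⁻¹ (loPt i) := by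
    intro j hj hne
    obtain ⟨h3, h4⟩ := (h2 _ j hj).resolve_left hne
    have h5 : u j ≠ hiPt i := fun e => (h4.trans hu).ne (hinv e)
    have h6 : hiPt i < u j := by
      simp only [Fin.lt_def, ne_eq, Fin.ext_iff, loPt_val, hiPt_val] at h3 h5 ⊢
      omega
    rw [Equiv.Perm.mul_apply, simpleSwap_of_ne i h3.ne' h5]
    exact ⟨h6, h4⟩
  refine ⟨fun a => ?_, fun a j hj => ?_⟩
  · by_cases ha : a = loPt i
    · subst ha
      rw [simpleSwap_mul_inv_lo, blockMat_mul_lo, one_mul, h1]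
      have : h (loPt i) (u⁻¹ (hiPt i)) = 0 := by
        by_contra h0
        exact absurd (hlo _ h0 hu.ne').2 hu.not_gt
      rw [this, mul_zero, zero_add]
    · by_cases ha' : a = hiPt i
      · subst ha'
        rw [simpleSwap_mul_inv_hi, blockMat_mul_hi, one_mul, zero_mul, add_zero, h1]
      · rw [simpleSwap_mul_inv_of_ne i u ha ha', blockMat_mul_of_ne _ _ _ _ _ _ _ ha ha', h1]
  · by_cases ha : a = loPt i
    · subst ha
      rw [blockMat_mul_lo, one_mul] at hj
      rw [simpleSwap_mul_inv_lo]
      by_cases h3 : h (loPt i) j = 0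
      · rw [h3, mul_zero, zero_add] at hj
        refine (h2 _ j hj).imp id fun ⟨h4, h5⟩ => ⟨?_, h5⟩
        rw [Equiv.Perm.mul_apply, simpleSwap_of_ne i (hlh.trans h4).ne' h4.ne']
        exact hlh.trans h4
      · right
        by_cases h4 : j = u⁻¹ (loPt i)
        · refine ⟨?_, h4 ▸ hu⟩
          rw [h4, Equiv.Perm.mul_apply, ← Equiv.Perm.mul_apply u, mul_inv_cancel,
            Equiv.Perm.one_apply, simpleSwap_lo]
          exact hlh
        · obtain ⟨h5, h6⟩ := hlo j h3 h4
          exact ⟨hlh.trans h5, h6.trans hu⟩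
    · by_cases ha' : a = hiPt i
      · subst ha'
        rw [blockMat_mul_hi, one_mul, zero_mul, add_zero] at hj
        rw [simpleSwap_mul_inv_hi]
        by_cases h4 : j = u⁻¹ (loPt i)
        · exact Or.inl h4
        · exact Or.inr (hlo j hj h4)
      · rw [blockMat_mul_of_ne _ _ _ _ _ _ _ ha ha'] at hj
        rw [simpleSwap_mul_inv_of_ne i u ha ha']
        refine (h2 a j hj).imp id fun ⟨h3, h4⟩ => ⟨?_, h4⟩
        rw [Equiv.Perm.mul_apply, ← simpleSwap_of_ne i ha ha']
        rwa [simpleSwap_lt_iff i (fun h => ha h.1) (fun h => ha' h.1)]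

/-- Uses the condition a < w j. The other half of the definition, j < w⁻¹ a, makes w⁻¹h lower
unitriangular in `IsNormalForm.permMat_mul`. -/
theorem IsNormalForm.mul_permMat {w : Equiv.Perm (Fin n)} {h : Matrix (Fin n) (Fin n) F}
    (hh : IsNormalForm w h) :
    (h * permMat F w⁻¹).BlockTriangular id ∧ ∀ a, (h * permMat F w⁻¹) a a = 1 := by
  refine ⟨fun a b hab => ?_, fun a => by rw [mul_permMat_apply, hh.1]⟩
  rw [mul_permMat_apply]
  by_contra h0
  rcases hh.2 _ _ h0 with h1 | ⟨h1, -⟩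
  · exact (show b < a from hab).ne (w⁻¹.injective h1)
  · rw [← Equiv.Perm.mul_apply, mul_inv_cancel, Equiv.Perm.one_apply] at h1
    exact absurd h1 (not_lt.2 (le_of_lt hab))

theorem IsNormalForm.det_ne_zero {w : Equiv.Perm (Fin n)} {h : Matrix (Fin n) (Fin n) F}
    (hh : IsNormalForm w h) : h.det ≠ 0 := by
  intro h0
  have h1 := Matrix.det_of_isUpperTriangular hh.mul_permMat.1
  rw [Matrix.det_mul, h0, zero_mul, Finset.prod_congr rfl fun a _ => hh.mul_permMat.2 a,
    Finset.prod_const_one] at h1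
  exact zero_ne_one h1

theorem IsNormalForm.mem_upCell {w : Equiv.Perm (Fin n)} {g : Matrix.GeneralLinearGroup (Fin n) F}
    (hg : IsNormalForm w g.1) : g ∈ UpCell F w := by
  refine ⟨g * permGL F w⁻¹, hg.mul_permMat.1, 1, one_mem _, ?_⟩
  rw [mul_one, mul_assoc, ← permGL_mul, inv_mul_cancel, permGL_one, mul_one]

/-- The line coordinate is peeled off at each descent; multiplying back by c(d) preserves normal
forms. -/
theorem exists_isNormalForm (w : Equiv.Perm (Fin n)) : ∀ {g : Matrix.GeneralLinearGroup (Fin n) F},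
    g ∈ UpCell F w → ∃ b ∈ upperBorel n F, IsNormalForm w (g * b).1 := by
  induction hl : permLength w using Nat.strong_induction_on generalizing w with
  | _ l ih =>
  intro g hg
  by_cases hw : w = 1
  · subst hw
    obtain ⟨b, hb, b', hb', rfl⟩ := hg
    refine ⟨(b * permGL F 1 * b')⁻¹, ?_, ?_⟩
    · rw [permGL_one, mul_one]
      exact inv_mem (mul_mem hb hb')
    · rw [mul_inv_cancel]
      exact IsNormalForm.one
  · obtain ⟨i, hi⟩ := exists_descent hw
    obtain ⟨u, rfl⟩ : ∃ u, w = simpleSwap n i * u := ⟨_, (simpleSwap_mul_cancel i w).symm⟩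
    rw [simpleSwap_mul_inv_lo, simpleSwap_mul_inv_hi] at hi
    have hlu := permLength_simpleSwap_mul_of_lt hi
    obtain ⟨d, hd⟩ := exists_curveGL_inv_mul_mem_upCell hi hg
    obtain ⟨b, hb, hn⟩ := ih _ (by omega) u rfl ((hd d).2 rfl)
    refine ⟨b, hb, ?_⟩
    have := hn.curve hi d
    rwa [← Units.val_mul, ← mul_assoc, mul_inv_cancel_left] at this

theorem IsNormalForm.permMat_mul {w : Equiv.Perm (Fin n)} {h : Matrix (Fin n) (Fin n) F}
    (hh : IsNormalForm w h) :
    (permMat F w⁻¹ * h).BlockTriangular OrderDual.toDual ∧ ∀ a, (permMat F w⁻¹ * h) a a = 1 := by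
  have key : ∀ a b, (permMat F w⁻¹ * h) a b = h (w a) b := by
    intro a b
    have := permMat_mul_apply h w⁻¹ (w a) b
    rwa [← Equiv.Perm.mul_apply, inv_mul_cancel, Equiv.Perm.one_apply] at this
  have hinv : ∀ a, w⁻¹ (w a) = a := fun a => by
    rw [← Equiv.Perm.mul_apply, inv_mul_cancel, Equiv.Perm.one_apply]
  refine ⟨fun a b hab => ?_, fun a => ?_⟩
  · rw [key]
    by_contra h0
    have hab' : a < b := hab
    rcases hh.2 _ _ h0 with h1 | ⟨-, h1⟩
    · rw [hinv] at h1; exact hab'.ne h1.symm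
    · rw [hinv] at h1; exact absurd h1 hab'.not_gt
  · have := hh.1 (w a)
    rwa [hinv, ← key] at this

/-- The quotient g⁻¹h is upper triangular because the cosets agree, and lower triangular because
w⁻¹g and w⁻¹h are. So it is diagonal, and the unit diagonals make it the identity. -/
theorem IsNormalForm.unique {w : Equiv.Perm (Fin n)} {g h : Matrix.GeneralLinearGroup (Fin n) F}
    (hg : IsNormalForm w g.1) (hh : IsNormalForm w h.1)
    (he : (g : Matrix.GeneralLinearGroup (Fin n) F ⧸ upperBorel n F) = h) : g = h := by
  have hb : g⁻¹ * h ∈ upperBorel n F := QuotientGroup.eq.1 he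
  set b := g⁻¹ * h with hbdef
  have hgb : h = g * b := by rw [hbdef, mul_inv_cancel_left]
  obtain ⟨h1, h2⟩ := hg.permMat_mul
  obtain ⟨h3, h4⟩ := hh.permMat_mul
  have hgl : permGL F w⁻¹ * g ∈ lowerSubgroup n F := mem_lowerSubgroup.2 h1
  have hhl : permGL F w⁻¹ * h ∈ lowerSubgroup n F := mem_lowerSubgroup.2 h3
  have hbl : b ∈ lowerSubgroup n F := by
    have : b = (permGL F w⁻¹ * g)⁻¹ * (permGL F w⁻¹ * h) := by rw [hbdef]; group
    rw [this]
    exact mul_mem (inv_mem hgl) hhl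
  have hoff : ∀ i j, i ≠ j → b.1 i j = 0 := by
    intro i j hij
    rcases lt_or_gt_of_ne hij with hlt | hlt
    · exact hbl _ _ hlt
    · exact hb hlt
  have hone : b = 1 := by
    refine Units.ext ?_
    ext i j
    change b.1 i j = (1 : Matrix (Fin n) (Fin n) F) i j
    by_cases hij : i = j
    · subst hij
      have h5 : (permMat F w⁻¹ * h.1) i i = (permMat F w⁻¹ * g.1) i i * b.1 i i := by
        rw [hgb, Units.val_mul, ← mul_assoc, Matrix.mul_apply, Finset.sum_eq_single i]
        · intro x _ hx
          rw [hoff x i hx, mul_zero]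
        · intro hx; exact absurd (Finset.mem_univ _) hx
      rw [h2, h4, one_mul] at h5
      rw [← h5, Matrix.one_apply_eq]
    · rw [hoff i j hij, Matrix.one_apply_ne hij]
  rw [hgb, hone, mul_one]

/-- At w = 1 the element lies in the Borel subgroup. Each factor c(d) preserves the union of two
opposite cells that differ by s. -/
theorem exists_mem_lowCell_of_mem_upCell (w : Equiv.Perm (Fin n)) :
    ∀ {g : Matrix.GeneralLinearGroup (Fin n) F}, g ∈ UpCell F w → ∃ v, g ∈ LowCell F v := by
  induction hl : permLength w using Nat.strong_induction_on generalizing w with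
  | _ l ih =>
  intro g hg
  by_cases hw : w = 1
  · subst hw
    obtain ⟨b, hb, b', hb', rfl⟩ := hg
    refine ⟨1, 1, one_mem _, b * b', mul_mem hb hb', ?_⟩
    rw [permGL_one, mul_one, one_mul, one_mul]
  · obtain ⟨i, hi⟩ := exists_descent hw
    obtain ⟨u, rfl⟩ : ∃ u, w = simpleSwap n i * u := ⟨_, (simpleSwap_mul_cancel i w).symm⟩
    rw [simpleSwap_mul_inv_lo, simpleSwap_mul_inv_hi] at hi
    have hlu := permLength_simpleSwap_mul_of_lt hi
    obtain ⟨d, hd⟩ := exists_curveGL_inv_mul_mem_upCell hi hg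
    obtain ⟨v, hv⟩ := ih _ (by omega) u rfl ((hd d).2 rfl)
    have key : ∀ x : Equiv.Perm (Fin n), x⁻¹ (loPt i) < x⁻¹ (hiPt i) →
        (curveGL i d)⁻¹ * g ∈ LowCell F x ∨ (curveGL i d)⁻¹ * g ∈ LowCell F (simpleSwap n i * x) →
        ∃ v, g ∈ LowCell F v := by
      intro x hx hm
      have := blockGL_mul_mem_lowCell_or (p := d) (q := 1) (r := 1) (t := 0) hx (by simp) hm
      change curveGL i d * _ ∈ _ ∨ curveGL i d * _ ∈ _ at this
      rw [mul_inv_cancel_left] at this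
      exact this.elim (fun h => ⟨_, h⟩) (fun h => ⟨_, h⟩)
    rcases inv_lo_lt_or v i with hv' | hv'
    · exact key v hv' (Or.inl hv)
    · refine key (simpleSwap n i * v) ?_ (Or.inr ?_)
      · rwa [simpleSwap_mul_inv_lo, simpleSwap_mul_inv_hi]
      · rwa [simpleSwap_mul_cancel]

/-- The normal forms which lie in an opposite Schubert cell. -/
def normalForms (F : Type*) [Field F] {n : ℕ} (v w : Equiv.Perm (Fin n)) :
    Set (Matrix.GeneralLinearGroup (Fin n) F) :=
  {g | IsNormalForm w g.1 ∧ g ∈ LowCell F v}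

theorem card_normalForms (v w : Equiv.Perm (Fin n)) :
    Nat.card (normalForms F v w) = Nat.card (richardson F v w) := by
  refine Nat.card_congr (Equiv.ofBijective
    (fun g => ⟨g.1, mk_mem_richardson.2 ⟨g.2.1.mem_upCell, g.2.2⟩⟩) ⟨?_, ?_⟩)
  · intro g h hgh
    exact Subtype.ext (g.2.1.unique h.2.1 (congrArg Subtype.val hgh))
  · rintro ⟨y, hy⟩
    obtain ⟨g, rfl⟩ := QuotientGroup.mk_surjective y
    obtain ⟨h1, h2⟩ := mk_mem_richardson.1 hy
    obtain ⟨b, hb, hn⟩ := exists_isNormalForm w h1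
    refine ⟨⟨g * b, hn, LowCell.mul_right h2 hb⟩, Subtype.ext ?_⟩
    exact (QuotientGroup.eq.2 (by rwa [inv_mul_cancel_left])).symm

/-- In the opposite Schubert cell of `v`, the column `j` can be changed by multiples of the columns
before it in such a way that its first nonzero entry is in the row `v j`. -/
theorem LowCell.exists_column {v : Equiv.Perm (Fin n)} {g : Matrix.GeneralLinearGroup (Fin n) F}
    (hg : g ∈ LowCell F v) (j : Fin n) : ∃ c : Fin n → F, (∀ x, j < x → c x = 0) ∧
      (∀ a, a < v j → (g.1.mulVec c) a = 0) ∧ (g.1.mulVec c) (v j) ≠ 0 := by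
  obtain ⟨l, hl, b, hb, rfl⟩ := hg
  have hb' : b⁻¹ ∈ upperBorel n F := inv_mem hb
  -- The combination is column j of b⁻¹: it carries l v b to column j of l v, which is the column v
  -- j of the lower triangular l.
  have key : ∀ a, ((l * permGL F v * b).1.mulVec fun x => (b⁻¹).1 x j) a = l.1 a (v j) := by
    intro a
    have h1 : ((l * permGL F v * b).1 * (b⁻¹).1) a j = l.1 a (v j) := by
      rw [← Units.val_mul, mul_inv_cancel_right, Units.val_mul]
      exact mul_permMat_apply l.1 v a j
    rw [← h1]
    rfl
  refine ⟨fun x => (b⁻¹).1 x j, fun x hx => hb' hx, fun a ha => ?_, ?_⟩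
  · rw [key]; exact hl _ _ ha
  · rw [key]; exact lower_diag_ne_zero hl _

end NormalForm

/-! ### Bounded affine permutations -/

section Grassmannian

variable {n k : ℕ}

/-- A Grassmannian permutation is the one which sorts the points according to whether they are sent
to the first block. -/
theorem isGrassmannian_iff_sort (p : Fin n → Prop) [DecidablePred p]
    (hp : (Finset.univ.filter p).card = k) (w : Equiv.Perm (Fin n)) :
    (IsGrassmannian k w ∧ ∀ r, (w r).1 < k ↔ p r)
      ↔ w⁻¹ = Tuple.sort fun r => if p r then 0 else 1 := by
  have hinv : ∀ j, w (w⁻¹ j) = j := fun j => by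
    rw [← Equiv.Perm.mul_apply, mul_inv_cancel, Equiv.Perm.one_apply]
  have hinv' : ∀ j, w⁻¹ (w j) = j := fun j => by
    rw [← Equiv.Perm.mul_apply, inv_mul_cancel, Equiv.Perm.one_apply]
  set g : Fin n → ℕ := fun r => if p r then 0 else 1 with hg
  constructor
  · rintro ⟨h1, h2⟩
    have hgw : ∀ j, g (w⁻¹ j) = if j.1 < k then 0 else 1 := by
      intro j
      rw [hg]
      refine if_congr ?_ rfl rfl
      rw [← h2, hinv]
    rw [Tuple.eq_sort_iff]
    refine ⟨fun i j hij => ?_, fun i j hij he => ?_⟩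
    · rw [Function.comp_apply, Function.comp_apply, hgw, hgw]
      have : i.1 ≤ j.1 := hij
      split_ifs <;> omega
    · rw [hgw, hgw] at he
      refine h1 i j hij ?_
      split_ifs at he <;> omega
  · intro h
    have h' := h
    rw [Tuple.eq_sort_iff] at h
    obtain ⟨h1, h2⟩ := h
    have hk : ∀ j : Fin n, j.1 < k ↔ p (w⁻¹ j) := by
      intro j
      have hmono : ∀ i j : Fin n, i ≤ j → p (w⁻¹ j) → p (w⁻¹ i) := by
        intro i j hij hj
        by_contra hi
        have h3 : g (w⁻¹ i) ≤ g (w⁻¹ j) := h1 hij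
        rw [hg] at h3
        simp only [if_pos hj, if_neg hi] at h3
        omega
      -- The set of these i is closed downwards, so its cardinality k determines it.
      have hc : (Finset.univ.filter fun i => p (w⁻¹ i)).card = k := by
        rw [← hp]
        exact Finset.card_equiv w⁻¹ fun i => by simp only [Finset.mem_filter, Finset.mem_univ,
          true_and]
      rw [← hc]
      exact Fin.lt_card_filter_univ_iff_apply_of_imp (fun i => p (w⁻¹ i)) (fun i j => hmono j i)
    refine ⟨fun i j hij hb => h2 i j hij ?_, fun r => ?_⟩
    · rw [hg]
      refine if_congr ?_ rfl rfl
      rw [← hk, ← hk]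
      have : i.1 < j.1 := hij
      omega
    · rw [hk, hinv']

theorem IsBoundedAffine.periodic_mul {f : ℤ → ℤ} (hf : IsBoundedAffine k n f) (j c : ℤ) :
    f (j + n * c) = f j + n * c := by
  induction c with
  | zero => rw [mul_zero, add_zero, add_zero]
  | succ c ih =>
    have : j + n * ((c : ℤ) + 1) = j + n * c + n := by ring
    rw [this, hf.periodic, ih]; ring
  | pred c ih =>
    have : j + n * (-(c : ℤ)) = j + n * (-(c : ℤ) - 1) + n := by ring
    rw [this, hf.periodic] at ih
    linear_combination ih

end Grassmannian

/-! ### The pair (v, w) of a bounded affine permutation -/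

section Affine

variable {n : ℕ} [NeZero n]

theorem residue_val (j : ℤ) : ((residue n j).1 : ℤ) = j % n := by
  have hn : (0 : ℤ) < n := by exact_mod_cast NeZero.pos n
  exact Int.toNat_of_nonneg (Int.emod_nonneg j hn.ne')

theorem residue_natCast (r : Fin n) : residue n (r.1 : ℤ) = r := by
  apply Fin.ext
  have := residue_val (n := n) (r.1 : ℤ)
  rw [Int.emod_eq_of_lt (by omega) (by exact_mod_cast r.2)] at this
  exact_mod_cast this

theorem residue_add_mul (j c : ℤ) : residue n (j + n * c) = residue n j := by
  apply Fin.ext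
  have h1 := residue_val (n := n) (j + n * c)
  rw [Int.add_mul_emod_self_left, ← residue_val] at h1
  exact_mod_cast h1

theorem exists_eq_add_mul (n : ℕ) [NeZero n] (j : ℤ) : ∃ (r : Fin n) (c : ℤ), j = r.1 + n * c :=
  ⟨residue n j, j / n, by rw [residue_val, Int.emod_add_mul_ediv]⟩

theorem eq_of_add_mul_eq {r s : Fin n} {c d : ℤ} (h : (r.1 : ℤ) + n * c = s.1 + n * d) :
    r = s := by
  have := congrArg (residue n) h
  rwa [residue_add_mul, residue_add_mul, residue_natCast, residue_natCast] at this

theorem affineExt_apply (u : Equiv.Perm (Fin n)) (r : Fin n) (c : ℤ) :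
    affineExt u (r.1 + n * c) = (u r).1 + n * c := by
  have hn : (0 : ℤ) < n := by exact_mod_cast NeZero.pos n
  rw [affineExt, residue_add_mul, residue_natCast, Int.add_mul_ediv_left _ _ hn.ne',
    Int.ediv_eq_zero_of_lt (by omega) (by exact_mod_cast r.2)]
  ring

/-- The value of `f_{v,w}`. -/
theorem affine_apply (k : ℕ) (v w : Equiv.Perm (Fin n)) (r : Fin n) (c : ℤ) :
    (affineExt v⁻¹ ∘ tauAffine k n ∘ affineExt w) (r.1 + n * c)
      = (v⁻¹ (w r)).1 + (if (w r).1 < k then (n : ℤ) else 0) + n * c := by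
  rw [Function.comp_apply, Function.comp_apply, affineExt_apply, tauAffine, residue_add_mul,
    residue_natCast]
  split_ifs with h
  · have : ((w r).1 : ℤ) + n * c + n = (w r).1 + n * (c + 1) := by ring
    rw [this, affineExt_apply]; ring
  · rw [affineExt_apply]; ring

theorem affine_apply_fin (k : ℕ) (v w : Equiv.Perm (Fin n)) (r : Fin n) :
    (affineExt v⁻¹ ∘ tauAffine k n ∘ affineExt w) r.1
      = (v⁻¹ (w r)).1 + (if (w r).1 < k then (n : ℤ) else 0) := by
  have := affine_apply k v w r 0
  rwa [mul_zero, add_zero, add_zero] at this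

theorem affine_periodic (k : ℕ) (v w : Equiv.Perm (Fin n)) (j c : ℤ) :
    (affineExt v⁻¹ ∘ tauAffine k n ∘ affineExt w) (j + n * c)
      = (affineExt v⁻¹ ∘ tauAffine k n ∘ affineExt w) j + n * c := by
  obtain ⟨r, d, rfl⟩ := exists_eq_add_mul n j
  have : (r.1 : ℤ) + n * d + n * c = r.1 + n * (d + c) := by ring
  rw [this, affine_apply, affine_apply]; ring

variable {k : ℕ}

theorem IsBoundedAffine.apply_fin {f : ℤ → ℤ} (hf : IsBoundedAffine k n f) (r : Fin n) :
    f r.1 = (residue n (f r.1)).1 + if (n : ℤ) ≤ f r.1 then (n : ℤ) else 0 := by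
  have h1 := hf.le r.1
  have h2 := hf.le_add r.1
  have h3 := r.2
  rw [residue_val]
  split_ifs with h
  · have : f r.1 = (f r.1 - n) + n * 1 := by ring
    rw [this, Int.add_mul_emod_self_left, Int.emod_eq_of_lt (by omega) (by omega)]
    ring
  · rw [Int.emod_eq_of_lt (by omega) (by omega), add_zero]

theorem IsBoundedAffine.residue_injective {f : ℤ → ℤ} (hf : IsBoundedAffine k n f) :
    Function.Injective fun r : Fin n => residue n (f r.1) := by
  intro r s h
  obtain ⟨a, c, hc⟩ := exists_eq_add_mul n (f r.1)
  obtain ⟨b, d, hd⟩ := exists_eq_add_mul n (f s.1)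
  have hab : a = b := by
    have h' : residue n (f r.1) = residue n (f s.1) := h
    rwa [hc, hd, residue_add_mul, residue_add_mul, residue_natCast, residue_natCast] at h'
  subst hab
  have h1 : f (r.1 + n * d) = f (s.1 + n * c) := by
    rw [hf.periodic_mul, hf.periodic_mul, hc, hd]; ring
  exact eq_of_add_mul_eq (hf.bijective.1 h1)

/-- The permutation of the residues which is induced by a bounded affine permutation. -/
noncomputable def IsBoundedAffine.residuePerm {f : ℤ → ℤ} (hf : IsBoundedAffine k n f) :
    Equiv.Perm (Fin n) :=
  Equiv.ofBijective _ (Finite.injective_iff_bijective.1 hf.residue_injective)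

theorem IsBoundedAffine.residuePerm_apply {f : ℤ → ℤ} (hf : IsBoundedAffine k n f) (r : Fin n) :
    hf.residuePerm r = residue n (f r.1) := rfl

/-- On one period f(r) is a residue plus n or 0, and the residues are permuted. So the sum of f(r) -
r is n times the number of r with f(r) ≥ n. -/
theorem IsBoundedAffine.card_eq {f : ℤ → ℤ} (hf : IsBoundedAffine k n f) :
    (Finset.univ.filter fun r : Fin n => (n : ℤ) ≤ f r.1).card = k := by
  have hn : (0 : ℤ) < n := by exact_mod_cast NeZero.pos n
  have h1 := hf.sum_eq
  rw [Finset.sum_range (f := fun j : ℕ => f j - j), Finset.sum_sub_distrib,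
    Finset.sum_congr rfl fun r _ => hf.apply_fin r, Finset.sum_add_distrib,
    ← Finset.sum_filter, Finset.sum_const, nsmul_eq_mul] at h1
  have h2 : ∑ r : Fin n, ((residue n (f r.1)).1 : ℤ) = ∑ r : Fin n, (r.1 : ℤ) :=
    Equiv.sum_comp hf.residuePerm fun r : Fin n => (r.1 : ℤ)
  rw [h2, add_sub_cancel_left] at h1
  exact_mod_cast mul_right_cancel₀ hn.ne' h1

theorem affine_lt_iff {f : ℤ → ℤ} {v w : Equiv.Perm (Fin n)}
    (h : f = affineExt v⁻¹ ∘ tauAffine k n ∘ affineExt w) (r : Fin n) :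
    (w r).1 < k ↔ (n : ℤ) ≤ f r.1 := by
  rw [h, affine_apply_fin]
  have := (v⁻¹ (w r)).2
  split_ifs with hr <;> omega

/-- The bounds on f say v⁻¹x ≤ w⁻¹x on the first k points and the reverse on the others. The rank
criterion follows by inclusion for a ≤ k, and by passing to the complementary points for a > k. -/
theorem bruhatLE_of_affine {f : ℤ → ℤ} (hf : IsBoundedAffine k n f) {v w : Equiv.Perm (Fin n)}
    (h : f = affineExt v⁻¹ ∘ tauAffine k n ∘ affineExt w) : BruhatLE v w := by
  have hinv : ∀ j, w (w⁻¹ j) = j := fun j => by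
    rw [← Equiv.Perm.mul_apply, mul_inv_cancel, Equiv.Perm.one_apply]
  have key : ∀ x, f (w⁻¹ x).1 = (v⁻¹ x).1 + if x.1 < k then (n : ℤ) else 0 := by
    intro x
    rw [h, affine_apply_fin, hinv]
  have h1 : ∀ x : Fin n, x.1 < k → (v⁻¹ x).1 ≤ (w⁻¹ x).1 := by
    intro x hx
    have := hf.le_add (w⁻¹ x).1
    rw [key, if_pos hx] at this
    omega
  have h2 : ∀ x : Fin n, k ≤ x.1 → (w⁻¹ x).1 ≤ (v⁻¹ x).1 := by
    intro x hx
    have := hf.le (w⁻¹ x).1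
    rw [key, if_neg (not_lt.2 hx)] at this
    omega
  refine bruhatLE_of_permRank_le w v fun a j => ?_
  rcases le_or_gt a k with ha | ha
  · refine Finset.card_le_card fun x hx => ?_
    simp only [Finset.mem_filter, Finset.mem_univ, true_and] at hx ⊢
    exact ⟨hx.1, (h1 x (by omega)).trans_lt hx.2⟩
  · have hsum : ∀ u : Equiv.Perm (Fin n), permRank u a j
        + (Finset.univ.filter fun x : Fin n => a ≤ x.1 ∧ (u⁻¹ x).1 < j).card
        = (Finset.univ.filter fun x : Fin n => x.1 < j).card := by
      intro u
      have h3 : (Finset.univ.filter fun x : Fin n => (u⁻¹ x).1 < j).card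
          = (Finset.univ.filter fun x : Fin n => x.1 < j).card :=
        Finset.card_equiv u⁻¹ fun i => by simp only [Finset.mem_filter, Finset.mem_univ, true_and]
      have h4 := Finset.card_filter_add_card_filter_not
        (s := Finset.univ.filter fun x : Fin n => (u⁻¹ x).1 < j) (fun x : Fin n => x.1 < a)
      rw [← h3, ← h4, permRank, Finset.filter_filter, Finset.filter_filter]
      refine congrArg₂ (· + ·) (congrArg Finset.card ?_) (congrArg Finset.card ?_) <;>
        (ext x; simp only [Finset.mem_filter, Finset.mem_univ, true_and, not_lt]; tauto)
    have h3 := hsum v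
    have h4 := hsum w
    have h5 : (Finset.univ.filter fun x : Fin n => a ≤ x.1 ∧ (v⁻¹ x).1 < j).card
        ≤ (Finset.univ.filter fun x : Fin n => a ≤ x.1 ∧ (w⁻¹ x).1 < j).card := by
      refine Finset.card_le_card fun x hx => ?_
      simp only [Finset.mem_filter, Finset.mem_univ, true_and] at hx ⊢
      exact ⟨hx.1, (h2 x (by omega)).trans_lt hx.2⟩
    omega

theorem affine_left_injective (w : Equiv.Perm (Fin n)) {v v' : Equiv.Perm (Fin n)}
    (h : affineExt v⁻¹ ∘ tauAffine k n ∘ affineExt w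
      = affineExt v'⁻¹ ∘ tauAffine k n ∘ affineExt w) : v = v' := by
  rw [← inv_inj]
  ext x
  have h1 := congrFun h (w⁻¹ x).1
  rw [affine_apply_fin, affine_apply_fin, add_left_inj, ← Equiv.Perm.mul_apply w, mul_inv_cancel,
    Equiv.Perm.one_apply] at h1
  exact_mod_cast h1

/-- A bounded affine permutation is `f_{v,w}` for exactly one pair `v ≤ w` with `w`
Grassmannian. -/
theorem IsBoundedAffine.existsUnique {f : ℤ → ℤ} (hf : IsBoundedAffine k n f) :
    ∃! p : Equiv.Perm (Fin n) × Equiv.Perm (Fin n), IsAffineOf k f p.1 p.2 := by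
  classical
  obtain ⟨w, hw⟩ : ∃ w : Equiv.Perm (Fin n),
      w = (Tuple.sort fun r : Fin n => if (n : ℤ) ≤ f r.1 then 0 else 1)⁻¹ := ⟨_, rfl⟩
  obtain ⟨hgr, hlt⟩ := (isGrassmannian_iff_sort (fun r : Fin n => (n : ℤ) ≤ f r.1) hf.card_eq w).2
    (by rw [hw, inv_inv])
  -- The set of r with f(r) ≥ n forces w. Modulo n the equation for f reads v⁻¹w = `hf.residuePerm`,
  -- which forces v.
  have heq : f = affineExt (w * hf.residuePerm⁻¹)⁻¹ ∘ tauAffine k n ∘ affineExt w := by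
    funext j
    obtain ⟨r, c, rfl⟩ := exists_eq_add_mul n j
    rw [hf.periodic_mul, affine_apply, hf.apply_fin, mul_inv_rev, inv_inv, ← Equiv.Perm.mul_apply,
      inv_mul_cancel_right, hf.residuePerm_apply]
    simp only [hlt]
  refine ⟨(w * hf.residuePerm⁻¹, w), ⟨bruhatLE_of_affine hf heq, hgr, heq⟩, ?_⟩
  rintro ⟨v', w'⟩ h
  have hw' : w' = w := by
    have := (isGrassmannian_iff_sort (fun r : Fin n => (n : ℤ) ≤ f r.1) hf.card_eq w').1
      ⟨h.grassmannian, fun r => affine_lt_iff h.eq r⟩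
    rw [hw, ← this, inv_inv]
  have he := h.eq
  dsimp only at he
  rw [hw'] at he
  exact Prod.ext (affine_left_injective (k := k) w (he.symm.trans heq)) hw'

/-- Passing from M to M + 1 brings in l = M + 1 and removes the preimage of M + 1 (possibly the same
point), so the number does not depend on M. At M = n - 1 it is `IsBoundedAffine.card_eq`. -/
theorem IsBoundedAffine.card_window {f : ℤ → ℤ} (hf : IsBoundedAffine k n f) (M : ℤ) :
    ((Finset.Ioc (M - n) M).filter fun l => M < f l).card = k := by
  have hn : (0 : ℤ) < n := by exact_mod_cast NeZero.pos n
  have step : ∀ M : ℤ, ((Finset.Ioc (M - n) M).filter fun l => M < f l).card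
      = ((Finset.Ioc (M + 1 - n) (M + 1)).filter fun l => M + 1 < f l).card := by
    intro M
    obtain ⟨x, hx⟩ := hf.bijective.2 (M + 1)
    have hx1 := hf.le x
    have hx2 := hf.le_add x
    have e : insert (M + 1) ((Finset.Ioc (M - n) M).filter fun l => M < f l)
        = insert x ((Finset.Ioc (M + 1 - n) (M + 1)).filter fun l => M + 1 < f l) := by
      ext l
      simp only [Finset.mem_insert, Finset.mem_filter, Finset.mem_Ioc]
      have h1 := hf.le l
      have h2 := hf.le_add l
      have h3 : f l = M + 1 → l = x := fun h => hf.bijective.1 (h.trans hx.symm)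
      have h4 : l = x → f l = M + 1 := fun h => h ▸ hx
      have h5 : l = M + 1 → f l = f (M + 1) := fun h => by rw [h]
      have h6 := hf.le (M + 1)
      constructor
      · rintro (h | h)
        · by_cases hl : l = x
          · exact Or.inl hl
          · have := mt h3 hl; right; omega
        · by_cases hl : l = x
          · exact Or.inl hl
          · have := mt h3 hl; right; omega
      · rintro (h | h)
        · have := h4 h
          by_cases hl : l = M + 1
          · exact Or.inl hl
          · right; omega
        · by_cases hl : l = M + 1
          · exact Or.inl hl
          · right; omega
    have h1 := congrArg Finset.card e
    rw [Finset.card_insert_of_notMem, Finset.card_insert_of_notMem] at h1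
    · omega
    · simp only [Finset.mem_filter, hx]; omega
    · simp only [Finset.mem_filter, Finset.mem_Ioc]; omega
  have base : ((Finset.Ioc ((n : ℤ) - 1 - n) (n - 1)).filter fun l => (n : ℤ) - 1 < f l).card = k := by
    rw [← hf.card_eq]
    symm
    refine Finset.card_bij (fun r _ => (r.1 : ℤ)) ?_ ?_ ?_
    · intro r hr
      simp only [Finset.mem_filter, Finset.mem_univ, true_and, Finset.mem_Ioc] at hr ⊢
      omega
    · intro r _ s _ h
      exact Fin.ext (by exact_mod_cast h)
    · intro l hl
      simp only [Finset.mem_filter, Finset.mem_Ioc] at hl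
      refine ⟨⟨l.toNat, by omega⟩, ?_, ?_⟩
      · simp only [Finset.mem_filter, Finset.mem_univ, true_and]
        rw [Int.toNat_of_nonneg (by omega)]; omega
      · exact Int.toNat_of_nonneg (by omega)
  have h : ∀ c : ℤ, ((Finset.Ioc ((n : ℤ) - 1 + c - n) (n - 1 + c)).filter
      fun l => (n : ℤ) - 1 + c < f l).card = k := by
    intro c
    induction c with
    | zero => rw [add_zero]; exact base
    | succ c ih => rw [step] at ih; rw [← ih]; simp only [add_assoc]
    | pred c ih =>
      rw [step, ← ih]
      have : (n : ℤ) - 1 + (-(c : ℤ) - 1) + 1 = n - 1 + -(c : ℤ) := by ring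
      simp only [this]
  have := h (M - (n - 1))
  have e : (n : ℤ) - 1 + (M - (n - 1)) = M := by ring
  rwa [e] at this

end Affine

/-! ### Points of the open positroid varieties -/

section Columns

variable {F : Type*} {k n : ℕ} [NeZero n]

theorem periodicCol_add_mul (A : Matrix (Fin k) (Fin n) F) (j c : ℤ) :
    periodicCol A (j + n * c) = periodicCol A j := by
  funext r
  rw [periodicCol, periodicCol, residue_add_mul]

theorem periodicCol_fin (A : Matrix (Fin k) (Fin n) F) (x : Fin n) (r : Fin k) :
    periodicCol A x.1 r = A r x := by
  rw [periodicCol, residue_natCast]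

variable [Field F]

/-- The span of the columns `A_{i+1}, …, A_j`. -/
def colSpan (A : Matrix (Fin k) (Fin n) F) (i j : ℤ) : Submodule F (Fin k → F) :=
  Submodule.span F (periodicCol A '' Set.Ioc i j)

theorem periodicCol_mem_colSpan (A : Matrix (Fin k) (Fin n) F) {i j l : ℤ} (h1 : i < l)
    (h2 : l ≤ j) : periodicCol A l ∈ colSpan A i j :=
  Submodule.subset_span ⟨l, ⟨h1, h2⟩, rfl⟩

theorem colSpan_add_mul (A : Matrix (Fin k) (Fin n) F) (i j c : ℤ) :
    colSpan A (i + n * c) (j + n * c) = colSpan A i j := by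
  rw [colSpan, colSpan]
  congr 1
  ext x
  constructor
  · rintro ⟨l, ⟨h1, h2⟩, rfl⟩
    refine ⟨l + n * -c, ⟨by linarith, by linarith⟩, periodicCol_add_mul A l (-c)⟩
  · rintro ⟨l, ⟨h1, h2⟩, rfl⟩
    exact ⟨l + n * c, ⟨by linarith, by linarith⟩, periodicCol_add_mul A l c⟩

theorem finrank_span_periodicCol {A : Matrix (Fin k) (Fin n) F}
    (hA : LinearIndependent F A.row) :
    Module.finrank F (Submodule.span F (Set.range (periodicCol A))) = k := by
  have h1 := hA.rank_matrix
  rw [Matrix.rank_eq_finrank_span_cols, Fintype.card_fin] at h1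
  have e : Set.range (periodicCol A) = Set.range A.col := by
    ext x
    constructor
    · rintro ⟨j, rfl⟩
      exact ⟨residue n j, rfl⟩
    · rintro ⟨r, rfl⟩
      exact ⟨r.1, funext fun a => periodicCol_fin A r a⟩
  rw [e]
  exact h1

/-- The necessary relations between the columns imply the minimality of the bounded affine
permutation. -/
theorem isLeast_of_mem_colSpan {f : ℤ → ℤ} (hf : IsBoundedAffine k n f)
    {A : Matrix (Fin k) (Fin n) F} (hA : LinearIndependent F A.row)
    (h : ∀ i, periodicCol A i ∈ colSpan A i (f i)) (i : ℤ) :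
    IsLeast {j : ℤ | i ≤ j ∧ periodicCol A i ∈ colSpan A i j} (f i) := by
  classical
  have hn : (0 : ℤ) < n := by exact_mod_cast NeZero.pos n
  refine ⟨⟨hf.le i, h i⟩, fun j hj => ?_⟩
  obtain ⟨hij, hmem⟩ := hj
  by_contra hlt
  rw [not_le] at hlt
  have hle := hf.le_add i
  -- The relations express the columns up to j through the k columns in C. A relation for A_i that
  -- ended before f(i) would make i ∈ C superfluous, leaving k - 1 columns to span a space of
  -- dimension k.
  set C := (Finset.Ioc (j - n) j).filter fun l => j < f l with hC
  have hiC : i ∈ C := by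
    rw [hC, Finset.mem_filter, Finset.mem_Ioc]
    omega
  set S := Submodule.span F (((C.erase i).image (periodicCol A) : Finset (Fin k → F)) :
    Set (Fin k → F)) with hS
  have key : ∀ m : ℕ, ∀ l : ℤ, l ≤ j → j - l < m → periodicCol A l ∈ S := by
    intro m
    induction m with
    | zero => intro l h1 h2; omega
    | succ m ih =>
      intro l h1 h2
      have hsub : ∀ j', j' ≤ j → colSpan A l j' ≤ S := by
        intro j' hj'
        refine Submodule.span_le.2 ?_
        rintro _ ⟨x, ⟨hx1, hx2⟩, rfl⟩
        exact ih x (by omega) (by push_cast at h2; omega)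
      by_cases hfl : f l ≤ j
      · exact hsub _ hfl (h l)
      · by_cases hli : l = i
        · subst hli
          exact hsub j le_rfl hmem
        · refine Submodule.subset_span ?_
          rw [Finset.mem_coe]
          refine Finset.mem_image_of_mem _ (Finset.mem_erase.2 ⟨hli, ?_⟩)
          have := hf.le_add l
          rw [hC, Finset.mem_filter, Finset.mem_Ioc]
          omega
  have hall : Submodule.span F (Set.range (periodicCol A)) ≤ S := by
    refine Submodule.span_le.2 ?_
    rintro _ ⟨l, rfl⟩
    rcases le_or_gt l j with hl | hl
    · exact key ((j - l).toNat + 1) l hl (by omega)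
    · have hle : l + n * (-(l - j)) ≤ j := by nlinarith
      rw [← periodicCol_add_mul A l (-(l - j))]
      exact key ((j - (l + n * (-(l - j)))).toNat + 1) _ hle (by omega)
  have h1 := Submodule.finrank_mono hall
  rw [finrank_span_periodicCol hA] at h1
  have h2 : Module.finrank F S ≤ ((C.erase i).image (periodicCol A)).card :=
    finrank_span_finset_le_card _
  have h3 := Finset.card_image_le (s := C.erase i) (f := periodicCol A)
  have hCk : C.card = k := hf.card_window j
  rw [Finset.card_erase_of_mem hiC, hCk] at h3
  have h4 : 0 < k := by
    rw [← hf.card_window j]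
    exact Finset.card_pos.2 ⟨i, hiC⟩
  omega

end Columns

/-! ### Row spans of normal forms for Grassmannian permutations -/

section NormalFormRows

variable {F : Type*} {k n : ℕ}

/-- The first `k` rows of a square matrix. -/
def topRows (hk : k ≤ n) (g : Matrix (Fin n) (Fin n) F) : Matrix (Fin k) (Fin n) F :=
  g.submatrix (Fin.castLE hk) id

theorem topRows_apply (hk : k ≤ n) (g : Matrix (Fin n) (Fin n) F) (a : Fin k) (j : Fin n) :
    topRows hk g a j = g (Fin.castLE hk a) j := rfl

theorem perm_inv_apply_self (w : Equiv.Perm (Fin n)) (j : Fin n) : w⁻¹ (w j) = j := by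
  rw [← Equiv.Perm.mul_apply, inv_mul_cancel, Equiv.Perm.one_apply]

theorem perm_apply_inv_self (w : Equiv.Perm (Fin n)) (j : Fin n) : w (w⁻¹ j) = j := by
  rw [← Equiv.Perm.mul_apply, mul_inv_cancel, Equiv.Perm.one_apply]

theorem IsGrassmannian.inv_lt_iff {w : Equiv.Perm (Fin n)} (hw : IsGrassmannian k w) {i j : Fin n}
    (h : (i.1 < k ∧ j.1 < k) ∨ (k ≤ i.1 ∧ k ≤ j.1)) : w⁻¹ i < w⁻¹ j ↔ i < j := by
  rcases lt_trichotomy i j with hij | hij | hij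
  · exact iff_of_true (hw i j hij (by omega)) hij
  · subst hij; exact iff_of_false (lt_irrefl _) (lt_irrefl _)
  · exact iff_of_false (hw j i hij (by omega)).not_gt hij.not_gt

variable [Field F] {w : Equiv.Perm (Fin n)} {g : Matrix (Fin n) (Fin n) F}

/-- The last rows of the normal forms for a Grassmannian permutation are unit vectors. -/
theorem IsNormalForm.row_of_le (hg : IsNormalForm w g) (hw : IsGrassmannian k w) {a : Fin n}
    (ha : k ≤ a.1) (j : Fin n) : g a j = if j = w⁻¹ a then 1 else 0 := by
  split_ifs with h
  · rw [h, hg.1]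
  · by_contra h0
    obtain ⟨h1, h2⟩ := (hg.2 a j h0).resolve_left h
    have h3 : a.1 < (w j).1 := h1
    have := (hw.inv_lt_iff (i := a) (j := w j) (Or.inr ⟨ha, by omega⟩)).2 h1
    rw [perm_inv_apply_self] at this
    exact absurd h2 this.not_gt

/-- The first rows of the normal forms for a Grassmannian permutation are in echelon form. -/
theorem IsNormalForm.row_of_lt (hg : IsNormalForm w g) (hw : IsGrassmannian k w) {a : Fin n}
    (ha : a.1 < k) {j : Fin n} (hj : g a j ≠ 0) (hne : j ≠ w⁻¹ a) : k ≤ (w j).1 ∧ j < w⁻¹ a := by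
  obtain ⟨h1, h2⟩ := (hg.2 a j hj).resolve_left hne
  refine ⟨?_, h2⟩
  by_contra hlt
  have := (hw.inv_lt_iff (i := a) (j := w j) (Or.inl ⟨ha, by omega⟩)).2 h1
  rw [perm_inv_apply_self] at this
  exact absurd h2 this.not_gt

theorem IsNormalForm.topRows_pivot (hg : IsNormalForm w g) (hw : IsGrassmannian k w) (hk : k ≤ n)
    (a b : Fin k) : topRows hk g a (w⁻¹ (Fin.castLE hk b)) = if a = b then 1 else 0 := by
  rw [topRows_apply]
  split_ifs with h
  · subst h; exact hg.1 _
  · by_contra h0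
    have hne : w⁻¹ (Fin.castLE hk b) ≠ w⁻¹ (Fin.castLE hk a) := fun he =>
      h (Fin.castLE_injective hk (w⁻¹.injective he)).symm
    have := (hg.row_of_lt hw (a := Fin.castLE hk a) a.2 h0 hne).1
    rw [perm_apply_inv_self] at this
    exact absurd b.2 (not_lt.2 this)

theorem IsNormalForm.linearIndependent_topRows (hg : IsNormalForm w g) (hw : IsGrassmannian k w)
    (hk : k ≤ n) : LinearIndependent F (topRows hk g).row := by
  rw [Fintype.linearIndependent_iff]
  intro c hc b
  have := congrFun hc (w⁻¹ (Fin.castLE hk b))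
  rw [Finset.sum_apply, Finset.sum_eq_single b] at this
  · rw [Pi.smul_apply, Matrix.row_apply, hg.topRows_pivot hw, if_pos rfl, smul_eq_mul, mul_one]
      at this
    exact this
  · intro a _ hab
    rw [Pi.smul_apply, Matrix.row_apply, hg.topRows_pivot hw, if_neg hab, smul_zero]
  · intro h; exact absurd (Finset.mem_univ b) h

/-- Uniqueness of the reduced echelon form: the pivot columns read off the coefficients of any row
in terms of the rows of the other matrix. The last n - k rows are the same unit vectors for both. -/
theorem IsNormalForm.eq_of_span_eq {g' : Matrix (Fin n) (Fin n) F} (hg : IsNormalForm w g)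
    (hg' : IsNormalForm w g') (hw : IsGrassmannian k w) (hk : k ≤ n)
    (h : Submodule.span F (Set.range (topRows hk g).row)
      = Submodule.span F (Set.range (topRows hk g').row)) : g = g' := by
  ext a j
  rcases lt_or_ge a.1 k with ha | ha
  · have hmem : (topRows hk g).row ⟨a.1, ha⟩ ∈ Submodule.span F (Set.range (topRows hk g').row) :=
      h ▸ Submodule.subset_span ⟨_, rfl⟩
    obtain ⟨c, hc⟩ := (Submodule.mem_span_range_iff_exists_fun F).1 hmem
    have hcb : ∀ b, c b = if (⟨a.1, ha⟩ : Fin k) = b then 1 else 0 := by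
      intro b
      have h1 := congrFun hc (w⁻¹ (Fin.castLE hk b))
      rw [Matrix.row_apply, hg.topRows_pivot hw, Finset.sum_apply, Finset.sum_eq_single b] at h1
      · rwa [Pi.smul_apply, Matrix.row_apply, hg'.topRows_pivot hw, if_pos rfl, smul_eq_mul,
          mul_one] at h1
      · intro x _ hx
        rw [Pi.smul_apply, Matrix.row_apply, hg'.topRows_pivot hw, if_neg hx, smul_zero]
      · intro hx; exact absurd (Finset.mem_univ b) hx
    have h2 := congrFun hc j
    rw [Finset.sum_apply, Finset.sum_eq_single ⟨a.1, ha⟩] at h2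
    · rw [Pi.smul_apply, hcb, if_pos rfl, one_smul] at h2
      exact h2.symm
    · intro x _ hx
      rw [Pi.smul_apply, hcb, if_neg hx.symm, zero_smul]
    · intro hx; exact absurd (Finset.mem_univ _) hx
  · rw [hg.row_of_le hw ha, hg'.row_of_le hw ha]

variable [NeZero n]

/-- The relations between the columns which come from the opposite Schubert cell. -/
theorem IsNormalForm.mem_colSpan {g : Matrix.GeneralLinearGroup (Fin n) F}
    (hg : IsNormalForm w g.1) (hw : IsGrassmannian k w) (hk : k ≤ n) {v : Equiv.Perm (Fin n)}
    (hv : g ∈ LowCell F v) (i : ℤ) :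
    i ≤ (affineExt v⁻¹ ∘ tauAffine k n ∘ affineExt w) i ∧
      periodicCol (topRows hk g.1) i ∈
        colSpan (topRows hk g.1) i ((affineExt v⁻¹ ∘ tauAffine k n ∘ affineExt w) i) := by
  set A := topRows hk g.1 with hA
  obtain ⟨r, d, rfl⟩ := exists_eq_add_mul n i
  rw [affine_periodic, colSpan_add_mul, periodicCol_add_mul, add_le_add_iff_right,
    affine_apply_fin]
  -- A combination of the columns up to j = v⁻¹(w r) has its first nonzero entry in the row w r; its
  -- first k rows become a relation between the columns of A.
  obtain ⟨c, hc1, hc2, hc3⟩ := LowCell.exists_column hv (v⁻¹ (w r))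
  rw [perm_apply_inv_self] at hc2 hc3
  set j := v⁻¹ (w r) with hj
  have hsum : (∑ x, c x • periodicCol A x.1) = fun a : Fin k => g.1.mulVec c (Fin.castLE hk a) := by
    funext a
    rw [Finset.sum_apply]
    refine Finset.sum_congr rfl fun x _ => ?_
    rw [Pi.smul_apply, periodicCol_fin, smul_eq_mul, mul_comm]
    rfl
  have hcx : ∀ x : Fin n, c x ≠ 0 → x ≤ j := fun x hx => not_lt.1 fun h => hx (hc1 x h)
  split_ifs with hr
  · have hrn := r.2
    refine ⟨by omega, ?_⟩
    have hpiv : ∀ b : Fin k, periodicCol A (w⁻¹ (Fin.castLE hk b)).1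
        = Pi.single b 1 := by
      intro b
      funext a
      rw [periodicCol_fin, hA, hg.topRows_pivot hw, Pi.single_apply]
    -- Expanded in the pivot columns, y involves only rows from w r on, so A_r and pivots to the
    -- right of r, by the Grassmannian condition. Solving for A_r leaves those pivots and the
    -- columns up to j, the latter shifted by n.
    set y : Fin k → F := fun a => g.1.mulVec c (Fin.castLE hk a) with hy
    have hysum : y = ∑ b : Fin k, y b • periodicCol A (w⁻¹ (Fin.castLE hk b)).1 := by
      simp only [hpiv]
      exact pi_eq_sum_univ' y
    set a₀ : Fin k := ⟨(w r).1, hr⟩ with ha₀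
    have hca₀ : Fin.castLE hk a₀ = w r := rfl
    have hya₀ : y a₀ ≠ 0 := hc3
    have hcol : periodicCol A (w⁻¹ (Fin.castLE hk a₀)).1 = periodicCol A r.1 := by
      rw [hca₀, perm_inv_apply_self]
    rw [← Finset.add_sum_erase _ _ (Finset.mem_univ a₀), hcol] at hysum
    have hy2 : y a₀ • periodicCol A r.1 = (∑ x, c x • periodicCol A x.1)
        - ∑ b ∈ Finset.univ.erase a₀, y b • periodicCol A (w⁻¹ (Fin.castLE hk b)).1 := by
      rw [hsum]
      exact eq_sub_of_add_eq hysum.symm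
    rw [← Submodule.smul_mem_iff _ hya₀, hy2]
    refine sub_mem (sum_mem fun x _ => ?_) (sum_mem fun b hb => ?_)
    · by_cases hx : c x = 0
      · rw [hx, zero_smul]; exact zero_mem _
      · refine Submodule.smul_mem _ _ ?_
        have h1 : x.1 ≤ j.1 := hcx x hx
        rw [← periodicCol_add_mul A x.1 1]
        exact periodicCol_mem_colSpan A (by omega) (by omega)
    · by_cases hb0 : y b = 0
      · rw [hb0, zero_smul]; exact zero_mem _
      · refine Submodule.smul_mem _ _ ?_
        have hlt : w r < Fin.castLE hk b := by
          refine lt_of_le_of_ne (not_lt.1 fun h => hb0 (hc2 _ h)) fun he => ?_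
          exact (Finset.mem_erase.1 hb).1 (Fin.castLE_injective hk (he.symm.trans hca₀.symm))
        have h1 := (hw.inv_lt_iff (Or.inl ⟨hr, b.2⟩)).2 hlt
        rw [perm_inv_apply_self] at h1
        have h2 : r.1 < (w⁻¹ (Fin.castLE hk b)).1 := h1
        have h3 := (w⁻¹ (Fin.castLE hk b)).2
        exact periodicCol_mem_colSpan A (by omega) (by omega)
  · rw [not_lt] at hr
    have hlow : ∀ a : Fin n, k ≤ a.1 → g.1.mulVec c a = c (w⁻¹ a) := by
      intro a ha
      rw [Matrix.mulVec, dotProduct, Finset.sum_eq_single (w⁻¹ a)]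
      · rw [hg.1, one_mul]
      · intro x _ hx
        rw [hg.row_of_le hw ha, if_neg hx, zero_mul]
      · intro hx; exact absurd (Finset.mem_univ _) hx
    have hcr : c r ≠ 0 := by
      rw [hlow _ hr, perm_inv_apply_self] at hc3
      exact hc3
    -- For w r ≥ k the first k rows of the combination vanish, which is a relation between the
    -- columns of A. It remains to see that it starts at r: a non-pivot x < r is read off the unit
    -- row w x < w r, and then a pivot x < r off its echelon row, whose other entries lie over
    -- non-pivots left of x.
    have hnp : ∀ x, x < r → k ≤ (w x).1 → c x = 0 := by
      intro x hx hwx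
      have h1 : w x < w r := by
        rw [← hw.inv_lt_iff (Or.inr ⟨hwx, hr⟩), perm_inv_apply_self, perm_inv_apply_self]
        exact hx
      have h2 := hc2 _ h1
      rwa [hlow _ hwx, perm_inv_apply_self] at h2
    have hp : ∀ x, x < r → c x = 0 := by
      intro x hx
      rcases lt_or_ge (w x).1 k with hwx | hwx
      · have h1 : w x < w r := Fin.lt_def.2 (by omega)
        have h2 := hc2 _ h1
        rw [Matrix.mulVec, dotProduct, Finset.sum_eq_single x] at h2
        · have h3 := hg.1 (w x)
          rw [perm_inv_apply_self] at h3
          rwa [h3, one_mul] at h2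
        · intro y _ hy
          by_cases h0 : g.1 (w x) y = 0
          · rw [h0, zero_mul]
          · have h3 := hg.row_of_lt hw hwx h0 (by rwa [perm_inv_apply_self])
            rw [perm_inv_apply_self] at h3
            rw [hnp y (h3.2.trans hx) h3.1, mul_zero]
        · intro h; exact absurd (Finset.mem_univ _) h
      · exact hnp x hx hwx
    have hrj : r.1 ≤ j.1 := hcx r hcr
    refine ⟨by omega, ?_⟩
    rw [add_zero]
    have hzero : (∑ x, c x • periodicCol A x.1) = 0 := by
      rw [hsum]
      funext a
      exact hc2 _ (Fin.lt_def.2 (lt_of_lt_of_le a.2 hr))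
    rw [← Finset.add_sum_erase _ _ (Finset.mem_univ r)] at hzero
    rw [← Submodule.smul_mem_iff _ hcr, eq_neg_of_add_eq_zero_left hzero]
    refine neg_mem (sum_mem fun x hx => ?_)
    by_cases hx0 : c x = 0
    · rw [hx0, zero_smul]; exact zero_mem _
    · refine Submodule.smul_mem _ _ ?_
      have h1 : x.1 ≤ j.1 := hcx x hx0
      have h2 : r.1 ≤ x.1 := not_lt.1 fun h => hx0 (hp x h)
      have h3 : x.1 ≠ r.1 := fun h => (Finset.mem_erase.1 hx).1 (Fin.ext h)
      exact periodicCol_mem_colSpan A (by omega) (by omega)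

end NormalFormRows

/-! ### Counting the points of the open positroid varieties -/

section PositroidCount

variable {k n : ℕ} {F : Type*} [Field F]

theorem span_row_mul_le {m l : ℕ} (M : Matrix (Fin m) (Fin l) F) (N : Matrix (Fin l) (Fin n) F) :
    Submodule.span F (Set.range (M * N).row) ≤ Submodule.span F (Set.range N.row) := by
  refine Submodule.span_le.2 ?_
  rintro _ ⟨a, rfl⟩
  refine (Submodule.mem_span_range_iff_exists_fun F).2 ⟨M a, ?_⟩
  ext j
  rw [Finset.sum_apply, Matrix.row_apply, Matrix.mul_apply]
  rfl

variable [NeZero n]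

/-- Both functions have the same sum over a period, so a pointwise inequality is an equality. -/
theorem eq_of_affine_le {v v' w : Equiv.Perm (Fin n)}
    (h : ∀ r : Fin n, (affineExt v⁻¹ ∘ tauAffine k n ∘ affineExt w) r.1
      ≤ (affineExt v'⁻¹ ∘ tauAffine k n ∘ affineExt w) r.1) : v = v' := by
  have hs : ∀ u : Equiv.Perm (Fin n),
      ∑ r : Fin n, ((u⁻¹ (w r)).1 : ℤ) = ∑ r : Fin n, (r.1 : ℤ) := fun u =>
    Equiv.sum_comp (u⁻¹ * w) fun r : Fin n => (r.1 : ℤ)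
  have hle : ∀ r ∈ Finset.univ, ((v⁻¹ (w r)).1 : ℤ) ≤ ((v'⁻¹ (w r)).1 : ℤ) := by
    intro r _
    have := h r
    rwa [affine_apply_fin, affine_apply_fin, add_le_add_iff_right] at this
  have heq := (Finset.sum_eq_sum_iff_of_le hle).1 ((hs v).trans (hs v').symm)
  rw [← inv_inj]
  ext x
  have := heq (w⁻¹ x) (Finset.mem_univ _)
  rw [perm_apply_inv_self] at this
  exact_mod_cast this

variable {f : ℤ → ℤ} {v w : Equiv.Perm (Fin n)}

theorem IsBoundedAffine.le_card (hf : IsBoundedAffine k n f) : k ≤ n := by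
  rw [← hf.card_eq]
  exact (Finset.card_le_univ _).trans (Fintype.card_fin n).le

theorem IsAffineOf.lt_iff (h : IsAffineOf k f v w) (r : Fin n) : (w r).1 < k ↔ (n : ℤ) ≤ f r.1 :=
  affine_lt_iff h.eq r

/-- The columns `A_i` with `f(i) ≥ n` form a basis. -/
theorem isUnit_pivots (hf : IsBoundedAffine k n f) (h : IsAffineOf k f v w)
    {A : Matrix (Fin k) (Fin n) F} (hA : LinearIndependent F A.row)
    (hmem : ∀ i, periodicCol A i ∈ colSpan A i (f i)) :
    IsUnit (A.submatrix id fun a => w⁻¹ (Fin.castLE hf.le_card a)) := by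
  set B := A.submatrix id fun a => w⁻¹ (Fin.castLE hf.le_card a) with hB
  -- Descending induction on r: if r is not a pivot, then f(r) < n and A_r lies in the span of later
  -- columns of the same period.
  have key : ∀ m : ℕ, ∀ r : Fin n, n - r.1 ≤ m →
      periodicCol A r.1 ∈ Submodule.span F (Set.range B.col) := by
    intro m
    induction m with
    | zero => intro r hr; omega
    | succ m ih =>
      intro r hr
      by_cases hw : (w r).1 < k
      · refine Submodule.subset_span ⟨⟨(w r).1, hw⟩, ?_⟩
        funext a
        rw [periodicCol_fin]
        change A a (w⁻¹ (w r)) = _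
        rw [perm_inv_apply_self]
      · have hlt := mt (h.lt_iff r).2 hw
        have hsub : colSpan A r.1 (f r.1) ≤ Submodule.span F (Set.range B.col) := by
          refine Submodule.span_le.2 ?_
          rintro _ ⟨x, ⟨hx1, hx2⟩, rfl⟩
          have := ih ⟨x.toNat, by omega⟩ (by simp only; omega)
          simp only [Int.toNat_of_nonneg (show 0 ≤ x by omega)] at this
          exact this
        exact hsub (hmem _)
  have hall : Submodule.span F (Set.range (periodicCol A)) ≤ Submodule.span F (Set.range B.col) := by
    refine Submodule.span_le.2 ?_
    rintro _ ⟨l, rfl⟩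
    obtain ⟨r, c, rfl⟩ := exists_eq_add_mul n l
    rw [periodicCol_add_mul]
    exact key n r (by omega)
  have htop : Submodule.span F (Set.range (periodicCol A)) = ⊤ := by
    refine Submodule.eq_top_of_finrank_eq ?_
    rw [finrank_span_periodicCol hA, Module.finrank_fin_fun]
  rw [htop, top_le_iff, ← Matrix.range_mulVecLin, LinearMap.range_eq_top] at hall
  exact Matrix.mulVec_surjective_iff_isUnit.1 hall

/-- Every point of an open positroid variety comes from a normal form. -/
theorem exists_normalForm_of_mem_positroid (hf : IsBoundedAffine k n f) (h : IsAffineOf k f v w)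
    {V : Submodule F (Fin n → F)} (hV : V ∈ positroid F k n f) :
    ∃ g ∈ normalForms F v w, Submodule.span F (Set.range (topRows hf.le_card g.1).row) = V := by
  obtain ⟨A, hA, rfl, hleast⟩ := hV
  have hmem : ∀ i, periodicCol A i ∈ colSpan A i (f i) := fun i => (hleast i).1.2
  obtain ⟨B, hB⟩ := isUnit_pivots hf h hA hmem
  set p : Fin k → Fin n := fun a => w⁻¹ (Fin.castLE hf.le_card a) with hp
  set A' : Matrix (Fin k) (Fin n) F := (B⁻¹).1 * A with hA'
  have hAA' : A = B.1 * A' := by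
    rw [hA', ← Matrix.mul_assoc, ← Units.val_mul, mul_inv_cancel, Units.val_one, Matrix.one_mul]
  have hpiv : ∀ a b, A' a (p b) = if a = b then 1 else 0 := by
    intro a b
    have h1 : A'.submatrix id p = 1 := by
      rw [hA', Matrix.submatrix_mul _ _ id id p Function.bijective_id, ← hB,
        Matrix.submatrix_id_id, ← Units.val_mul, inv_mul_cancel, Units.val_one]
    have h2 := congrFun (congrFun h1 a) b
    rwa [Matrix.one_apply] at h2
  have hcol : ∀ j, periodicCol A' j = (B⁻¹).1.mulVecLin (periodicCol A j) := fun j => rfl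
  have hmem' : ∀ i, periodicCol A' i ∈ colSpan A' i (f i) := by
    intro i
    have h1 := Submodule.mem_map_of_mem (f := (B⁻¹).1.mulVecLin) (hmem i)
    rw [colSpan, Submodule.map_span, ← Set.image_comp] at h1
    exact h1
  -- Descending induction on r again: a non-pivot column is a combination of later columns of the
  -- period, which already vanish in the rows whose pivot is to the left. This gives the echelon
  -- shape.
  have hzero : ∀ m : ℕ, ∀ r : Fin n, n - r.1 ≤ m → ∀ a, p a < r → A' a r = 0 := by
    intro m
    induction m with
    | zero => intro r hr; omega
    | succ m ih =>
      intro r hr a hlt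
      by_cases hw : (w r).1 < k
      · have hr' : r = p ⟨(w r).1, hw⟩ := (perm_inv_apply_self w r).symm
        rw [hr', hpiv, if_neg]
        intro hab
        rw [hr', ← hab] at hlt
        exact lt_irrefl _ hlt
      · have hlt' := mt (h.lt_iff r).2 hw
        have hsub : colSpan A' r.1 (f r.1) ≤ LinearMap.ker (LinearMap.proj (R := F)
            (φ := fun _ : Fin k => F) a) := by
          refine Submodule.span_le.2 ?_
          rintro _ ⟨x, ⟨hx1, hx2⟩, rfl⟩
          have hx := periodicCol_fin A' ⟨x.toNat, by omega⟩ a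
          simp only [Int.toNat_of_nonneg (show 0 ≤ x by omega)] at hx
          rw [SetLike.mem_coe, LinearMap.mem_ker, LinearMap.proj_apply, hx]
          refine ih _ (by simp only; omega) a (hlt.trans ?_)
          rw [Fin.lt_def]
          simp only
          omega
        have h1 := hsub (hmem' r.1)
        rwa [LinearMap.mem_ker, LinearMap.proj_apply, periodicCol_fin] at h1
  -- The echelon matrix is completed by the unit rows that every normal form for a Grassmannian w
  -- has.
  set M : Matrix (Fin n) (Fin n) F := Matrix.of fun a j =>
    if ha : a.1 < k then A' ⟨a.1, ha⟩ j else if j = w⁻¹ a then 1 else 0 with hM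
  have hMlt : ∀ (a : Fin n) (ha : a.1 < k) j, M a j = A' ⟨a.1, ha⟩ j := by
    intro a ha j
    rw [hM, Matrix.of_apply, dif_pos ha]
  have hMge : ∀ (a : Fin n) (_ : ¬ a.1 < k) j, M a j = if j = w⁻¹ a then 1 else 0 := by
    intro a ha j
    rw [hM, Matrix.of_apply, dif_neg ha]
  have hnf : IsNormalForm w M := by
    refine ⟨fun a => ?_, fun a j hj => ?_⟩
    · by_cases ha : a.1 < k
      · rw [hMlt a ha]
        exact (hpiv ⟨a.1, ha⟩ ⟨a.1, ha⟩).trans (if_pos rfl)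
      · rw [hMge a ha, if_pos rfl]
    · by_cases ha : a.1 < k
      · rw [hMlt a ha] at hj
        by_cases hja : j = w⁻¹ a
        · exact Or.inl hja
        · right
          have hge : ¬ (w j).1 < k := by
            intro hw
            have hj' : j = p ⟨(w j).1, hw⟩ := (perm_inv_apply_self w j).symm
            rw [hj', hpiv] at hj
            refine hj (if_neg fun hab => hja ?_)
            have : a = w j := Fin.ext (congrArg (fun x : Fin k => x.1) hab)
            rw [this, perm_inv_apply_self]
          refine ⟨Fin.lt_def.2 (by omega), lt_of_le_of_ne (not_lt.1 fun hlt => ?_) hja⟩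
          exact hj (hzero n j (by omega) ⟨a.1, ha⟩ hlt)
      · rw [hMge a ha] at hj
        left
        by_contra hne
        exact hj (if_neg hne)
  have htopM : topRows hf.le_card M = A' := by
    ext a j
    rw [topRows_apply]
    exact hMlt (Fin.castLE hf.le_card a) a.2 j
  set g := Matrix.GeneralLinearGroup.mkOfDetNeZero M hnf.det_ne_zero with hg
  have hgM : g.1 = M := rfl
  have hgn : IsNormalForm w g.1 := hnf
  obtain ⟨v', hv'⟩ := exists_mem_lowCell_of_mem_upCell w hgn.mem_upCell
  have hLI := hgn.linearIndependent_topRows h.grassmannian hf.le_card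
  rw [hgM, htopM] at hLI
  -- The opposite cell v' of the normal form gives relations that end at f_{v',w}; minimality of f =
  -- f_{v,w} makes it the pointwise smaller one.
  have hvv' : v = v' := by
    refine eq_of_affine_le (k := k) (w := w) fun r => ?_
    have h1 := hgn.mem_colSpan h.grassmannian hf.le_card hv' r.1
    rw [hgM, htopM] at h1
    rw [← h.eq]
    exact (isLeast_of_mem_colSpan hf hLI hmem' r.1).2 h1
  refine ⟨g, ⟨hgn, hvv' ▸ hv'⟩, ?_⟩
  rw [hgM, htopM]
  refine le_antisymm (span_row_mul_le _ _) ?_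
  conv_lhs => rw [hAA']
  exact span_row_mul_le _ _

theorem span_topRows_mem_positroid (hf : IsBoundedAffine k n f) (h : IsAffineOf k f v w)
    {g : Matrix.GeneralLinearGroup (Fin n) F} (hg : g ∈ normalForms F v w) :
    Submodule.span F (Set.range (topRows hf.le_card g.1).row) ∈ positroid F k n f := by
  have hLI := hg.1.linearIndependent_topRows h.grassmannian hf.le_card
  refine ⟨topRows hf.le_card g.1, hLI, rfl, isLeast_of_mem_colSpan hf hLI fun i => ?_⟩
  rw [congrFun h.eq i]
  exact (hg.1.mem_colSpan h.grassmannian hf.le_card hg.2 i).2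

theorem card_positroid (hf : IsBoundedAffine k n f) (h : IsAffineOf k f v w) :
    Nat.card (positroid F k n f) = Nat.card (richardson F v w) := by
  rw [← card_normalForms]
  symm
  refine Nat.card_congr (Equiv.ofBijective
    (fun g => ⟨_, span_topRows_mem_positroid hf h g.2⟩) ⟨fun g g' he => ?_, ?_⟩)
  · refine Subtype.ext (Units.ext ?_)
    exact g.2.1.eq_of_span_eq g'.2.1 h.grassmannian hf.le_card (congrArg Subtype.val he)
  · rintro ⟨V, hV⟩
    obtain ⟨g, hg, he⟩ := exists_normalForm_of_mem_positroid hf h hV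
    exact ⟨⟨g, hg⟩, Subtype.ext he⟩

theorem card_positroid_eq_substTopTerm [Fintype F] (hf : IsBoundedAffine k n f)
    (h : IsAffineOf k f v w) {a b : List (Fin (n - 1))} (ha : IsReducedWord a v)
    (hb : IsReducedWord b w) :
    (Nat.card (positroid F k n f) : ℝ) = ((Fintype.card F : ℝ) - 1) ^ (n - 1)
      * substTopTerm (homfly (braidClosure (braidOfWord b * (braidOfWord a)⁻¹)))
          (Real.sqrt (Fintype.card F)) := by
  have hq : (1 : ℝ) < Fintype.card F := by exact_mod_cast Fintype.one_lt_card (α := F)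
  have hs : (Real.sqrt (Fintype.card F)) ^ 2 = (Fintype.card F : ℝ) := Real.sq_sqrt (by linarith)
  have h1 := aeval_klR_eq_substTerm (t := Real.sqrt (Fintype.card F))
    (Real.sqrt_ne_zero'.2 (by linarith)) (by rw [hs]; exact hq.ne') ha hb
  have h2 := card_richardson (F := F) v w
  rw [hs] at h1
  rw [substTopTerm, homfly_degree_eq ha hb h.le, WithBot.unbotD_coe, ← h1, card_positroid hf h]
  have h3 : ((Nat.card (richardson F v w) : ℤ) : ℝ)
      = (((klR v w).eval (Fintype.card F : ℤ) : ℤ) : ℝ) := by rw [h2]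
  rw [Int.cast_natCast] at h3
  rw [h3, ← Int.cast_natCast (R := ℝ) (Fintype.card F), ← eq_intCast (algebraMap ℤ ℝ),
    ← eq_intCast (algebraMap ℤ ℝ), Polynomial.aeval_algebraMap_apply, Polynomial.coe_aeval_eq_eval]

end PositroidCount

/-! ### The theorem -/

theorem theorem2p1 (n : ℕ) [NeZero n] :
    -- the HOMFLY polynomial of the closure of `β(w) β(v)⁻¹`, for all `v`, `w` and all choices
    -- `b`, `a` of reduced words
    (∀ (v w : Equiv.Perm (Fin n)) (a b : List (Fin (n - 1))),
      IsReducedWord a v → IsReducedWord b w →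
        (¬ BruhatLE v w →
          (homfly (braidClosure (braidOfWord b * (braidOfWord a)⁻¹))).degree
            < (topDegree v w : WithBot ℤ)) ∧
        (BruhatLE v w →
          (homfly (braidClosure (braidOfWord b * (braidOfWord a)⁻¹))).degree
            = (topDegree v w : WithBot ℤ)) ∧
        -- an identity in the field `ℚ(t)`, where `t = q^{1/2}`
        Polynomial.aeval ((RatFunc.X : RatFunc ℚ) ^ 2) (klR v w)
          = ((RatFunc.X : RatFunc ℚ) ^ 2 - 1) ^ (n - 1)
            * substTerm (homfly (braidClosure (braidOfWord b * (braidOfWord a)⁻¹)))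
                (topDegree v w) (RatFunc.X : RatFunc ℚ)) ∧
    -- point counts of open Richardson varieties
    (∀ (v w : Equiv.Perm (Fin n)) (F : Type*) [Field F] [Fintype F],
      (Nat.card (richardson F v w) : ℤ) = (klR v w).eval (Fintype.card F : ℤ)) ∧
    -- point counts of open positroid varieties
    (∀ (k : ℕ) (f : ℤ → ℤ), IsBoundedAffine k n f →
      (∃! p : Equiv.Perm (Fin n) × Equiv.Perm (Fin n), IsAffineOf k f p.1 p.2) ∧
      ∀ (v w : Equiv.Perm (Fin n)) (a b : List (Fin (n - 1))),
        IsAffineOf k f v w → IsReducedWord a v → IsReducedWord b w →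
          ∀ (F : Type*) [Field F] [Fintype F],
            (Nat.card (positroid F k n f) : ℝ)
              = ((Fintype.card F : ℝ) - 1) ^ (n - 1)
                * substTopTerm (homfly (braidClosure (braidOfWord b * (braidOfWord a)⁻¹)))
                    (Real.sqrt (Fintype.card F))) := by
  refine ⟨fun v w a b ha hb => ⟨homfly_degree_lt ha hb, homfly_degree_eq ha hb, ?_⟩,
    fun v w F _ _ => card_richardson v w, fun k f hf => ⟨hf.existsUnique, ?_⟩⟩
  · have hX : (RatFunc.X : RatFunc ℚ) ≠ 0 := RatFunc.X_ne_zero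
    have hX' : (RatFunc.X : RatFunc ℚ) ^ 2 ≠ 1 := by
      intro h
      rw [← RatFunc.algebraMap_X, ← map_pow, ← map_one (algebraMap (Polynomial ℚ) (RatFunc ℚ))] at h
      have h1 := congrArg Polynomial.natDegree (RatFunc.algebraMap_injective ℚ h)
      rw [Polynomial.natDegree_X_pow, Polynomial.natDegree_one] at h1
      omega
    refine Eq.trans ?_ (aeval_klR_eq_substTerm hX hX' ha hb)
    exact congrArg (fun φ => Polynomial.eval₂ φ ((RatFunc.X : RatFunc ℚ) ^ 2) (klR v w))
      (RingHom.ext_int _ _)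
  · intro v w a b h ha hb F _ _
    exact card_positroid_eq_substTopTerm hf h ha hb
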